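/- Let $(M^n,g)$, $n\ge 3$, be a smooth Riemannian manifold (Hausdorff, second countable, without boundary) with Levi-Civita connection $\nabla$, curvature tensor $Rm(X,Y)Z=[\nabla_X,\nabla_Y]Z-\nabla_{[X,Y]}Z$, Ricci tensor $Ric(Y,Z)=\operatorname{tr}(X\mapsto Rm(X,Y)Z)$ and scalar curvature $R=\operatorname{tr}_g Ric$. Let $m$ be a positive integer and let $f,\varphi,\lambda$ be smooth real functions on $M$ with $f>0$ such that $(M,g,f,\varphi,\lambda)$ is a Ricci-Hessian type manifold, i.e. $$Ric+\nabla^2\varphi=\lambda g+\frac{m}{f}\nabla^2 f .$$ Suppose that $g$ has harmonic Weyl tensor: the Weyl tensor $$W(X,Y)Z=Rm(X,Y)Z-\tfrac{1}{n-2}\big(Ric(Y,Z)X-Ric(X,Z)Y+g(Y,Z)Ric(X)-g(X,Z)Ric(Y)\big)+\tfrac{R}{(n-1)(n-2)}\big(g(Y,Z)X-g(X,Z)Y\big)$$ satisfies $\operatorname{div}W=0$, where $(\operatorname{div}W)(X,Y,Z)=\operatorname{tr}\big(v\mapsto(\nabla_vW)(X,Y)Z\big)$; if $n=3$ (where $W$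 vanishes identically) this is understood to mean that $(M,g)$ is locally conformally flat. Then $$\big[(m+n-2)Ric(\nabla f,\cdot)-f\,Ric(\nabla\varphi,\cdot)+(n-2)\nabla^2\varphi(\nabla f,\cdot)\big]\wedge df=(n-1)\,f\,\Omega(\nabla\varphi,\nabla f),$$ where $\alpha\wedge\beta=\alpha\otimes\beta-\beta\otimes\alpha$ for 1-forms and $\Omega(X,Y)(U,V)=g(Rm(U,V)X,Y)$. In particular, if $\nabla\varphi$ is normal to the $f$-hypersurfaces (the level sets $f^{-1}(c)$ of regular values $c$ of $f$), then at every point where $\nabla f\neq0$ the vector $\nabla f$ is an eigenvector of the Ricci tensor. -/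

import Mathlib

open scoped Manifold ContDiff

noncomputable section

namespace RicciHessian

/-! ### Riemannian geometry in one coordinate system

Here `G y i j` are the components `g_{ij}(y)` of a metric in local coordinates `y`. Indices of tensor
components are written in the order of their arguments; an upper index comes first. -/

section Coordinates

variable {n : ℕ}

/-- The partial derivative `∂_i F` at `y`. -/
def pd (i : Fin n) (F : EuclideanSpace ℝ (Fin n) → ℝ) (y : EuclideanSpace ℝ (Fin n)) : ℝ :=
  fderiv ℝ F y (EuclideanSpace.single i 1)

variable (G : EuclideanSpace ℝ (Fin n) → Matrix (Fin n) (Fin n) ℝ)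

/-- The Christoffel symbol `Γ^k_{ij}` of the Levi-Civita connection,
`∇_{∂_i} ∂_j = ∑_k Γ^k_{ij} ∂_k`. -/
def christoffel (k i j : Fin n) (y : EuclideanSpace ℝ (Fin n)) : ℝ :=
  (1 / 2) * ∑ l, (G y)⁻¹ k l *
    (pd i (fun z => G z j l) y + pd j (fun z => G z i l) y - pd l (fun z => G z i j) y)

/-- The curvature tensor `Rm(X,Y)Z = [∇_X, ∇_Y]Z - ∇_{[X,Y]}Z`: the `l`-th component of
`Rm(∂_i, ∂_j)∂_k`. -/
def riem (l i j k : Fin n) (y : EuclideanSpace ℝ (Fin n)) : ℝ :=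
  pd i (christoffel G l j k) y - pd j (christoffel G l i k) y
    + ∑ s, (christoffel G l i s y * christoffel G s j k y
        - christoffel G l j s y * christoffel G s i k y)

/-- The Ricci tensor `Ric(Y,Z) = tr (X ↦ Rm(X,Y)Z)`. -/
def ric (j k : Fin n) (y : EuclideanSpace ℝ (Fin n)) : ℝ :=
  ∑ i, riem G i i j k y

/-- The Ricci tensor as a (1,1)-tensor, `g(Ric X, Y) = Ric(X,Y)`. -/
def ricEnd (y : EuclideanSpace ℝ (Fin n)) : Matrix (Fin n) (Fin n) ℝ :=
  fun l j => ∑ k, (G y)⁻¹ l k * ric G k j y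

/-- The scalar curvature, the trace of the Ricci tensor. -/
def scal (y : EuclideanSpace ℝ (Fin n)) : ℝ :=
  ∑ i, ricEnd G y i i

/-- The Weyl tensor as a (1,3)-tensor: the `l`-th component of `W(∂_i, ∂_j)∂_k`, where
`W(X,Y)Z = Rm(X,Y)Z
  - (Ric(Y,Z)X - Ric(X,Z)Y + g(Y,Z)Ric(X) - g(X,Z)Ric(Y)) / (n-2)
  + R (g(Y,Z)X - g(X,Z)Y) / ((n-1)(n-2))`. -/
def weyl (l i j k : Fin n) (y : EuclideanSpace ℝ (Fin n)) : ℝ :=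
  riem G l i j k y
    - (1 / ((n : ℝ) - 2)) *
      (ric G j k y * (1 : Matrix (Fin n) (Fin n) ℝ) l i
        - ric G i k y * (1 : Matrix (Fin n) (Fin n) ℝ) l j
        + G y j k * ricEnd G y l i - G y i k * ricEnd G y l j)
    + (scal G y / (((n : ℝ) - 1) * ((n : ℝ) - 2))) *
      (G y j k * (1 : Matrix (Fin n) (Fin n) ℝ) l i
        - G y i k * (1 : Matrix (Fin n) (Fin n) ℝ) l j)

/-- The covariant derivative of the Weyl tensor: the `l`-th component of
`(∇_{∂_a} W)(∂_i, ∂_j)∂_k`. -/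
def nablaWeyl (a l i j k : Fin n) (y : EuclideanSpace ℝ (Fin n)) : ℝ :=
  pd a (weyl G l i j k) y
    + ∑ s, (christoffel G l a s y * weyl G s i j k y
        - christoffel G s a i y * weyl G l s j k y
        - christoffel G s a j y * weyl G l i s k y
        - christoffel G s a k y * weyl G l i j s y)

/-- The divergence of the Weyl tensor, `(div W)(X,Y,Z) = tr (v ↦ (∇_v W)(X,Y)Z)`. -/
def divWeyl (i j k : Fin n) (y : EuclideanSpace ℝ (Fin n)) : ℝ :=
  ∑ l, nablaWeyl G l l i j k y

/-- The Hessian `∇²F = ∇dF` of a function. -/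
def hess (F : EuclideanSpace ℝ (Fin n) → ℝ) (i j : Fin n) (y : EuclideanSpace ℝ (Fin n)) : ℝ :=
  pd i (pd j F) y - ∑ k, christoffel G k i j y * pd k F y

/-- The components of the gradient `∇F`. -/
def grad (F : EuclideanSpace ℝ (Fin n) → ℝ) (y : EuclideanSpace ℝ (Fin n)) : Fin n → ℝ :=
  fun i => ∑ j, (G y)⁻¹ i j * pd j F y

/-- The curvature form `Ω(X,Y)(U,V) = g(Rm(U,V)X, Y)` for `U = ∂_i`, `V = ∂_j` and vectors `X`, `Y`
given by their components. -/
def curvForm (X Y : Fin n → ℝ) (i j : Fin n) (y : EuclideanSpace ℝ (Fin n)) : ℝ :=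
  ∑ k, ∑ l, ∑ s, G y l s * riem G l i j k y * X k * Y s

/-- The 1-form `(m+n-2) Ric(∇f,·) - f Ric(∇φ,·) + (n-2) ∇²φ(∇f,·)`. -/
def mainForm (m : ℕ) (f φ : EuclideanSpace ℝ (Fin n) → ℝ) (i : Fin n)
    (y : EuclideanSpace ℝ (Fin n)) : ℝ :=
  ((m : ℝ) + n - 2) * ∑ k, ric G k i y * grad G f y k
    - f y * ∑ k, ric G k i y * grad G φ y k
    + ((n : ℝ) - 2) * ∑ k, hess G φ k i y * grad G f y k

end Coordinates

/-- The wedge product `α ∧ β = α ⊗ β - β ⊗ α` of covectors given by their components. -/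
def wedge {n : ℕ} (α β : Fin n → ℝ) (i j : Fin n) : ℝ := α i * β j - β i * α j

/-! ### Riemannian manifolds

A tensor on `M` is described by its components in all charts of the smooth structure (the maximal
atlas), so an identity between tensors means that it holds for the components in each such chart. -/

section Manifold

variable {n : ℕ} {M : Type*} [TopologicalSpace M]
  [ChartedSpace (EuclideanSpace ℝ (Fin n)) M] [IsManifold (𝓡 n) ∞ M]

/-- The coordinate vector field `∂_i` of the chart `e`, at the point with coordinates `y`. -/
def coordVec (e : OpenPartialHomeomorph M (EuclideanSpace ℝ (Fin n)))
    (i : Fin n) (y : EuclideanSpace ℝ (Fin n)) : TangentSpace (𝓡 n) (e.symm y) :=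
  mfderiv (𝓡 n) (𝓡 n) e.symm y (EuclideanSpace.single i (1 : ℝ) : EuclideanSpace ℝ (Fin n))

variable (g : Bundle.ContMDiffRiemannianMetric (𝓡 n) ∞ (EuclideanSpace ℝ (Fin n))
    (fun x : M => TangentSpace (𝓡 n) x))

/-- The components `g_{ij} = g(∂_i, ∂_j)` of the metric in the chart `e`. -/
def chartMetric (e : OpenPartialHomeomorph M (EuclideanSpace ℝ (Fin n)))
    (y : EuclideanSpace ℝ (Fin n)) : Matrix (Fin n) (Fin n) ℝ :=
  fun i j => g.inner (e.symm y) (coordVec e i y) (coordVec e j y)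

/-- The function `F` on `M` written in the coordinates of the chart `e`. -/
def chartFun (F : M → ℝ) (e : OpenPartialHomeomorph M (EuclideanSpace ℝ (Fin n))) :
    EuclideanSpace ℝ (Fin n) → ℝ :=
  fun y => F (e.symm y)

/-- `(M, g, f, φ, lam)` is a Ricci-Hessian type manifold (with the positive integer `m`):
`Ric + ∇²φ = lam g + (m / f) ∇²f` with `f`, `φ`, `lam` smooth and `f` positive. -/
structure IsRicciHessianType (m : ℕ) (f φ lam : M → ℝ) : Prop where
  m_pos : 0 < m
  smooth_f : ContMDiff (𝓡 n) 𝓘(ℝ, ℝ) ∞ f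
  smooth_φ : ContMDiff (𝓡 n) 𝓘(ℝ, ℝ) ∞ φ
  smooth_lam : ContMDiff (𝓡 n) 𝓘(ℝ, ℝ) ∞ lam
  f_pos : ∀ p, 0 < f p
  equation : ∀ e ∈ IsManifold.maximalAtlas (𝓡 n) ∞ M, ∀ y ∈ e.target, ∀ i j,
    ric (chartMetric g e) i j y + hess (chartMetric g e) (chartFun φ e) i j y
      = chartFun lam e y * chartMetric g e y i j
        + (m / chartFun f e y) * hess (chartMetric g e) (chartFun f e) i j y

/-- Local conformal flatness: around each point there is a diffeomorphism `e⁻¹` from an open subset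
of Euclidean space onto a neighbourhood of the point with `(e⁻¹)^* g = u² g_0`, `u` positive and
smooth. (The smooth diffeomorphisms from open subsets of `M` onto open subsets of Euclidean space
are exactly the members of the maximal atlas.) -/
def IsLocallyConformallyFlat : Prop :=
  ∀ p : M, ∃ e ∈ IsManifold.maximalAtlas (𝓡 n) ∞ M, p ∈ e.source ∧
    ∃ u : EuclideanSpace ℝ (Fin n) → ℝ, ContDiffOn ℝ ∞ u e.target ∧ (∀ y ∈ e.target, 0 < u y) ∧
      ∀ y ∈ e.target, chartMetric g e y = (u y) ^ 2 • (1 : Matrix (Fin n) (Fin n) ℝ)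

/-- Harmonic Weyl tensor: `div W = 0`, which in dimension three (where `W` itself vanishes
identically) is understood as local conformal flatness. -/
def HasHarmonicWeyl : Prop :=
  (∀ e ∈ IsManifold.maximalAtlas (𝓡 n) ∞ M, ∀ y ∈ e.target, ∀ i j k,
    divWeyl (chartMetric g e) i j k y = 0) ∧
  (n = 3 → IsLocallyConformallyFlat g)

/-- `c` is a regular value of `f`. -/
def IsRegularValue (n : ℕ) {M : Type*} [TopologicalSpace M]
    [ChartedSpace (EuclideanSpace ℝ (Fin n)) M] (f : M → ℝ) (c : ℝ) : Prop :=
  ∀ p, f p = c → mfderiv (𝓡 n) 𝓘(ℝ, ℝ) f p ≠ 0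

/-- `∇φ` is normal on the `f`-hypersurfaces, the level sets `f⁻¹(c)` of regular values `c`:
`g(∇φ, v) = dφ(v) = 0` for each `v` tangent to such a level set, i.e. in the kernel of `df`. -/
def GradNormalOnLevels (n : ℕ) {M : Type*} [TopologicalSpace M]
    [ChartedSpace (EuclideanSpace ℝ (Fin n)) M] (f φ : M → ℝ) : Prop :=
  ∀ c, IsRegularValue n f c → ∀ p, f p = c → ∀ v : TangentSpace (𝓡 n) p,
    mfderiv (𝓡 n) 𝓘(ℝ, ℝ) f p v = 0 → mfderiv (𝓡 n) 𝓘(ℝ, ℝ) φ p v = 0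

end Manifold

end RicciHessian

end

namespace RicciHessian

noncomputable section

/-! Multiplied by `f`, the defining equation reads `f (Ric + ∇²φ) = λ f g + m ∇²f`. Differentiate it
covariantly and antisymmetrise in the direction of differentiation and the first slot. The third
derivatives of `φ` and `f` turn into curvature terms (`IsNormalAt.pd_hess_antisymm`). The
derivatives of `Ric` are controlled by the Weyl condition, which makes `Ric - R g / (2 (n - 1))` a
Codazzi tensor: for `n ≥ 4` because `div W` is `(n - 3) / (n - 2)` times its antisymmetrised
derivative (`IsNormalAt.isCodazziAt_of_divWeyl`), for `n = 3` by a computation in a conformally flat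
chart (`isCodazziAt_of_conformal`). There remains an algebraic relation between `df`, `Ric + ∇²φ`, a
1-form `s` and the curvature applied to `dφ` and `df`. Its trace determines `s`; its contraction
with `∇f` loses the `m`-term, since `Ω(∇f, ∇f) = 0`. Eliminating `s` gives the wedge identity
(`wedge_eq_of_codazzi`).

The differentiation is carried out at the centre of a normal chart (`exists_normal_chart`), where
covariant derivatives are partial derivatives. Both sides of the identity are tensors, so the
transformation rules under `IsIsometryOn` carry it to every chart.

For the eigenvector statement, the regular values of `f` are dense by Sard's theorem
(`volume_image_critical_eq_zero`), so `dφ ∧ df = 0` wherever `df ≠ 0`, not only on regular levels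
(`GradNormalOnLevels.wedge_eq_zero`). At a point write `dφ = c df`; the right side of the wedge
identity then vanishes. The derivative of `dφ ∧ df = 0` and the defining equation express the
remaining wedges with `df` through `∇²f(∇f, ·) ∧ df`, whose coefficient becomes `(m - f c)² + (n -
2) m > 0`. Hence `Ric(∇f, ·) ∧ df = 0` (`IsMetricOn.exists_eigenvalue`). -/

theorem two_le_infty : (2 : WithTop ℕ∞) ≤ ∞ :=
  WithTop.coe_le_coe.2 (le_top : (2 : ℕ∞) ≤ ⊤)

/-! ### Calculus of partial derivatives. -/

section Calculus

variable {n : ℕ} {U : Set (EuclideanSpace ℝ (Fin n))}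
  {F H : EuclideanSpace ℝ (Fin n) → ℝ} {y : EuclideanSpace ℝ (Fin n)}

theorem _root_.ContDiffOn.differentiableAt_of_isOpen (hF : ContDiffOn ℝ ∞ F U) (hU : IsOpen U)
    (hy : y ∈ U) : DifferentiableAt ℝ F y :=
  (hF.contDiffAt (hU.mem_nhds hy)).differentiableAt (by simp)

theorem contDiffOn_pd (hU : IsOpen U) (hF : ContDiffOn ℝ ∞ F U) (i : Fin n) :
    ContDiffOn ℝ ∞ (pd i F) U :=
  (hF.fderiv_of_isOpen hU (by simp)).clm_apply contDiffOn_const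

theorem pd_congr (h : F =ᶠ[nhds y] H) (i : Fin n) : pd i F y = pd i H y := by
  simp only [pd, h.fderiv_eq]

theorem pd_congr_on (hU : IsOpen U) (hy : y ∈ U) (h : ∀ z ∈ U, F z = H z) (i : Fin n) :
    pd i F y = pd i H y :=
  pd_congr (Filter.eventuallyEq_of_mem (hU.mem_nhds hy) h) i

theorem pd_const (c : ℝ) (i : Fin n) : pd i (fun _ => c) y = 0 := by
  simp [pd]

theorem pd_add (hF : DifferentiableAt ℝ F y) (hH : DifferentiableAt ℝ H y) (i : Fin n) :
    pd i (fun z => F z + H z) y = pd i F y + pd i H y := by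
  simp only [pd, fderiv_fun_add hF hH, _root_.add_apply]

theorem pd_sub (hF : DifferentiableAt ℝ F y) (hH : DifferentiableAt ℝ H y) (i : Fin n) :
    pd i (fun z => F z - H z) y = pd i F y - pd i H y := by
  simp only [pd, fderiv_fun_sub hF hH, _root_.sub_apply]

theorem pd_neg (i : Fin n) : pd i (fun z => -F z) y = -pd i F y := by
  simp only [pd, fderiv_fun_neg, _root_.neg_apply]

theorem pd_mul (hF : DifferentiableAt ℝ F y) (hH : DifferentiableAt ℝ H y) (i : Fin n) :
    pd i (fun z => F z * H z) y = pd i F y * H y + F y * pd i H y := by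
  simp only [pd, fderiv_fun_mul hF hH, _root_.add_apply,
    _root_.smul_apply, smul_eq_mul]
  ring

theorem pd_const_mul (hF : DifferentiableAt ℝ F y) (c : ℝ) (i : Fin n) :
    pd i (fun z => c * F z) y = c * pd i F y := by
  rw [pd_mul (differentiableAt_const c) hF, pd_const]
  ring

theorem pd_sum {ι : Type*} (s : Finset ι) {A : ι → EuclideanSpace ℝ (Fin n) → ℝ}
    (hA : ∀ a ∈ s, DifferentiableAt ℝ (A a) y) (i : Fin n) :
    pd i (fun z => ∑ a ∈ s, A a z) y = ∑ a ∈ s, pd i (A a) y := by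
  simp only [pd, fderiv_fun_sum hA, _root_.sum_apply]

theorem pd_comm (hU : IsOpen U) (hF : ContDiffOn ℝ ∞ F U) (hy : y ∈ U) (i j : Fin n) :
    pd i (pd j F) y = pd j (pd i F) y := by
  have hF' : ContDiffAt ℝ ∞ F y := hF.contDiffAt (hU.mem_nhds hy)
  have hd : DifferentiableAt ℝ (fderiv ℝ F) y :=
    (hF'.fderiv_right (m := 1) (by
      rw [one_add_one_eq_two]
      exact two_le_infty)).differentiableAt (by simp)
  have key : ∀ a b : Fin n, pd a (pd b F) y
      = fderiv ℝ (fderiv ℝ F) y (EuclideanSpace.single a 1) (EuclideanSpace.single b 1) := by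
    intro a b
    have : pd b F = fun z => fderiv ℝ F z (EuclideanSpace.single b 1) := rfl
    rw [pd, this, fderiv_clm_apply hd (differentiableAt_const _)]
    simp
  rw [key, key]
  exact (hF'.isSymmSndFDerivAt (by
    rw [minSmoothness_of_isRCLikeNormedField]
    exact two_le_infty)) _ _

theorem fderiv_eq_sum_pd (v : EuclideanSpace ℝ (Fin n)) :
    fderiv ℝ F y v = ∑ i, pd i F y * v i := by
  have hv : v = ∑ i, v i • EuclideanSpace.single i (1 : ℝ) := by
    ext k
    simp [Finset.sum_apply, Pi.single_apply]
  conv_lhs => rw [hv]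
  simp [pd, mul_comm]

end Calculus

/-! ### Calculus of matrix-valued functions. -/

section MatrixCalculus

variable {n : ℕ} {U : Set (EuclideanSpace ℝ (Fin n))}
  {A B : EuclideanSpace ℝ (Fin n) → Matrix (Fin n) (Fin n) ℝ} {y : EuclideanSpace ℝ (Fin n)}

/-- Smoothness on `U` of a matrix-valued function, entry by entry. -/
def SmoothMatrixOn (U : Set (EuclideanSpace ℝ (Fin n)))
    (A : EuclideanSpace ℝ (Fin n) → Matrix (Fin n) (Fin n) ℝ) : Prop :=
  ∀ k l, ContDiffOn ℝ ∞ (fun z => A z k l) U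

/-- The entrywise partial derivative of a matrix-valued function. -/
def pdMatrix (i : Fin n) (A : EuclideanSpace ℝ (Fin n) → Matrix (Fin n) (Fin n) ℝ)
    (y : EuclideanSpace ℝ (Fin n)) : Matrix (Fin n) (Fin n) ℝ :=
  fun k l => pd i (fun z => A z k l) y

theorem SmoothMatrixOn.mul (hA : SmoothMatrixOn U A) (hB : SmoothMatrixOn U B) :
    SmoothMatrixOn U (fun z => A z * B z) := fun k l => by
  simp only [Matrix.mul_apply]
  exact ContDiffOn.sum fun s _ => (hA k s).mul (hB s l)

theorem SmoothMatrixOn.add (hA : SmoothMatrixOn U A) (hB : SmoothMatrixOn U B) :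
    SmoothMatrixOn U (fun z => A z + B z) := fun k l => (hA k l).add (hB k l)

theorem SmoothMatrixOn.sub (hA : SmoothMatrixOn U A) (hB : SmoothMatrixOn U B) :
    SmoothMatrixOn U (fun z => A z - B z) := fun k l => (hA k l).sub (hB k l)

theorem SmoothMatrixOn.transpose (hA : SmoothMatrixOn U A) :
    SmoothMatrixOn U (fun z => (A z).transpose) := fun k l => hA l k

theorem SmoothMatrixOn.pdMatrix (hU : IsOpen U) (hA : SmoothMatrixOn U A) (i : Fin n) :
    SmoothMatrixOn U (pdMatrix i A) := fun k l => contDiffOn_pd hU (hA k l) i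

theorem SmoothMatrixOn.det (hA : SmoothMatrixOn U A) :
    ContDiffOn ℝ ∞ (fun z => (A z).det) U := by
  simp only [Matrix.det_apply']
  exact ContDiffOn.sum fun σ _ => contDiffOn_const.mul
    (contDiffOn_prod fun i _ => hA (σ i) i)

/-- Cramer's rule: up to the factor `det⁻¹`, each entry of the inverse is the determinant of `A`
with one row replaced by a unit vector. -/
theorem SmoothMatrixOn.inv (hA : SmoothMatrixOn U A) (h : ∀ z ∈ U, (A z).det ≠ 0) :
    SmoothMatrixOn U (fun z => (A z)⁻¹) := fun k l => by
  simp only [Matrix.inv_def, Ring.inverse_eq_inv', Matrix.smul_apply, smul_eq_mul,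
    Matrix.adjugate_apply]
  refine (hA.det.inv h).mul (SmoothMatrixOn.det fun a b => ?_)
  by_cases hal : a = l
  · subst hal
    simpa using contDiffOn_const
  · simpa [Matrix.updateRow_ne hal] using hA a b

theorem pdMatrix_congr_on (hU : IsOpen U) (hy : y ∈ U) (h : ∀ z ∈ U, A z = B z) (i : Fin n) :
    pdMatrix i A y = pdMatrix i B y := by
  ext k l
  exact pd_congr_on hU hy (fun z hz => by rw [h z hz]) i

theorem pdMatrix_mul (hU : IsOpen U) (hy : y ∈ U) (hA : SmoothMatrixOn U A)
    (hB : SmoothMatrixOn U B) (i : Fin n) :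
    pdMatrix i (fun z => A z * B z) y = pdMatrix i A y * B y + A y * pdMatrix i B y := by
  ext k l
  simp only [pdMatrix, Matrix.add_apply, Matrix.mul_apply]
  rw [pd_sum _ fun s _ => ((hA k s).mul (hB s l)).differentiableAt_of_isOpen hU hy,
    ← Finset.sum_add_distrib]
  exact Finset.sum_congr rfl fun s _ => pd_mul
    ((hA k s).differentiableAt_of_isOpen hU hy) ((hB s l).differentiableAt_of_isOpen hU hy) i

theorem pdMatrix_add (hU : IsOpen U) (hy : y ∈ U) (hA : SmoothMatrixOn U A)
    (hB : SmoothMatrixOn U B) (i : Fin n) :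
    pdMatrix i (fun z => A z + B z) y = pdMatrix i A y + pdMatrix i B y := by
  ext k l
  exact pd_add ((hA k l).differentiableAt_of_isOpen hU hy)
    ((hB k l).differentiableAt_of_isOpen hU hy) i

theorem pdMatrix_sub (hU : IsOpen U) (hy : y ∈ U) (hA : SmoothMatrixOn U A)
    (hB : SmoothMatrixOn U B) (i : Fin n) :
    pdMatrix i (fun z => A z - B z) y = pdMatrix i A y - pdMatrix i B y := by
  ext k l
  exact pd_sub ((hA k l).differentiableAt_of_isOpen hU hy)
    ((hB k l).differentiableAt_of_isOpen hU hy) i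

theorem pdMatrix_transpose (i : Fin n) :
    pdMatrix i (fun z => (A z).transpose) y = (pdMatrix i A y).transpose := rfl

theorem pdMatrix_comm (hU : IsOpen U) (hy : y ∈ U) (hA : SmoothMatrixOn U A) (i j : Fin n) :
    pdMatrix i (pdMatrix j A) y = pdMatrix j (pdMatrix i A) y := by
  ext k l
  exact pd_comm hU (hA k l) hy i j

end MatrixCalculus


/-! ### Levi-Civita connection, curvature and Hessian of a metric in coordinates. -/

section LocalMetric

variable {n : ℕ}

/-- `G` gives the components of a smooth Riemannian metric on the open set `U`. -/
structure IsMetricOn (U : Set (EuclideanSpace ℝ (Fin n)))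
    (G : EuclideanSpace ℝ (Fin n) → Matrix (Fin n) (Fin n) ℝ) : Prop where
  isOpen : IsOpen U
  smooth : SmoothMatrixOn U G
  posDef : ∀ y ∈ U, (G y).PosDef

/-- The connection matrices `(Γ_i)^k_j = Γ^k_{ij}`. -/
def connMatrix (G : EuclideanSpace ℝ (Fin n) → Matrix (Fin n) (Fin n) ℝ) (i : Fin n)
    (y : EuclideanSpace ℝ (Fin n)) : Matrix (Fin n) (Fin n) ℝ :=
  fun k j => christoffel G k i j y

/-- The curvature matrices `(Rm(∂_i, ∂_j))^l_k`. -/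
def curvMatrix (G : EuclideanSpace ℝ (Fin n) → Matrix (Fin n) (Fin n) ℝ) (i j : Fin n)
    (y : EuclideanSpace ℝ (Fin n)) : Matrix (Fin n) (Fin n) ℝ :=
  fun l k => riem G l i j k y

/-- The Ricci tensor as a matrix. -/
def ricMatrix (G : EuclideanSpace ℝ (Fin n) → Matrix (Fin n) (Fin n) ℝ)
    (y : EuclideanSpace ℝ (Fin n)) : Matrix (Fin n) (Fin n) ℝ :=
  fun j k => ric G j k y

/-- The fundamental lemma of Riemannian geometry in matrix form: a torsion-free metric connection
is given by the Koszul formula. -/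
theorem koszul_unique {g : Matrix (Fin n) (Fin n) ℝ} (hg : g.PosDef)
    {D A : Fin n → Matrix (Fin n) (Fin n) ℝ} (hD : ∀ i, D i = g * A i + (g * A i).transpose)
    (hA : ∀ i j k, A i k j = A j k i) (i j k : Fin n) :
    A i k j = (1 / 2) * ∑ l, g⁻¹ k l * (D i j l + D j i l - D l i j) := by
  have hdet : IsUnit g.det := hg.det_pos.ne'.isUnit
  have hL : ∀ a l b, (g * A a) l b = (g * A b) l a := fun a l b => by
    simp only [Matrix.mul_apply, hA a b]
  have h1 : ∀ l, D i j l + D j i l - D l i j = 2 * (g * A i) l j := fun l => by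
    simp only [hD, Matrix.add_apply, Matrix.transpose_apply]
    rw [hL i j l, hL j i l, hL l i j, hL j l i, hL i l j, hL l j i]
    have := hL i l j
    have := hL j i l
    linarith
  simp only [h1]
  have h2 : ∑ l, g⁻¹ k l * (2 * (g * A i) l j) = 2 * (g⁻¹ * (g * A i)) k j := by
    rw [Matrix.mul_apply, Finset.mul_sum]
    exact Finset.sum_congr rfl fun l _ => by ring
  rw [h2, Matrix.nonsing_inv_mul_cancel_left _ _ hdet]
  ring

variable {U : Set (EuclideanSpace ℝ (Fin n))}
  {G : EuclideanSpace ℝ (Fin n) → Matrix (Fin n) (Fin n) ℝ} {y : EuclideanSpace ℝ (Fin n)}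

namespace IsMetricOn

theorem apply_comm (hG : IsMetricOn U G) (hy : y ∈ U) (i j : Fin n) : G y i j = G y j i := by
  simpa using (hG.posDef y hy).isHermitian.apply j i

theorem transpose_eq (hG : IsMetricOn U G) (hy : y ∈ U) : (G y).transpose = G y := by
  ext i j
  exact hG.apply_comm hy j i

theorem det_ne_zero (hG : IsMetricOn U G) (hy : y ∈ U) : (G y).det ≠ 0 :=
  (hG.posDef y hy).det_pos.ne'

theorem isUnit_det (hG : IsMetricOn U G) (hy : y ∈ U) : IsUnit (G y).det :=
  (hG.det_ne_zero hy).isUnit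

theorem smooth_inv (hG : IsMetricOn U G) : SmoothMatrixOn U fun z => (G z)⁻¹ :=
  hG.smooth.inv fun _ hz => hG.det_ne_zero hz

theorem pd_comm_apply (hG : IsMetricOn U G) (hy : y ∈ U) (i j k : Fin n) :
    pd i (fun z => G z j k) y = pd i (fun z => G z k j) y :=
  pd_congr_on hG.isOpen hy (fun _ hz => hG.apply_comm hz j k) i

theorem christoffel_symm (hG : IsMetricOn U G) (hy : y ∈ U) (k i j : Fin n) :
    christoffel G k i j y = christoffel G k j i y := by
  unfold christoffel
  congr 1
  refine Finset.sum_congr rfl fun l _ => ?_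
  rw [hG.pd_comm_apply hy l i j]
  ring

theorem smooth_christoffel (hG : IsMetricOn U G) (k i j : Fin n) :
    ContDiffOn ℝ ∞ (christoffel G k i j) U := by
  unfold christoffel
  have hd := fun a b c => contDiffOn_pd hG.isOpen (hG.smooth a b) c
  exact contDiffOn_const.mul (ContDiffOn.sum fun l _ =>
    (hG.smooth_inv k l).mul (((hd j l i).add (hd i l j)).sub (hd i j l)))

theorem smooth_connMatrix (hG : IsMetricOn U G) (i : Fin n) :
    SmoothMatrixOn U (connMatrix G i) := fun k j => hG.smooth_christoffel k i j

theorem sum_mul_christoffel (hG : IsMetricOn U G) (hy : y ∈ U) (i j l : Fin n) :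
    (G y * connMatrix G i y) l j = (1 / 2) * (pd i (fun z => G z j l) y
      + pd j (fun z => G z i l) y - pd l (fun z => G z i j) y) := by
  have h : connMatrix G i y = (1 / 2 : ℝ) • ((G y)⁻¹ * Matrix.of fun l j =>
      (pd i (fun z => G z j l) y + pd j (fun z => G z i l) y - pd l (fun z => G z i j) y)) := by
    ext k j
    simp [connMatrix, christoffel, Matrix.mul_apply]
  rw [h, Matrix.mul_smul, Matrix.mul_nonsing_inv_cancel_left _ _ (hG.isUnit_det hy)]
  simp

/-- The Levi-Civita connection is metric: `∂_i g = g Γ_i + (g Γ_i)ᵀ`. -/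
theorem pdMatrix_eq (hG : IsMetricOn U G) (hy : y ∈ U) (i : Fin n) :
    pdMatrix i G y = G y * connMatrix G i y + (G y * connMatrix G i y).transpose := by
  ext k l
  rw [Matrix.add_apply, Matrix.transpose_apply, hG.sum_mul_christoffel hy,
    hG.sum_mul_christoffel hy, pdMatrix, hG.pd_comm_apply hy i l k, hG.pd_comm_apply hy k i l,
    hG.pd_comm_apply hy l i k]
  ring

/-- The form `dΓ + Γ ∧ Γ` of the curvature, which lets the later identities be proved by matrix
algebra without indices. -/
theorem curvMatrix_eq (G : EuclideanSpace ℝ (Fin n) → Matrix (Fin n) (Fin n) ℝ)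
    (i j : Fin n) (y : EuclideanSpace ℝ (Fin n)) :
    curvMatrix G i j y = pdMatrix i (connMatrix G j) y - pdMatrix j (connMatrix G i) y
      + (connMatrix G i y * connMatrix G j y - connMatrix G j y * connMatrix G i y) := by
  ext l k
  simp [curvMatrix, riem, pdMatrix, connMatrix, Matrix.mul_apply, Finset.sum_sub_distrib]

theorem smooth_curvMatrix (hG : IsMetricOn U G) (i j : Fin n) :
    SmoothMatrixOn U (curvMatrix G i j) := by
  have h := hG.smooth_connMatrix
  have : curvMatrix G i j = fun y => pdMatrix i (connMatrix G j) y - pdMatrix j (connMatrix G i) y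
      + (connMatrix G i y * connMatrix G j y - connMatrix G j y * connMatrix G i y) :=
    funext fun y => curvMatrix_eq G i j y
  rw [this]
  exact (((h j).pdMatrix hG.isOpen i).sub ((h i).pdMatrix hG.isOpen j)).add
    (((h i).mul (h j)).sub ((h j).mul (h i)))

theorem smooth_riem (hG : IsMetricOn U G) (l i j k : Fin n) :
    ContDiffOn ℝ ∞ (riem G l i j k) U := hG.smooth_curvMatrix i j l k

theorem smooth_ric (hG : IsMetricOn U G) (j k : Fin n) :
    ContDiffOn ℝ ∞ (ric G j k) U := by
  unfold ric
  exact ContDiffOn.sum fun i _ => hG.smooth_riem i i j k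

theorem smooth_ricMatrix (hG : IsMetricOn U G) : SmoothMatrixOn U (ricMatrix G) :=
  hG.smooth_ric

theorem smooth_ricEnd (hG : IsMetricOn U G) : SmoothMatrixOn U (ricEnd G) :=
  hG.smooth_inv.mul hG.smooth_ricMatrix

theorem smooth_scal (hG : IsMetricOn U G) : ContDiffOn ℝ ∞ (scal G) U := by
  unfold scal
  exact ContDiffOn.sum fun i _ => hG.smooth_ricEnd i i

theorem riem_antisymm (G : EuclideanSpace ℝ (Fin n) → Matrix (Fin n) (Fin n) ℝ)
    (l i j k : Fin n) (y : EuclideanSpace ℝ (Fin n)) :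
    riem G l i j k y = -riem G l j i k y := by
  simp only [riem, Finset.sum_sub_distrib]
  ring

/-- The curvature form is skew in its last two arguments: `g Rm(∂_i, ∂_j)` is skew-symmetric. -/
theorem mul_curvMatrix_transpose (hG : IsMetricOn U G) (hy : y ∈ U) (i j : Fin n) :
    (G y * curvMatrix G i j y).transpose = -(G y * curvMatrix G i j y) := by
  have hs := hG.smooth_connMatrix
  have hd : ∀ a b, pdMatrix a (pdMatrix b G) y
      = pdMatrix a G y * connMatrix G b y + G y * pdMatrix a (connMatrix G b) y
        + (pdMatrix a G y * connMatrix G b y + G y * pdMatrix a (connMatrix G b) y).transpose := by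
    intro a b
    rw [pdMatrix_congr_on hG.isOpen hy (fun z hz => hG.pdMatrix_eq hz b) a,
      pdMatrix_add hG.isOpen hy (hG.smooth.mul (hs b)) (hG.smooth.mul (hs b)).transpose,
      pdMatrix_transpose (A := fun z => G z * connMatrix G b z),
      pdMatrix_mul hG.isOpen hy hG.smooth (hs b)]
  -- Expanding `∂_i ∂_j g = ∂_j ∂_i g` by metric compatibility, applied twice, yields exactly the
  -- skewness of `g Rm`.
  have hc := pdMatrix_comm hG.isOpen hy hG.smooth i j
  rw [hd, hd, hG.pdMatrix_eq hy, hG.pdMatrix_eq hy] at hc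
  rw [curvMatrix_eq]
  simp only [Matrix.transpose_add, Matrix.transpose_mul, Matrix.transpose_transpose,
    Matrix.transpose_sub, hG.transpose_eq hy, add_mul, mul_add, mul_sub] at hc ⊢
  simp only [Matrix.mul_assoc] at hc ⊢
  rw [← sub_eq_zero] at hc ⊢
  rw [← hc]
  abel

theorem smooth_hess (hG : IsMetricOn U G) {F : EuclideanSpace ℝ (Fin n) → ℝ}
    (hF : ContDiffOn ℝ ∞ F U) (i j : Fin n) : ContDiffOn ℝ ∞ (hess G F i j) U := by
  unfold hess
  exact (contDiffOn_pd hG.isOpen (contDiffOn_pd hG.isOpen hF j) i).sub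
    (ContDiffOn.sum fun k _ => (hG.smooth_christoffel k i j).mul (contDiffOn_pd hG.isOpen hF k))

theorem hess_symm (hG : IsMetricOn U G) (hy : y ∈ U) {F : EuclideanSpace ℝ (Fin n) → ℝ}
    (hF : ContDiffOn ℝ ∞ F U) (i j : Fin n) : hess G F i j y = hess G F j i y := by
  simp only [hess, pd_comm hG.isOpen hF hy i j, hG.christoffel_symm hy _ i j]

end IsMetricOn

end LocalMetric


/-! ### Connection and curvature under a change of coordinates. -/

section Transition

variable {n : ℕ}

/-- The Jacobian matrix of a map between coordinate domains. -/
def jacobian (T : EuclideanSpace ℝ (Fin n) → EuclideanSpace ℝ (Fin n))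
    (y : EuclideanSpace ℝ (Fin n)) : Matrix (Fin n) (Fin n) ℝ :=
  fun a i => pd i (fun z => T z a) y

/-- `T` maps `U` to `U'` smoothly and pulls the metric `G'` back to `G`. -/
structure IsIsometryOn (U U' : Set (EuclideanSpace ℝ (Fin n)))
    (G G' : EuclideanSpace ℝ (Fin n) → Matrix (Fin n) (Fin n) ℝ)
    (T : EuclideanSpace ℝ (Fin n) → EuclideanSpace ℝ (Fin n)) : Prop where
  metric : IsMetricOn U G
  metric' : IsMetricOn U' G'
  smooth : ContDiffOn ℝ ∞ T U
  mapsTo : Set.MapsTo T U U'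
  pullback : ∀ y ∈ U, G y = (jacobian T y).transpose * G' (T y) * jacobian T y

/-- The connection matrices of `G'` pulled back along `T`. -/
def pulledConn (G' : EuclideanSpace ℝ (Fin n) → Matrix (Fin n) (Fin n) ℝ)
    (T : EuclideanSpace ℝ (Fin n) → EuclideanSpace ℝ (Fin n)) (i : Fin n)
    (y : EuclideanSpace ℝ (Fin n)) : Matrix (Fin n) (Fin n) ℝ :=
  ∑ a, jacobian T y a i • connMatrix G' a (T y)

variable {U U' : Set (EuclideanSpace ℝ (Fin n))}
  {G G' : EuclideanSpace ℝ (Fin n) → Matrix (Fin n) (Fin n) ℝ}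
  {T : EuclideanSpace ℝ (Fin n) → EuclideanSpace ℝ (Fin n)} {y : EuclideanSpace ℝ (Fin n)}

theorem jacobian_apply (hT : DifferentiableAt ℝ T y) (a i : Fin n) :
    jacobian T y a i = fderiv ℝ T y (EuclideanSpace.single i 1) a := by
  have h1 : HasFDerivAt (fun z => T z a)
      ((EuclideanSpace.proj a : EuclideanSpace ℝ (Fin n) →L[ℝ] ℝ).comp (fderiv ℝ T y)) y :=
    (EuclideanSpace.proj a : EuclideanSpace ℝ (Fin n) →L[ℝ] ℝ).hasFDerivAt.comp y
      hT.hasFDerivAt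
  simp [jacobian, pd, h1.fderiv]

theorem pd_comp {F : EuclideanSpace ℝ (Fin n) → ℝ} (hF : DifferentiableAt ℝ F (T y))
    (hT : DifferentiableAt ℝ T y) (i : Fin n) :
    pd i (fun z => F (T z)) y = ∑ a, pd a F (T y) * jacobian T y a i := by
  have h2 : fderiv ℝ (fun z => F (T z)) y = (fderiv ℝ F (T y)).comp (fderiv ℝ T y) :=
    fderiv_comp y hF hT
  rw [pd, h2, ContinuousLinearMap.comp_apply, fderiv_eq_sum_pd]
  simp only [jacobian_apply hT]

namespace IsIsometryOn

variable (h : IsIsometryOn U U' G G' T)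
include h

theorem differentiableAt (hy : y ∈ U) : DifferentiableAt ℝ T y :=
  (h.smooth.contDiffAt (h.metric.isOpen.mem_nhds hy)).differentiableAt (by simp)

theorem smooth_apply (a : Fin n) : ContDiffOn ℝ ∞ (fun z => T z a) U :=
  (EuclideanSpace.proj a : EuclideanSpace ℝ (Fin n) →L[ℝ] ℝ).contDiff.comp_contDiffOn h.smooth

theorem smooth_jacobian : SmoothMatrixOn U (jacobian T) := fun a i =>
  contDiffOn_pd h.metric.isOpen (h.smooth_apply a) i

theorem smooth_comp {F : EuclideanSpace ℝ (Fin n) → ℝ} (hF : ContDiffOn ℝ ∞ F U') :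
    ContDiffOn ℝ ∞ (fun z => F (T z)) U :=
  hF.comp h.smooth h.mapsTo

theorem smoothMatrix_comp {A : EuclideanSpace ℝ (Fin n) → Matrix (Fin n) (Fin n) ℝ}
    (hA : SmoothMatrixOn U' A) : SmoothMatrixOn U fun z => A (T z) :=
  fun k l => h.smooth_comp (hA k l)

theorem pd_comp_of_smooth (hy : y ∈ U) {F : EuclideanSpace ℝ (Fin n) → ℝ}
    (hF : ContDiffOn ℝ ∞ F U') (i : Fin n) :
    pd i (fun z => F (T z)) y = ∑ a, pd a F (T y) * jacobian T y a i :=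
  pd_comp (hF.differentiableAt_of_isOpen h.metric'.isOpen (h.mapsTo hy)) (h.differentiableAt hy) i

theorem pdMatrix_comp (hy : y ∈ U) {A : EuclideanSpace ℝ (Fin n) → Matrix (Fin n) (Fin n) ℝ}
    (hA : SmoothMatrixOn U' A) (i : Fin n) :
    pdMatrix i (fun z => A (T z)) y = ∑ a, jacobian T y a i • pdMatrix a A (T y) := by
  ext k l
  simp only [pdMatrix, h.pd_comp_of_smooth hy (hA k l), Matrix.sum_apply, Matrix.smul_apply,
    smul_eq_mul, mul_comm]

/-- The pulled back metric `Jᵀ G' J` is nondegenerate, so `J` is invertible without assuming that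
`T` is a diffeomorphism. -/
theorem det_jacobian_ne_zero (hy : y ∈ U) : (jacobian T y).det ≠ 0 := by
  have h1 := h.metric.det_ne_zero hy
  rw [h.pullback y hy, Matrix.det_mul] at h1
  exact right_ne_zero_of_mul h1

theorem isUnit_det_jacobian (hy : y ∈ U) : IsUnit (jacobian T y).det :=
  (h.det_jacobian_ne_zero hy).isUnit

theorem pd_jacobian_comm (hy : y ∈ U) (a i j : Fin n) :
    pd i (fun z => jacobian T z a j) y = pd j (fun z => jacobian T z a i) y :=
  pd_comm h.metric.isOpen (h.smooth_apply a) hy i j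

theorem smooth_pulledConn (i : Fin n) : SmoothMatrixOn U (pulledConn G' T i) := fun k l => by
  simp only [pulledConn, Matrix.sum_apply, Matrix.smul_apply, smul_eq_mul]
  exact ContDiffOn.sum fun a _ => (h.smooth_jacobian a i).mul
    (h.smooth_comp (h.metric'.smooth_connMatrix a k l))

/-- The transformation rule of the connection matrices. -/
theorem pdMatrix_jacobian (hy : y ∈ U) (i : Fin n) :
    pdMatrix i (jacobian T) y
      = jacobian T y * connMatrix G i y - pulledConn G' T i y * jacobian T y := by
  have hJ := h.smooth_jacobian
  have hG' := h.smoothMatrix_comp h.metric'.smooth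
  have hu := h.isUnit_det_jacobian hy
  have hA : ∀ i, jacobian T y * ((jacobian T y)⁻¹ *
      (pdMatrix i (jacobian T) y + pulledConn G' T i y * jacobian T y))
      = pdMatrix i (jacobian T) y + pulledConn G' T i y * jacobian T y :=
    fun i => Matrix.mul_nonsing_inv_cancel_left _ _ hu
  have hcomp : ∀ i, pdMatrix i (fun z => G' (T z)) y = G' (T y) * pulledConn G' T i y
      + (G' (T y) * pulledConn G' T i y).transpose := by
    intro i
    rw [h.pdMatrix_comp hy h.metric'.smooth]
    simp only [h.metric'.pdMatrix_eq (h.mapsTo hy), pulledConn, Finset.mul_sum,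
      Matrix.transpose_sum, ← Finset.sum_add_distrib, smul_add, Matrix.mul_smul,
      Matrix.transpose_smul]
  -- The candidate `J⁻¹ (∂_i J + Γ'_i J)`, with `Γ'` the pulled back connection, is metric for `G`
  -- and torsion-free. By uniqueness it is the Levi-Civita connection of `G`.
  have key := koszul_unique (h.metric.posDef y hy) (D := fun i => pdMatrix i G y)
    (A := fun i => (jacobian T y)⁻¹ *
      (pdMatrix i (jacobian T) y + pulledConn G' T i y * jacobian T y)) ?_ ?_
  · rw [eq_sub_iff_add_eq, ← hA i]
    congr 1
    ext k j
    rw [key i j k]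
    rfl
  · intro i
    rw [pdMatrix_congr_on h.metric.isOpen hy h.pullback i,
      pdMatrix_mul h.metric.isOpen hy (hJ.transpose.mul hG') hJ,
      pdMatrix_mul h.metric.isOpen hy hJ.transpose hG', pdMatrix_transpose, hcomp, h.pullback y hy,
      Matrix.mul_assoc _ (jacobian T y) _, hA]
    simp only [Matrix.transpose_add, Matrix.transpose_mul, Matrix.transpose_transpose,
      h.metric'.transpose_eq (h.mapsTo hy), add_mul, mul_add, Matrix.mul_assoc]
    abel
  · intro i j k
    have hs : ∀ a, (pdMatrix i (jacobian T) y + pulledConn G' T i y * jacobian T y) a j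
        = (pdMatrix j (jacobian T) y + pulledConn G' T j y * jacobian T y) a i := by
      intro a
      have h1 : ∀ i j, (pulledConn G' T i y * jacobian T y) a j
          = ∑ b, ∑ c, jacobian T y c i * connMatrix G' c (T y) a b * jacobian T y b j := by
        intro i j
        simp only [pulledConn, Matrix.mul_apply, Matrix.sum_apply, Matrix.smul_apply, smul_eq_mul,
          Finset.sum_mul]
      rw [Matrix.add_apply, Matrix.add_apply, h1, h1, Finset.sum_comm]
      congr 1
      · exact h.pd_jacobian_comm hy a i j
      · refine Finset.sum_congr rfl fun b _ => Finset.sum_congr rfl fun c _ => ?_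
        have : connMatrix G' b (T y) a c = connMatrix G' c (T y) a b :=
          h.metric'.christoffel_symm (h.mapsTo hy) a b c
        rw [this]
        ring
    change ((jacobian T y)⁻¹ * (_ : Matrix (Fin n) (Fin n) ℝ)) k j
      = ((jacobian T y)⁻¹ * (_ : Matrix (Fin n) (Fin n) ℝ)) k i
    rw [Matrix.mul_apply, Matrix.mul_apply]
    exact Finset.sum_congr rfl fun a _ => by rw [hs]

/-- The curvature of the pulled back connection is the pulled back curvature. -/
theorem curv_pulledConn (hy : y ∈ U) (i j : Fin n) :
    pdMatrix i (pulledConn G' T j) y - pdMatrix j (pulledConn G' T i) y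
      + (pulledConn G' T i y * pulledConn G' T j y - pulledConn G' T j y * pulledConn G' T i y)
      = ∑ a, ∑ b, (jacobian T y a i * jacobian T y b j) • curvMatrix G' a b (T y) := by
  have hd : ∀ i j, pdMatrix i (pulledConn G' T j) y
      = ∑ b, pd i (fun z => jacobian T z b j) y • connMatrix G' b (T y)
        + ∑ a, ∑ b, (jacobian T y a i * jacobian T y b j) •
          pdMatrix a (connMatrix G' b) (T y) := by
    intro i j
    rw [Finset.sum_comm, ← Finset.sum_add_distrib]
    ext k l
    have hs : ∀ b, ContDiffOn ℝ ∞ (fun z => connMatrix G' b (T z) k l) U := fun b =>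
      h.smoothMatrix_comp (h.metric'.smooth_connMatrix b) k l
    simp only [pdMatrix, pulledConn, Matrix.sum_apply, Matrix.smul_apply, smul_eq_mul,
      Matrix.add_apply]
    rw [pd_sum _ fun b _ => ((h.smooth_jacobian b j).mul (hs b)).differentiableAt_of_isOpen
      h.metric.isOpen hy]
    refine Finset.sum_congr rfl fun b _ => ?_
    rw [pd_mul ((h.smooth_jacobian b j).differentiableAt_of_isOpen h.metric.isOpen hy)
      ((hs b).differentiableAt_of_isOpen h.metric.isOpen hy),
      h.pd_comp_of_smooth hy (h.metric'.smooth_connMatrix b k l), Finset.mul_sum]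
    congr 1
    exact Finset.sum_congr rfl fun a _ => by ring
  have hp : ∀ i j, pulledConn G' T i y * pulledConn G' T j y
      = ∑ a, ∑ b, (jacobian T y a i * jacobian T y b j) •
          (connMatrix G' a (T y) * connMatrix G' b (T y)) := by
    intro i j
    simp only [pulledConn, Finset.sum_mul, Finset.mul_sum, Matrix.smul_mul, Matrix.mul_smul,
      smul_smul]
    rw [Finset.sum_comm]
    exact Finset.sum_congr rfl fun a _ => Finset.sum_congr rfl fun b _ => by rw [mul_comm]
  have hswap : ∀ X : Fin n → Fin n → Matrix (Fin n) (Fin n) ℝ,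
      ∑ a, ∑ b, (jacobian T y a j * jacobian T y b i) • X a b
        = ∑ a, ∑ b, (jacobian T y a i * jacobian T y b j) • X b a := by
    intro X
    rw [Finset.sum_comm]
    exact Finset.sum_congr rfl fun a _ => Finset.sum_congr rfl fun b _ => by rw [mul_comm]
  -- The second derivatives of `T` enter symmetrically in `i` and `j` and cancel in the difference.
  rw [hd i j, hd j i, hp i j, hp j i, hswap, hswap]
  simp only [IsMetricOn.curvMatrix_eq, h.pd_jacobian_comm hy _ j i, smul_add, smul_sub,
    Finset.sum_add_distrib, Finset.sum_sub_distrib]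
  abel

/-- The curvature is a tensor. -/
theorem jacobian_mul_curvMatrix (hy : y ∈ U) (i j : Fin n) :
    jacobian T y * curvMatrix G i j y
      = (∑ a, ∑ b, (jacobian T y a i * jacobian T y b j) • curvMatrix G' a b (T y))
        * jacobian T y := by
  have hJ := h.smooth_jacobian
  have hU := h.metric.isOpen
  have hd : ∀ a b, pdMatrix a (pdMatrix b (jacobian T)) y
      = pdMatrix a (jacobian T) y * connMatrix G b y
        + jacobian T y * pdMatrix a (connMatrix G b) y
        - (pdMatrix a (pulledConn G' T b) y * jacobian T y
          + pulledConn G' T b y * pdMatrix a (jacobian T) y) := by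
    intro a b
    have hc := h.metric.smooth_connMatrix b
    have hp := h.smooth_pulledConn b
    rw [pdMatrix_congr_on hU hy (fun z hz => h.pdMatrix_jacobian hz b) a,
      pdMatrix_sub hU hy (hJ.mul hc) (hp.mul hJ), pdMatrix_mul hU hy hJ hc,
      pdMatrix_mul hU hy hp hJ]
  -- The curvature rule is the integrability condition `∂_i ∂_j J = ∂_j ∂_i J` of the system `∂_i J
  -- = J Γ_i - Γ'_i J`.
  have hc := pdMatrix_comm hU hy hJ i j
  rw [hd, hd, h.pdMatrix_jacobian hy, h.pdMatrix_jacobian hy] at hc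
  rw [← h.curv_pulledConn hy, IsMetricOn.curvMatrix_eq]
  rw [← sub_eq_zero] at hc ⊢
  rw [← hc]
  noncomm_ring

end IsIsometryOn

end Transition


/-! ### Transformation rules of the tensors in the theorem. -/

section TensorTransition

variable {n : ℕ}

/-- The Codazzi equation `(∇_i A)_{jk} = (∇_j A)_{ik}` at `y` for the symmetric 2-tensor `A`. -/
def IsCodazziAt (G A : EuclideanSpace ℝ (Fin n) → Matrix (Fin n) (Fin n) ℝ)
    (y : EuclideanSpace ℝ (Fin n)) : Prop :=
  ∀ i j k, (pdMatrix i A y - A y * connMatrix G i y) j k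
    = (pdMatrix j A y - A y * connMatrix G j y) i k

/-- The Schouten tensor up to a constant factor, `Ric - R g / (2 (n - 1))`. -/
def schouten (G : EuclideanSpace ℝ (Fin n) → Matrix (Fin n) (Fin n) ℝ)
    (y : EuclideanSpace ℝ (Fin n)) : Matrix (Fin n) (Fin n) ℝ :=
  ricMatrix G y - (scal G y / (2 * ((n : ℝ) - 1))) • G y

theorem ricEnd_eq (G : EuclideanSpace ℝ (Fin n) → Matrix (Fin n) (Fin n) ℝ)
    (y : EuclideanSpace ℝ (Fin n)) : ricEnd G y = (G y)⁻¹ * ricMatrix G y := rfl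

theorem scal_eq (G : EuclideanSpace ℝ (Fin n) → Matrix (Fin n) (Fin n) ℝ)
    (y : EuclideanSpace ℝ (Fin n)) : scal G y = (ricEnd G y).trace := rfl

theorem grad_eq (G : EuclideanSpace ℝ (Fin n) → Matrix (Fin n) (Fin n) ℝ)
    (F : EuclideanSpace ℝ (Fin n) → ℝ) (y : EuclideanSpace ℝ (Fin n)) :
    grad G F y = (G y)⁻¹.mulVec fun j => pd j F y := rfl

theorem IsMetricOn.smooth_schouten {U : Set (EuclideanSpace ℝ (Fin n))}
    {G : EuclideanSpace ℝ (Fin n) → Matrix (Fin n) (Fin n) ℝ} (hG : IsMetricOn U G) :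
    SmoothMatrixOn U (schouten G) := fun k l =>
  (hG.smooth_ric k l).sub ((hG.smooth_scal.div_const _).mul (hG.smooth k l))

/-- Contracting one slot of a covariant 2-tensor with `v` amounts to contracting the transformed
tensor with the pushed forward vector `J v`. -/
theorem sum_mul_eq_of_tensor {J : Matrix (Fin n) (Fin n) ℝ} {B B' : Fin n → Fin n → ℝ} {v : Fin n → ℝ}
    (hB : ∀ i j, B i j = ∑ a, ∑ b, J a i * B' a b * J b j) (i : Fin n) :
    ∑ k, B k i * v k
      = ∑ b, (∑ a, B' a b * J.mulVec v a) * J b i := by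
  simp only [hB, Matrix.mulVec, dotProduct, Finset.mul_sum, Finset.sum_mul]
  rw [Finset.sum_comm_cycle]
  refine Finset.sum_congr rfl fun b _ => ?_
  rw [Finset.sum_comm]
  exact Finset.sum_congr rfl fun a _ => Finset.sum_congr rfl fun k _ => by ring

theorem curvForm_eq_dotProduct {G : EuclideanSpace ℝ (Fin n) → Matrix (Fin n) (Fin n) ℝ}
    {y : EuclideanSpace ℝ (Fin n)} (hG : (G y).transpose = G y) (X Y : Fin n → ℝ) (i j : Fin n) :
    curvForm G X Y i j y = Y ⬝ᵥ (G y * curvMatrix G i j y).mulVec X := by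
  rw [← hG]
  simp only [curvForm, Matrix.mulVec, dotProduct, Matrix.mul_apply, Finset.mul_sum,
    Finset.sum_mul, Matrix.transpose_apply, curvMatrix]
  rw [Finset.sum_comm_cycle]
  exact Finset.sum_congr rfl fun s _ => Finset.sum_congr rfl fun k _ =>
    Finset.sum_congr rfl fun l _ => by ring

namespace IsIsometryOn

variable {U U' : Set (EuclideanSpace ℝ (Fin n))}
  {G G' : EuclideanSpace ℝ (Fin n) → Matrix (Fin n) (Fin n) ℝ}
  {T : EuclideanSpace ℝ (Fin n) → EuclideanSpace ℝ (Fin n)} {y : EuclideanSpace ℝ (Fin n)}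
  (h : IsIsometryOn U U' G G' T)
include h

/-- The Ricci tensor is a tensor. -/
theorem ricMatrix_eq (hy : y ∈ U) :
    ricMatrix G y = (jacobian T y).transpose * ricMatrix G' (T y) * jacobian T y := by
  have hu := h.isUnit_det_jacobian hy
  have hR : ∀ i j, curvMatrix G i j y = (jacobian T y)⁻¹ *
      ((∑ a, ∑ b, (jacobian T y a i * jacobian T y b j) • curvMatrix G' a b (T y))
        * jacobian T y) := fun i j => by
    rw [← h.jacobian_mul_curvMatrix hy, Matrix.nonsing_inv_mul_cancel_left _ _ hu]
  -- The trace defining `Ric` pairs a lower index carrying `J` with an upper one carrying `J⁻¹`.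
  have hI : ∀ a c, ∑ i, jacobian T y a i * (jacobian T y)⁻¹ i c = (1 : Matrix _ _ ℝ) a c := by
    intro a c
    rw [← Matrix.mul_apply, Matrix.mul_nonsing_inv _ hu]
  ext j k
  have h1 : ricMatrix G y j k = ∑ i, curvMatrix G i j y i k := rfl
  have h2 : ∀ i, curvMatrix G i j y i k = ∑ a, ∑ b, ∑ c, jacobian T y a i * (jacobian T y)⁻¹ i c *
      (jacobian T y b j * (curvMatrix G' a b (T y) * jacobian T y) c k) := by
    intro i
    rw [hR, Matrix.mul_apply]
    simp only [Finset.sum_mul, Matrix.smul_mul, Matrix.sum_apply, Matrix.smul_apply, smul_eq_mul,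
      Finset.mul_sum]
    rw [Finset.sum_comm]
    refine Finset.sum_congr rfl fun a _ => ?_
    rw [Finset.sum_comm]
    exact Finset.sum_congr rfl fun b _ => Finset.sum_congr rfl fun c _ => by ring
  have h3 : ricMatrix G y j k = ∑ a, ∑ b, ∑ c, (∑ i, jacobian T y a i * (jacobian T y)⁻¹ i c) *
      (jacobian T y b j * (curvMatrix G' a b (T y) * jacobian T y) c k) := by
    rw [h1]
    simp only [h2, Finset.sum_mul]
    rw [Finset.sum_comm]
    refine Finset.sum_congr rfl fun a _ => ?_
    rw [Finset.sum_comm]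
    refine Finset.sum_congr rfl fun b _ => ?_
    rw [Finset.sum_comm]
  rw [h3]
  simp only [hI, Matrix.one_apply, ite_mul, one_mul, zero_mul, Finset.sum_ite_eq,
    Finset.mem_univ, if_true]
  rw [Matrix.mul_assoc, Matrix.mul_apply, Finset.sum_comm]
  refine Finset.sum_congr rfl fun b _ => ?_
  rw [← Finset.mul_sum, Matrix.transpose_apply]
  congr 1
  simp only [Matrix.mul_apply]
  rw [Finset.sum_comm]
  refine Finset.sum_congr rfl fun d _ => ?_
  rw [← Finset.sum_mul]
  rfl

theorem inv_eq (hy : y ∈ U) :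
    (G y)⁻¹ = (jacobian T y)⁻¹ * ((G' (T y))⁻¹ * ((jacobian T y).transpose)⁻¹) := by
  rw [h.pullback y hy, Matrix.mul_inv_rev, Matrix.mul_inv_rev]

theorem jacobian_mul_ricEnd (hy : y ∈ U) :
    jacobian T y * ricEnd G y = ricEnd G' (T y) * jacobian T y := by
  have hu := h.isUnit_det_jacobian hy
  have hu' : IsUnit (jacobian T y).transpose.det := by rwa [Matrix.det_transpose]
  rw [ricEnd_eq, ricEnd_eq, h.inv_eq hy, h.ricMatrix_eq hy]
  simp only [Matrix.mul_assoc]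
  rw [Matrix.mul_nonsing_inv_cancel_left _ _ hu, Matrix.nonsing_inv_mul_cancel_left _ _ hu']

/-- The Ricci endomorphisms are conjugate by `J`, so they have the same trace. -/
theorem scal_eq (hy : y ∈ U) : scal G y = scal G' (T y) := by
  have hu := h.isUnit_det_jacobian hy
  rw [RicciHessian.scal_eq, RicciHessian.scal_eq,
    ← Matrix.nonsing_inv_mul_cancel_left _ (ricEnd G y) hu, h.jacobian_mul_ricEnd hy,
    Matrix.trace_mul_comm, Matrix.mul_nonsing_inv_cancel_right _ _ hu]

theorem schouten_eq (hy : y ∈ U) :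
    schouten G y = (jacobian T y).transpose * schouten G' (T y) * jacobian T y := by
  simp only [schouten, h.ricMatrix_eq hy, h.scal_eq hy, h.pullback y hy, Matrix.mul_sub,
    Matrix.sub_mul, Matrix.mul_smul, Matrix.smul_mul]

/-- The Codazzi equation does not depend on the coordinates. -/
theorem isCodazziAt {A A' : EuclideanSpace ℝ (Fin n) → Matrix (Fin n) (Fin n) ℝ} (hy : y ∈ U)
    (hA' : SmoothMatrixOn U' A')
    (hA : ∀ z ∈ U, A z = (jacobian T z).transpose * A' (T z) * jacobian T z)
    (hcod : IsCodazziAt G' A' (T y)) : IsCodazziAt G A y := by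
  have hJ := h.smooth_jacobian
  have hU := h.metric.isOpen
  have hAT := h.smoothMatrix_comp hA'
  -- Only the correction `A_{js} Γ^s_{ik}` is kept: the other one, `Γ^s_{ij} A_{sk}`, is symmetric
  -- in `i, j` and drops out of the Codazzi equation. Likewise the non-tensorial term `(∂_i J)ᵀ A'
  -- J` below is symmetric in `i, j`, as it involves second derivatives of `T`.
  have hD : ∀ i, pdMatrix i A y - A y * connMatrix G i y
      = (pdMatrix i (jacobian T) y).transpose * (A' (T y) * jacobian T y)
        + (jacobian T y).transpose * ((∑ a, jacobian T y a i •
          (pdMatrix a A' (T y) - A' (T y) * connMatrix G' a (T y))) * jacobian T y) := by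
    intro i
    have hc : ∑ a, jacobian T y a i • (pdMatrix a A' (T y) - A' (T y) * connMatrix G' a (T y))
        = pdMatrix i (fun z => A' (T z)) y - A' (T y) * pulledConn G' T i y := by
      rw [h.pdMatrix_comp hy hA']
      simp only [pulledConn, Finset.mul_sum, Matrix.mul_smul, smul_sub, Finset.sum_sub_distrib]
    rw [hc, pdMatrix_congr_on hU hy hA i, pdMatrix_mul hU hy (hJ.transpose.mul hAT) hJ,
      pdMatrix_mul hU hy hJ.transpose hAT, pdMatrix_transpose, hA y hy]
    rw [h.pdMatrix_jacobian hy]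
    noncomm_ring
  intro i j k
  rw [hD, hD, Matrix.add_apply, Matrix.add_apply]
  congr 1
  · generalize A' (T y) * jacobian T y = N
    simp only [Matrix.mul_apply, Matrix.transpose_apply]
    refine Finset.sum_congr rfl fun a _ => ?_
    rw [show pdMatrix i (jacobian T) y a j = pdMatrix j (jacobian T) y a i from
      h.pd_jacobian_comm hy a i j]
  · have hs : ∀ (P : Fin n → Matrix (Fin n) (Fin n) ℝ) (i j : Fin n),
        ((jacobian T y).transpose * ((∑ a, jacobian T y a i • P a) * jacobian T y)) j k
          = ∑ b, ∑ a, ∑ c,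
            jacobian T y b j * (jacobian T y a i * P a b c * jacobian T y c k) := by
      intro P i j
      simp only [Matrix.mul_apply, Matrix.sum_apply, Matrix.smul_apply, smul_eq_mul,
        Finset.sum_mul, Finset.mul_sum, Matrix.transpose_apply]
    rw [hs, hs, Finset.sum_comm]
    refine Finset.sum_congr rfl fun a _ => Finset.sum_congr rfl fun b _ =>
      Finset.sum_congr rfl fun c _ => ?_
    rw [hcod a b c]
    ring

variable {F F' : EuclideanSpace ℝ (Fin n) → ℝ}

theorem pd_eq (hy : y ∈ U) (hF' : ContDiffOn ℝ ∞ F' U') (hF : ∀ z ∈ U, F z = F' (T z))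
    (i : Fin n) : pd i F y = ∑ a, pd a F' (T y) * jacobian T y a i := by
  rw [pd_congr_on h.metric.isOpen hy hF, h.pd_comp_of_smooth hy hF']

theorem jacobian_mulVec_grad (hy : y ∈ U) (hF' : ContDiffOn ℝ ∞ F' U')
    (hF : ∀ z ∈ U, F z = F' (T z)) :
    (jacobian T y).mulVec (grad G F y) = grad G' F' (T y) := by
  have hu := h.isUnit_det_jacobian hy
  have hu' : IsUnit (jacobian T y).transpose.det := by rwa [Matrix.det_transpose]
  have hd : (fun j => pd j F y) = (jacobian T y).transpose.mulVec fun a => pd a F' (T y) := by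
    ext j
    simp [h.pd_eq hy hF' hF, Matrix.mulVec, dotProduct, mul_comm]
  rw [grad_eq, grad_eq, hd, h.inv_eq hy, Matrix.mulVec_mulVec, Matrix.mulVec_mulVec,
    ← Matrix.mul_assoc, Matrix.mul_nonsing_inv _ hu, Matrix.one_mul, Matrix.mul_assoc,
    Matrix.nonsing_inv_mul _ hu', Matrix.mul_one]

/-- The Hessian is a tensor. -/
theorem hess_eq (hy : y ∈ U) (hF' : ContDiffOn ℝ ∞ F' U') (hF : ∀ z ∈ U, F z = F' (T z))
    (i j : Fin n) :
    hess G F i j y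
      = ∑ a, ∑ b, jacobian T y a i * hess G' F' a b (T y) * jacobian T y b j := by
  have hU := h.metric.isOpen
  have hp : ∀ a, ContDiffOn ℝ ∞ (pd a F') U' := contDiffOn_pd h.metric'.isOpen hF'
  have h1 : pd i (pd j F) y = ∑ b, ((∑ a, pd a (pd b F') (T y) * jacobian T y a i)
      * jacobian T y b j + pd b F' (T y) * pdMatrix i (jacobian T) y b j) := by
    rw [pd_congr_on hU hy (fun z hz => h.pd_eq hz hF' hF j), pd_sum _ fun b _ =>
      ((h.smooth_comp (hp b)).mul (h.smooth_jacobian b j)).differentiableAt_of_isOpen hU hy]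
    refine Finset.sum_congr rfl fun b _ => ?_
    rw [pd_mul ((h.smooth_comp (hp b)).differentiableAt_of_isOpen hU hy)
      ((h.smooth_jacobian b j).differentiableAt_of_isOpen hU hy), h.pd_comp_of_smooth hy (hp b)]
    rfl
  have h2 : ∑ k, christoffel G k i j y * pd k F y
      = ∑ b, pd b F' (T y) * (jacobian T y * connMatrix G i y) b j := by
    simp only [h.pd_eq hy hF' hF, Matrix.mul_apply, Finset.mul_sum]
    rw [Finset.sum_comm]
    exact Finset.sum_congr rfl fun b _ => Finset.sum_congr rfl fun k _ => by
      simp only [connMatrix]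
      ring
  have h3 : ∑ b, pd b F' (T y) * (pulledConn G' T i y * jacobian T y) b j
      = ∑ a, ∑ b, jacobian T y a i * (∑ c, christoffel G' c a b (T y) * pd c F' (T y))
        * jacobian T y b j := by
    simp only [pulledConn, Matrix.mul_apply, Matrix.sum_apply, Matrix.smul_apply, smul_eq_mul,
      Finset.sum_mul, Finset.mul_sum]
    rw [Finset.sum_comm_cycle]
    refine Finset.sum_congr rfl fun a _ => ?_
    rw [Finset.sum_comm]
    refine Finset.sum_congr rfl fun b _ => Finset.sum_congr rfl fun c _ => ?_
    simp only [connMatrix]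
    ring
  rw [hess, h1, h2, h.pdMatrix_jacobian hy]
  simp only [hess, mul_sub, sub_mul, Matrix.sub_apply, Finset.sum_add_distrib,
    Finset.sum_sub_distrib, ← h3]
  have h4 : ∑ b, (∑ a, pd a (pd b F') (T y) * jacobian T y a i) * jacobian T y b j
      = ∑ a, ∑ b, jacobian T y a i * pd a (pd b F') (T y) * jacobian T y b j := by
    rw [Finset.sum_comm]
    refine Finset.sum_congr rfl fun b _ => ?_
    rw [Finset.sum_mul]
    exact Finset.sum_congr rfl fun a _ => by ring
  rw [h4]
  ring

theorem ric_eq (hy : y ∈ U) (i j : Fin n) : ric G i j y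
    = ∑ a, ∑ b, jacobian T y a i * ric G' a b (T y) * jacobian T y b j := by
  have := congrFun (congrFun (h.ricMatrix_eq hy) i) j
  rw [show ric G i j y = ricMatrix G y i j from rfl, this]
  simp only [Matrix.mul_apply, Matrix.transpose_apply, Finset.sum_mul]
  rw [Finset.sum_comm]
  rfl

variable {f f' φ φ' : EuclideanSpace ℝ (Fin n) → ℝ}

theorem mainForm_eq (hy : y ∈ U) (hf' : ContDiffOn ℝ ∞ f' U') (hf : ∀ z ∈ U, f z = f' (T z))
    (hφ' : ContDiffOn ℝ ∞ φ' U') (hφ : ∀ z ∈ U, φ z = φ' (T z)) (m : ℕ) (i : Fin n) :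
    mainForm G m f φ i y = ∑ b, mainForm G' m f' φ' b (T y) * jacobian T y b i := by
  have hr := h.ric_eq hy
  simp only [mainForm, sum_mul_eq_of_tensor hr, sum_mul_eq_of_tensor (h.hess_eq hy hφ' hφ),
    h.jacobian_mulVec_grad hy hf' hf, h.jacobian_mulVec_grad hy hφ' hφ, hf y hy]
  simp only [add_mul, sub_mul, Finset.sum_add_distrib, Finset.sum_sub_distrib, Finset.mul_sum,
    Finset.sum_mul, mul_assoc]

theorem curvForm_eq (hy : y ∈ U) (X Y : Fin n → ℝ) (i j : Fin n) :
    curvForm G X Y i j y = ∑ a, ∑ b, jacobian T y a i * jacobian T y b j *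
      curvForm G' ((jacobian T y).mulVec X) ((jacobian T y).mulVec Y) a b (T y) := by
  rw [curvForm_eq_dotProduct (h.metric.transpose_eq hy)]
  simp only [curvForm_eq_dotProduct (h.metric'.transpose_eq (h.mapsTo hy))]
  rw [h.pullback y hy, Matrix.mul_assoc, h.jacobian_mul_curvMatrix hy, Matrix.mul_assoc,
    ← Matrix.mul_assoc (G' (T y)), ← Matrix.mulVec_mulVec, ← Matrix.mulVec_mulVec,
    Matrix.dotProduct_mulVec, Matrix.vecMul_transpose]
  simp only [Finset.mul_sum, Matrix.mul_smul, Matrix.sum_mulVec, Matrix.smul_mulVec,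
    dotProduct_sum, dotProduct_smul, smul_eq_mul]

end IsIsometryOn

end TensorTransition


/-! ### The wedge identity at the centre of normal coordinates. -/

section NormalPoint

variable {n : ℕ}

/-- The algebraic part of the identity, in an orthonormal frame: `K l i j k` are the curvature
components, `a = df`, `b = dφ`, `P = ∇²φ`. -/
theorem wedge_eq_of_codazzi {K : Fin n → Fin n → Fin n → Fin n → ℝ}
    {Ri P : Fin n → Fin n → ℝ} {a b s : Fin n → ℝ} {f m : ℝ}
    (hK1 : ∀ l i j k, K l i j k = -K l j i k) (hK2 : ∀ l i j k, K l i j k = -K k i j l)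
    (hRi : ∀ j k, Ri j k = ∑ i, K i i j k) (hsym : ∀ j k, Ri j k = Ri k j)
    (hP : ∀ j k, P j k = P k j)
    (h : ∀ i j k, a i * (Ri j k + P j k) - a j * (Ri i k + P i k)
      + s i * (1 : Matrix (Fin n) (Fin n) ℝ) j k - s j * (1 : Matrix (Fin n) (Fin n) ℝ) i k
      = f * ∑ l, K l i j k * b l - m * ∑ l, K l i j k * a l) (i j : Fin n) :
    wedge (fun i => (m + n - 2) * ∑ k, Ri k i * a k - f * ∑ k, Ri k i * b k
        + ((n : ℝ) - 2) * ∑ k, P k i * a k) a i j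
      = ((n : ℝ) - 1) * f * ∑ k, ∑ l, K l i j k * b k * a l := by
  -- Using both skew-symmetries, the trace over the last two slots is again the Ricci tensor.
  have htr : ∀ i l, ∑ j, K l i j j = Ri l i := by
    intro i l
    rw [hsym, hRi]
    exact Finset.sum_congr rfl fun j _ => by rw [hK2, hK1, neg_neg]
  have hTK : ∀ i (v : Fin n → ℝ), ∑ j, ∑ l, K l i j j * v l = ∑ k, Ri k i * v k := by
    intro i v
    rw [Finset.sum_comm]
    exact Finset.sum_congr rfl fun l _ => by rw [← Finset.sum_mul, htr]
  -- Setting `j = k` and summing: `s_i δ_jj - s_j δ_ij` contributes `(n - 1) s_i`.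
  have hs : ∀ i, ((n : ℝ) - 1) * s i = f * ∑ k, Ri k i * b k - m * ∑ k, Ri k i * a k
      - a i * ∑ j, (Ri j j + P j j) + (∑ k, Ri k i * a k + ∑ k, P k i * a k) := by
    intro i
    have h1 : ∑ j, (a i * (Ri j j + P j j) - a j * (Ri i j + P i j)
        + s i * (1 : Matrix (Fin n) (Fin n) ℝ) j j - s j * (1 : Matrix (Fin n) (Fin n) ℝ) i j)
        = ∑ j, (f * ∑ l, K l i j j * b l - m * ∑ l, K l i j j * a l) :=
      Finset.sum_congr rfl fun j _ => h i j j
    rw [Finset.sum_sub_distrib, Finset.sum_sub_distrib, ← Finset.mul_sum, ← Finset.mul_sum, hTK,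
      hTK, Finset.sum_add_distrib, Finset.sum_sub_distrib] at h1
    have h2 : ∑ j, a j * (Ri i j + P i j) = ∑ k, Ri k i * a k + ∑ k, P k i * a k := by
      rw [← Finset.sum_add_distrib]
      exact Finset.sum_congr rfl fun j _ => by rw [hsym i j, hP i j]; ring
    rw [h2, ← Finset.mul_sum] at h1
    simp only [Matrix.one_apply, if_true, mul_one, mul_ite, mul_zero, Finset.sum_const,
      Finset.card_univ, Fintype.card_fin, nsmul_eq_mul, Finset.sum_ite_eq, Finset.mem_univ] at h1
    linarith
  -- This is `Ω(∇f, ∇f) = 0`; it removes the `m`-term when the relation is contracted with `a`.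
  have hz : ∑ k, ∑ l, K l i j k * a l * a k = 0 := by
    have : ∑ k, ∑ l, K l i j k * a l * a k = -∑ k, ∑ l, K l i j k * a l * a k := by
      conv_lhs => rw [Finset.sum_comm]
      simp only [← Finset.sum_neg_distrib]
      exact Finset.sum_congr rfl fun k _ => Finset.sum_congr rfl fun l _ => by
        rw [hK2]; ring
    linarith
  have hb : ∑ k, ∑ l, K l i j k * b l * a k = -∑ k, ∑ l, K l i j k * b k * a l := by
    rw [Finset.sum_comm]
    simp only [← Finset.sum_neg_distrib]
    exact Finset.sum_congr rfl fun k _ => Finset.sum_congr rfl fun l _ => by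
      rw [hK2]; ring
  have hc : a i * (∑ k, Ri k j * a k + ∑ k, P k j * a k)
      - a j * (∑ k, Ri k i * a k + ∑ k, P k i * a k) + s i * a j - s j * a i
      = -(f * ∑ k, ∑ l, K l i j k * b k * a l) := by
    have h1 : ∑ k, (a i * (Ri j k + P j k) - a j * (Ri i k + P i k)
        + s i * (1 : Matrix (Fin n) (Fin n) ℝ) j k
        - s j * (1 : Matrix (Fin n) (Fin n) ℝ) i k) * a k
        = ∑ k, (f * ∑ l, K l i j k * b l - m * ∑ l, K l i j k * a l) * a k :=
      Finset.sum_congr rfl fun k _ => by rw [h i j k]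
    have h2 : ∀ i, ∑ k, (Ri i k + P i k) * a k = ∑ k, Ri k i * a k + ∑ k, P k i * a k := by
      intro i
      rw [← Finset.sum_add_distrib]
      exact Finset.sum_congr rfl fun k _ => by rw [hsym i k, hP i k]; ring
    simp only [add_mul _ _ (a _), sub_mul _ _ (a _), Finset.sum_add_distrib,
      Finset.sum_sub_distrib, mul_assoc, ← Finset.mul_sum] at h1
    simp only [add_mul, Finset.sum_add_distrib] at h2
    simp only [h2] at h1
    have h3 : ∀ v : Fin n → ℝ, ∑ k, (∑ l, K l i j k * v l) * a k
        = ∑ k, ∑ l, K l i j k * v l * a k := fun v =>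
      Finset.sum_congr rfl fun k _ => by rw [Finset.sum_mul]
    simp only [h3, hz, hb, mul_zero, sub_zero, Matrix.one_apply, ite_mul, one_mul, zero_mul,
      Finset.sum_ite_eq, Finset.mem_univ, if_true] at h1
    rw [h1]
    ring
  have hi := hs i
  have hj := hs j
  unfold wedge
  -- The unwanted trace of `Ri + P` occurs in `s` only as a multiple of `a`, so wedging with `a`
  -- removes it.
  linear_combination (a j) * hi - (a i) * hj - ((n : ℝ) - 1) * hc

variable {U : Set (EuclideanSpace ℝ (Fin n))}
  {G : EuclideanSpace ℝ (Fin n) → Matrix (Fin n) (Fin n) ℝ} {y : EuclideanSpace ℝ (Fin n)}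

namespace IsMetricOn

variable (hG : IsMetricOn U G) (hy : y ∈ U)
include hG hy

theorem pd_ric (a j k : Fin n) : pd a (ric G j k) y = ∑ i, pd a (riem G i i j k) y := by
  rw [show ric G j k = fun z => ∑ i, riem G i i j k z from rfl,
    pd_sum _ fun i _ => (hG.smooth_riem i i j k).differentiableAt_of_isOpen hG.isOpen hy]

theorem pd_riem_antisymm (a l i j k : Fin n) :
    pd a (riem G l i j k) y = -pd a (riem G l j i k) y := by
  rw [← pd_neg]
  exact pd_congr_on hG.isOpen hy (fun z _ => IsMetricOn.riem_antisymm G l i j k z) a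

theorem pd_ric_comm (hsym : ∀ z ∈ U, ∀ i j, ric G i j z = ric G j i z) (a i j : Fin n) : pd a (ric G i j) y = pd a (ric G j i) y :=
  pd_congr_on hG.isOpen hy (fun z hz => hsym z hz i j) a

end IsMetricOn

/-- `y` is the centre of normal coordinates, up to first order. -/
structure IsNormalAt (G : EuclideanSpace ℝ (Fin n) → Matrix (Fin n) (Fin n) ℝ)
    (y : EuclideanSpace ℝ (Fin n)) : Prop where
  eq_one : G y = 1
  conn_eq_zero : ∀ i, connMatrix G i y = 0

namespace IsNormalAt

variable (hN : IsNormalAt G y)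
include hN

theorem christoffel_eq (k i j : Fin n) : christoffel G k i j y = 0 :=
  congrFun (congrFun (hN.conn_eq_zero i) k) j

theorem inv_eq_one : (G y)⁻¹ = 1 := by rw [hN.eq_one, inv_one]

theorem grad_eq (F : EuclideanSpace ℝ (Fin n) → ℝ) : grad G F y = fun i => pd i F y := by
  rw [RicciHessian.grad_eq, hN.inv_eq_one, Matrix.one_mulVec]

theorem riem_eq (l i j k : Fin n) : riem G l i j k y
    = pd i (christoffel G l j k) y - pd j (christoffel G l i k) y := by
  simp [riem, hN.christoffel_eq]

variable (hG : IsMetricOn U G) (hy : y ∈ U)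
include hG hy

theorem pd_metric (i j k : Fin n) : pd i (fun z => G z j k) y = 0 := by
  have := congrFun (congrFun (hG.pdMatrix_eq hy i) j) k
  simpa [hN.conn_eq_zero, pdMatrix] using this

/-- Differentiate `G G⁻¹ = 1`, where `∂G = 0` at the centre. Hence indices may be raised under a
derivative there. -/
theorem pd_inv (i j k : Fin n) : pd i (fun z => (G z)⁻¹ j k) y = 0 := by
  have h1 : pdMatrix i (fun z => G z * (G z)⁻¹) y = 0 := by
    rw [pdMatrix_congr_on hG.isOpen hy (B := fun _ => 1)
      (fun z hz => Matrix.mul_nonsing_inv _ (hG.isUnit_det hz))]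
    ext a b
    exact pd_const _ _
  rw [pdMatrix_mul hG.isOpen hy hG.smooth hG.smooth_inv,
    show pdMatrix i G y = 0 from by ext a b; exact hN.pd_metric hG hy i a b, hN.eq_one,
    zero_mul, zero_add, one_mul] at h1
  exact congrFun (congrFun h1 j) k

theorem pd_ricEnd (a i j : Fin n) :
    pd a (fun z => ricEnd G z i j) y = pd a (ric G i j) y := by
  have h1 : pdMatrix a (ricEnd G) y = pdMatrix a (ricMatrix G) y := by
    rw [show ricEnd G = fun z => (G z)⁻¹ * ricMatrix G z from rfl,
      pdMatrix_mul hG.isOpen hy hG.smooth_inv hG.smooth_ricMatrix,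
      show pdMatrix a (fun z => (G z)⁻¹) y = 0 from by ext b c; exact hN.pd_inv hG hy a b c,
      hN.inv_eq_one, zero_mul, zero_add, one_mul]
  exact congrFun (congrFun h1 i) j

theorem pd_scal (a : Fin n) : pd a (scal G) y = ∑ i, pd a (ric G i i) y := by
  rw [show scal G = fun z => ∑ i, ricEnd G z i i from rfl,
    pd_sum _ fun i _ => (hG.smooth_ricEnd i i).differentiableAt_of_isOpen hG.isOpen hy]
  exact Finset.sum_congr rfl fun i _ => hN.pd_ricEnd hG hy a i i

theorem riem_skew (l i j k : Fin n) : riem G l i j k y = -riem G k i j l y := by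
  have := congrFun (congrFun (hG.mul_curvMatrix_transpose hy i j) k) l
  simpa [hN.eq_one, curvMatrix] using this

theorem pd_riem_skew (a l i j k : Fin n) :
    pd a (riem G l i j k) y = -pd a (riem G k i j l) y := by
  have hs := hG.smooth.mul (hG.smooth_curvMatrix i j)
  have h1 : pdMatrix a (fun z => G z * curvMatrix G i j z) y = pdMatrix a (curvMatrix G i j) y := by
    rw [pdMatrix_mul hG.isOpen hy hG.smooth (hG.smooth_curvMatrix i j),
      show pdMatrix a G y = 0 from by ext b c; exact hN.pd_metric hG hy a b c, hN.eq_one,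
      zero_mul, zero_add, one_mul]
  have h2 : pd a (fun z => (G z * curvMatrix G i j z) l k) y
      = -pd a (fun z => (G z * curvMatrix G i j z) k l) y := by
    rw [← pd_neg]
    exact pd_congr_on hG.isOpen hy
      (fun z hz => congrFun (congrFun (hG.mul_curvMatrix_transpose hz i j) k) l) a
  calc pd a (riem G l i j k) y = pdMatrix a (curvMatrix G i j) y l k := rfl
    _ = pdMatrix a (fun z => G z * curvMatrix G i j z) y l k := by rw [h1]
    _ = -pdMatrix a (fun z => G z * curvMatrix G i j z) y k l := h2
    _ = -pdMatrix a (curvMatrix G i j) y k l := by rw [h1]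

/-- The quadratic terms `Γ Γ` have vanishing derivative at a point where `Γ` itself vanishes. The
second Bianchi identity then reduces to commuting partial derivatives of `Γ`. -/
theorem pd_riem (a l i j k : Fin n) : pd a (riem G l i j k) y
    = pd a (pd i (christoffel G l j k)) y - pd a (pd j (christoffel G l i k)) y := by
  have hU := hG.isOpen
  have hc := hG.smooth_connMatrix
  have h0 : ∀ i j, pdMatrix a (fun z => connMatrix G i z * connMatrix G j z) y = 0 := by
    intro i j
    rw [pdMatrix_mul hU hy (hc i) (hc j), hN.conn_eq_zero, hN.conn_eq_zero, zero_mul, mul_zero,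
      add_zero]
  have h1 : pdMatrix a (curvMatrix G i j) y = pdMatrix a (pdMatrix i (connMatrix G j)) y
      - pdMatrix a (pdMatrix j (connMatrix G i)) y := by
    rw [pdMatrix_congr_on hU hy (fun z _ => IsMetricOn.curvMatrix_eq G i j z),
      pdMatrix_add hU hy (((hc j).pdMatrix hU i).sub ((hc i).pdMatrix hU j))
        (((hc i).mul (hc j)).sub ((hc j).mul (hc i))),
      pdMatrix_sub hU hy ((hc j).pdMatrix hU i) ((hc i).pdMatrix hU j),
      pdMatrix_sub hU hy ((hc i).mul (hc j)) ((hc j).mul (hc i)), h0, h0, sub_zero, add_zero]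
  exact congrFun (congrFun h1 l) k

/-- The second Bianchi identity. -/
theorem bianchi (a l i j k : Fin n) :
    pd a (riem G l i j k) y + pd i (riem G l j a k) y + pd j (riem G l a i k) y = 0 := by
  have hc := fun b c => hG.smooth_christoffel l b c
  simp only [hN.pd_riem hG hy]
  rw [pd_comm hG.isOpen (hc j k) hy a i, pd_comm hG.isOpen (hc i k) hy a j,
    pd_comm hG.isOpen (hc a k) hy i j]
  ring

/-- The contracted second Bianchi identity. -/
theorem div_riem (i j k : Fin n) : ∑ l, pd l (riem G l i j k) y
    = pd i (ric G j k) y - pd j (ric G i k) y := by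
  rw [hG.pd_ric hy, hG.pd_ric hy, ← Finset.sum_sub_distrib]
  refine Finset.sum_congr rfl fun l _ => ?_
  have h1 := hN.bianchi hG hy l l i j k
  have h2 := hG.pd_riem_antisymm hy i l j l k
  linarith

variable (hsym : ∀ z ∈ U, ∀ i j, ric G i j z = ric G j i z)
include hsym

/-- The twice contracted second Bianchi identity, `div Ric = dR / 2`. -/
theorem div_ric (i : Fin n) : ∑ l, pd l (ric G l i) y = (1 / 2) * pd i (scal G) y := by
  have h1 : ∑ k, ∑ l, pd l (riem G l i k k) y = ∑ k, (pd i (ric G k k) y - pd k (ric G i k) y) :=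
    Finset.sum_congr rfl fun k _ => hN.div_riem hG hy i k k
  have h2 : ∑ k, ∑ l, pd l (riem G l i k k) y = ∑ l, pd l (ric G l i) y := by
    rw [Finset.sum_comm]
    refine Finset.sum_congr rfl fun l _ => ?_
    rw [hG.pd_ric_comm hy hsym, hG.pd_ric hy]
    exact Finset.sum_congr rfl fun k _ => by
      rw [hN.pd_riem_skew hG hy, hG.pd_riem_antisymm hy, neg_neg]
  rw [h2, Finset.sum_sub_distrib, ← hN.pd_scal hG hy,
    Finset.sum_congr rfl fun k _ => hG.pd_ric_comm hy hsym k i k] at h1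
  linarith

/-- At the centre the divergence is a sum of partial derivatives and metric factors are constant to
first order. The contracted Bianchi identities `div_riem` and `div_ric` express every divergence
that occurs. -/
theorem divWeyl_eq (i j k : Fin n) : divWeyl G i j k y
    = pd i (ric G j k) y - pd j (ric G i k) y
      - (1 / ((n : ℝ) - 2)) * (pd i (ric G j k) y - pd j (ric G i k) y
        + (1 : Matrix (Fin n) (Fin n) ℝ) j k * ((1 / 2) * pd i (scal G) y)
        - (1 : Matrix (Fin n) (Fin n) ℝ) i k * ((1 / 2) * pd j (scal G) y))
      + (1 / (((n : ℝ) - 1) * ((n : ℝ) - 2))) *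
        ((1 : Matrix (Fin n) (Fin n) ℝ) j k * pd i (scal G) y
          - (1 : Matrix (Fin n) (Fin n) ℝ) i k * pd j (scal G) y) := by
  have hU := hG.isOpen
  have dr : ∀ j k, DifferentiableAt ℝ (fun z => ric G j k z) y := fun j k =>
    (hG.smooth_ric j k).differentiableAt_of_isOpen hU hy
  have dR : ∀ l, DifferentiableAt ℝ (fun z => riem G l i j k z) y := fun l =>
    (hG.smooth_riem l i j k).differentiableAt_of_isOpen hU hy
  have dE : ∀ j k, DifferentiableAt ℝ (fun z => ricEnd G z j k) y := fun j k =>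
    (hG.smooth_ricEnd j k).differentiableAt_of_isOpen hU hy
  have dG : ∀ j k, DifferentiableAt ℝ (fun z => G z j k) y := fun j k =>
    (hG.smooth j k).differentiableAt_of_isOpen hU hy
  have dS : DifferentiableAt ℝ (fun z => scal G z) y :=
    hG.smooth_scal.differentiableAt_of_isOpen hU hy
  have key : ∀ l, nablaWeyl G l l i j k y = pd l (riem G l i j k) y
      - (1 / ((n : ℝ) - 2)) * ((1 : Matrix (Fin n) (Fin n) ℝ) l i * pd l (ric G j k) y
        - (1 : Matrix (Fin n) (Fin n) ℝ) l j * pd l (ric G i k) y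
        + (1 : Matrix (Fin n) (Fin n) ℝ) j k * pd l (ric G l i) y
        - (1 : Matrix (Fin n) (Fin n) ℝ) i k * pd l (ric G l j) y)
      + (1 / (((n : ℝ) - 1) * ((n : ℝ) - 2))) * (((1 : Matrix (Fin n) (Fin n) ℝ) j k *
          (1 : Matrix (Fin n) (Fin n) ℝ) l i - (1 : Matrix (Fin n) (Fin n) ℝ) i k *
          (1 : Matrix (Fin n) (Fin n) ℝ) l j) * pd l (scal G) y) := by
    intro l
    have e1 : weyl G l i j k = fun z => (riem G l i j k z
        - (1 / ((n : ℝ) - 2)) *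
        (((1 : Matrix (Fin n) (Fin n) ℝ) l i * ric G j k z
        - (1 : Matrix (Fin n) (Fin n) ℝ) l j * ric G i k z)
        + (G z j k * ricEnd G z l i - G z i k * ricEnd G z l j)))
        + (1 / (((n : ℝ) - 1) * ((n : ℝ) - 2))) * (scal G z *
        ((1 : Matrix (Fin n) (Fin n) ℝ) l i * G z j k
          - (1 : Matrix (Fin n) (Fin n) ℝ) l j * G z i k)) := by
      funext z
      simp only [weyl]
      ring
    have d1 := ((dr j k).const_mul ((1 : Matrix (Fin n) (Fin n) ℝ) l i)).fun_sub
      ((dr i k).const_mul ((1 : Matrix (Fin n) (Fin n) ℝ) l j))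
    have d2 := ((dG j k).fun_mul (dE l i)).fun_sub ((dG i k).fun_mul (dE l j))
    have d4 := ((dG j k).const_mul ((1 : Matrix (Fin n) (Fin n) ℝ) l i)).fun_sub
      ((dG i k).const_mul ((1 : Matrix (Fin n) (Fin n) ℝ) l j))
    have d3 := dS.fun_mul d4
    have e2 : pd l (weyl G l i j k) y = (pd l (riem G l i j k) y
        - (1 / ((n : ℝ) - 2)) *
        (((1 : Matrix (Fin n) (Fin n) ℝ) l i * pd l (ric G j k) y
        - (1 : Matrix (Fin n) (Fin n) ℝ) l j * pd l (ric G i k) y)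
        + ((pd l (fun z => G z j k) y * ricEnd G y l i + G y j k * pd l (fun z => ricEnd G z l i) y)
          - (pd l (fun z => G z i k) y * ricEnd G y l j
            + G y i k * pd l (fun z => ricEnd G z l j) y))))
        + (1 / (((n : ℝ) - 1) * ((n : ℝ) - 2))) * (pd l (scal G) y *
        ((1 : Matrix (Fin n) (Fin n) ℝ) l i * G y j k
          - (1 : Matrix (Fin n) (Fin n) ℝ) l j * G y i k)
        + scal G y * ((1 : Matrix (Fin n) (Fin n) ℝ) l i * pd l (fun z => G z j k) y
          - (1 : Matrix (Fin n) (Fin n) ℝ) l j * pd l (fun z => G z i k) y)) := by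
      rw [e1, pd_add ((dR l).fun_sub ((d1.fun_add d2).const_mul _)) (d3.const_mul _),
        pd_sub (dR l) ((d1.fun_add d2).const_mul _), pd_const_mul (d1.fun_add d2), pd_const_mul d3,
        pd_add d1 d2, pd_mul dS d4,
        pd_sub ((dr j k).const_mul _) ((dr i k).const_mul _),
        pd_sub ((dG j k).fun_mul (dE l i)) ((dG i k).fun_mul (dE l j)),
        pd_sub ((dG j k).const_mul _) ((dG i k).const_mul _), pd_mul (dG j k) (dE l i),
        pd_mul (dG i k) (dE l j), pd_const_mul (dr j k), pd_const_mul (dr i k),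
        pd_const_mul (dG j k), pd_const_mul (dG i k)]
    simp only [nablaWeyl, hN.christoffel_eq, zero_mul, sub_zero, Finset.sum_const_zero, add_zero]
    rw [e2]
    simp only [hN.pd_metric hG hy, hN.pd_ricEnd hG hy, hN.eq_one]
    ring
  rw [divWeyl, Finset.sum_congr rfl fun l _ => key l, Finset.sum_add_distrib,
    Finset.sum_sub_distrib, hN.div_riem hG hy, ← Finset.mul_sum, ← Finset.mul_sum]
  simp only [sub_mul, Finset.sum_add_distrib, Finset.sum_sub_distrib, mul_assoc, ← Finset.mul_sum,
    hN.div_ric hG hy hsym]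
  simp [Matrix.one_apply]

omit hsym in
theorem pd_schouten (a j k : Fin n) : pd a (fun z => schouten G z j k) y
    = pd a (ric G j k) y
      - pd a (scal G) y / (2 * ((n : ℝ) - 1)) * (1 : Matrix (Fin n) (Fin n) ℝ) j k := by
  have hU := hG.isOpen
  have dS := hG.smooth_scal.differentiableAt_of_isOpen hU hy
  have dG := (hG.smooth j k).differentiableAt_of_isOpen hU hy
  have e : (fun z => schouten G z j k)
      = fun z => ric G j k z - (1 / (2 * ((n : ℝ) - 1))) * (scal G z * G z j k) := by
    funext z
    simp only [schouten, Matrix.sub_apply, Matrix.smul_apply, smul_eq_mul, ricMatrix]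
    ring
  rw [e, pd_sub ((hG.smooth_ric j k).differentiableAt_of_isOpen hU hy) ((dS.fun_mul dG).const_mul _),
    pd_const_mul (dS.fun_mul dG), pd_mul dS dG, hN.pd_metric hG hy, hN.eq_one]
  ring

/-- In dimension at least four a harmonic Weyl tensor forces the Cotton tensor to vanish. -/
theorem isCodazziAt_of_divWeyl (hn : 4 ≤ n) (hW : ∀ i j k, divWeyl G i j k y = 0) :
    IsCodazziAt G (schouten G) y := by
  intro i j k
  rw [hN.conn_eq_zero, hN.conn_eq_zero, mul_zero, sub_zero, sub_zero]
  have h1 := hN.pd_schouten hG hy i j k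
  have h2 := hN.pd_schouten hG hy j i k
  have h3 := hW i j k
  rw [hN.divWeyl_eq hG hy hsym] at h3
  simp only [pdMatrix]
  rw [h1, h2]
  have hn' : (4 : ℝ) ≤ n := by exact_mod_cast hn
  have n1 : (n : ℝ) - 1 ≠ 0 := by linarith
  have n2 : (n : ℝ) - 2 ≠ 0 := by linarith
  have n3 : (n : ℝ) - 3 ≠ 0 := by linarith
  rw [← sub_eq_zero]
  -- Collecting terms, `div W` is `(n - 3) / (n - 2)` times the Codazzi defect; this factor is
  -- nonzero for `n ≥ 4` and is the reason why dimension three is separate.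
  refine (mul_eq_zero.1 (?_ : ((n : ℝ) - 3) / ((n : ℝ) - 2) * _ = 0)).resolve_left
    (div_ne_zero n3 n2)
  rw [← h3]
  field_simp
  ring

omit hsym in
-- The Ricci identity for `dF`. The pure third derivatives of `F` commute, and what is left is the
-- derivative of `Γ` applied to `dF`.
theorem pd_hess_antisymm {F : EuclideanSpace ℝ (Fin n) → ℝ} (hF : ContDiffOn ℝ ∞ F U)
    (i j k : Fin n) : pd i (hess G F j k) y - pd j (hess G F i k) y
      = -∑ l, riem G l i j k y * pd l F y := by
  have hU := hG.isOpen
  have hp := fun l => contDiffOn_pd hU hF l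
  have key : ∀ i j, pd i (hess G F j k) y = pd i (pd j (pd k F)) y
      - ∑ l, pd i (christoffel G l j k) y * pd l F y := by
    intro i j
    have dm := fun l => ((hG.smooth_christoffel l j k).mul (hp l)).differentiableAt_of_isOpen hU hy
    rw [show hess G F j k = fun z => pd j (pd k F) z - ∑ l, christoffel G l j k z * pd l F z
      from rfl, pd_sub ((contDiffOn_pd hU (hp k) j).differentiableAt_of_isOpen hU hy)
        (DifferentiableAt.fun_sum fun l _ => dm l), pd_sum _ fun l _ => dm l]
    congr 1
    refine Finset.sum_congr rfl fun l _ => ?_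
    rw [pd_mul ((hG.smooth_christoffel l j k).differentiableAt_of_isOpen hU hy)
      ((hp l).differentiableAt_of_isOpen hU hy), hN.christoffel_eq, zero_mul, add_zero]
  rw [key, key, pd_comm hU (hp k) hy i j]
  simp only [hN.riem_eq, sub_mul, Finset.sum_sub_distrib]
  ring

/-- The wedge identity at the centre of normal coordinates. -/
theorem wedge_mainForm {f φ lam : EuclideanSpace ℝ (Fin n) → ℝ} (m : ℕ)
    (hf : ContDiffOn ℝ ∞ f U) (hφ : ContDiffOn ℝ ∞ φ U) (hlam : ContDiffOn ℝ ∞ lam U)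
    (hpos : ∀ z ∈ U, 0 < f z)
    (heq : ∀ z ∈ U, ∀ i j, ric G i j z + hess G φ i j z
      = lam z * G z i j + (m / f z) * hess G f i j z)
    (hcod : IsCodazziAt G (schouten G) y) (i j : Fin n) :
    wedge (fun k => mainForm G m f φ k y) (fun k => pd k f y) i j
      = ((n : ℝ) - 1) * f y * curvForm G (grad G φ y) (grad G f y) i j y := by
  have hU := hG.isOpen
  have df := hf.differentiableAt_of_isOpen hU hy
  -- The equation is multiplied by `f` before differentiating, so that no derivative of `m / f`
  -- appears.
  have hder : ∀ i j k, pd i f y * (ric G j k y + hess G φ j k y)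
      + f y * (pd i (ric G j k) y + pd i (hess G φ j k) y)
      = pd i (fun z => lam z * f z) y * (1 : Matrix (Fin n) (Fin n) ℝ) j k
        + m * pd i (hess G f j k) y := by
    intro i j k
    have dr := (hG.smooth_ric j k).differentiableAt_of_isOpen hU hy
    have dp := (hG.smooth_hess hφ j k).differentiableAt_of_isOpen hU hy
    have dh := (hG.smooth_hess hf j k).differentiableAt_of_isOpen hU hy
    have dl := (hlam.mul hf).differentiableAt_of_isOpen hU hy
    have dG := (hG.smooth j k).differentiableAt_of_isOpen hU hy
    have e : ∀ z ∈ U, f z * (ric G j k z + hess G φ j k z)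
        = (lam z * f z) * G z j k + m * hess G f j k z := by
      intro z hz
      have := (hpos z hz).ne'
      rw [heq z hz]
      field_simp
    have h1 := pd_congr_on hU hy e i
    rw [pd_mul df (dr.fun_add dp), pd_add dr dp, pd_add (dl.fun_mul dG) (dh.const_mul _),
      pd_const_mul dh, pd_mul dl dG, hN.pd_metric hG hy, hN.eq_one] at h1
    rw [h1]
    ring
  have hC : ∀ i j k, pd i (ric G j k) y - pd j (ric G i k) y
      = pd i (scal G) y / (2 * ((n : ℝ) - 1)) * (1 : Matrix (Fin n) (Fin n) ℝ) j k
      - pd j (scal G) y / (2 * ((n : ℝ) - 1)) * (1 : Matrix (Fin n) (Fin n) ℝ) i k := by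
    intro i j k
    have h1 := hcod i j k
    rw [hN.conn_eq_zero, hN.conn_eq_zero, mul_zero, sub_zero, sub_zero] at h1
    simp only [pdMatrix] at h1
    rw [hN.pd_schouten hG hy, hN.pd_schouten hG hy] at h1
    linarith
  have hmain := wedge_eq_of_codazzi (K := fun l i j k => riem G l i j k y)
    (Ri := fun i j => ric G i j y) (P := fun i j => hess G φ i j y) (a := fun i => pd i f y)
    (b := fun i => pd i φ y)
    -- The form `s` collects all terms that multiply the metric: the scalar curvature term of the
    -- Codazzi equation and `d(λ f)`.
    (s := fun i => f y * (pd i (scal G) y / (2 * ((n : ℝ) - 1)))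
      - pd i (fun z => lam z * f z) y) (f := f y) (m := m)
    (fun l i j k => IsMetricOn.riem_antisymm G l i j k y)
    (fun l i j k => hN.riem_skew hG hy l i j k) (fun j k => rfl) (hsym y hy)
    (fun j k => hG.hess_symm hy hφ j k) ?_ i j
  · have hcf : curvForm G (grad G φ y) (grad G f y) i j y
        = ∑ k, ∑ l, riem G l i j k y * pd k φ y * pd l f y := by
      simp [curvForm, hN.eq_one, hN.grad_eq, Matrix.one_apply]
    rw [hcf, ← hmain]
    simp only [mainForm, hN.grad_eq]
  · intro i j k
    have h1 := hder i j k
    have h2 := hder j i k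
    have h3 := hC i j k
    have h4 := hN.pd_hess_antisymm hG hy hφ i j k
    have h5 := hN.pd_hess_antisymm hG hy hf i j k
    linear_combination h1 - h2 - f y * h3 - f y * h4 + m * h5

end IsNormalAt

end NormalPoint


/-! ### Conformally flat metrics have a Codazzi Schouten tensor. -/

section ConformallyFlat

variable {n : ℕ}

/-- The Christoffel symbols of the metric `u² g₀`, where `v = d log u`. -/
def conformalConn (v : Fin n → ℝ) (k i j : Fin n) : ℝ :=
  (1 : Matrix (Fin n) (Fin n) ℝ) k j * v i + (1 : Matrix (Fin n) (Fin n) ℝ) k i * v j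
    - (1 : Matrix (Fin n) (Fin n) ℝ) i j * v k

theorem one_apply_comm (i j : Fin n) :
    (1 : Matrix (Fin n) (Fin n) ℝ) i j = (1 : Matrix (Fin n) (Fin n) ℝ) j i := by
  simp [Matrix.one_apply, eq_comm]

theorem sum_one_apply_mul (i : Fin n) (x : Fin n → ℝ) :
    ∑ s, (1 : Matrix (Fin n) (Fin n) ℝ) i s * x s = x i := by
  simp [Matrix.one_apply]

theorem sum_mul_conformalConn (x v : Fin n → ℝ) (i k : Fin n) :
    ∑ s, x s * conformalConn v s i k
      = x k * v i + x i * v k - (1 : Matrix (Fin n) (Fin n) ℝ) i k * ∑ s, x s * v s := by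
  have h : ∀ s, x s * conformalConn v s i k = (1 : Matrix (Fin n) (Fin n) ℝ) k s * (x s * v i)
      + (1 : Matrix (Fin n) (Fin n) ℝ) i s * (x s * v k)
      - (1 : Matrix (Fin n) (Fin n) ℝ) i k * (x s * v s) := fun s => by
    rw [conformalConn, one_apply_comm s k, one_apply_comm s i]
    ring
  simp only [h, Finset.sum_add_distrib, Finset.sum_sub_distrib, sum_one_apply_mul,
    ← Finset.mul_sum]

theorem sum_one_apply_self : ∑ i : Fin n, (1 : Matrix (Fin n) (Fin n) ℝ) i i = n := by
  simp

/-- The part of the Ricci tensor of `u² g₀` that is quadratic in `Γ`. -/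
theorem sum_conformalConn_mul_sub (v : Fin n → ℝ) (j k : Fin n) :
    ∑ i, ∑ s, (conformalConn v i i s * conformalConn v s j k
        - conformalConn v i j s * conformalConn v s i k)
      = ((n : ℝ) - 2) * (v j * v k - (1 : Matrix (Fin n) (Fin n) ℝ) j k * ∑ s, v s * v s) := by
  have h1 : ∑ i, ∑ s, conformalConn v i i s * conformalConn v s j k
      = n * (v k * v j + v j * v k - (1 : Matrix (Fin n) (Fin n) ℝ) j k * ∑ s, v s * v s) := by
    rw [Finset.sum_comm]
    have : ∀ s, ∑ i, conformalConn v i i s = n * v s := by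
      intro s
      simp only [conformalConn, Finset.sum_add_distrib, Finset.sum_sub_distrib, ← Finset.sum_mul,
        sum_one_apply_self]
      ring
    simp only [← Finset.sum_mul, this, mul_assoc, ← Finset.mul_sum, sum_mul_conformalConn]
  have h2 : ∑ i, ∑ s, conformalConn v i j s * conformalConn v s i k
      = (n : ℝ) * (v j * v k) + 2 * (v j * v k)
        - 2 * ((1 : Matrix (Fin n) (Fin n) ℝ) j k * ∑ s, v s * v s) := by
    have h3 : ∀ i, ∑ s, conformalConn v i j s * v s
        = (1 : Matrix (Fin n) (Fin n) ℝ) j i * ∑ s, v s * v s := by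
      intro i
      have : ∀ s, conformalConn v i j s * v s = (1 : Matrix (Fin n) (Fin n) ℝ) i s * (v j * v s)
          + (1 : Matrix (Fin n) (Fin n) ℝ) j i * (v s * v s)
          - (1 : Matrix (Fin n) (Fin n) ℝ) j s * (v i * v s) := fun s => by
        rw [conformalConn, one_apply_comm i j]
        ring
      simp only [this, Finset.sum_add_distrib, Finset.sum_sub_distrib, sum_one_apply_mul,
        ← Finset.mul_sum]
      ring
    have h4 : ∀ i, ∑ s, conformalConn v i j s * conformalConn v s i k
        = (1 : Matrix (Fin n) (Fin n) ℝ) k i * (v j * v i)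
          + (1 : Matrix (Fin n) (Fin n) ℝ) j i * (v k * v i)
          - (1 : Matrix (Fin n) (Fin n) ℝ) j k * (v i * v i)
          + ((1 : Matrix (Fin n) (Fin n) ℝ) i i * (v j * v k)
            + (1 : Matrix (Fin n) (Fin n) ℝ) j i * (v i * v k)
            - (1 : Matrix (Fin n) (Fin n) ℝ) j i * (v i * v k))
          - (1 : Matrix (Fin n) (Fin n) ℝ) k i *
            ((1 : Matrix (Fin n) (Fin n) ℝ) j i * ∑ s, v s * v s) := by
      intro i
      rw [sum_mul_conformalConn, h3]
      simp only [conformalConn]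
      rw [one_apply_comm i k, one_apply_comm i j]
      ring
    simp only [h4, Finset.sum_add_distrib, Finset.sum_sub_distrib, sum_one_apply_mul,
      ← Finset.mul_sum, ← Finset.sum_mul, sum_one_apply_self]
    ring
  simp only [Finset.sum_sub_distrib, h1, h2]
  ring

variable {U : Set (EuclideanSpace ℝ (Fin n))}
  {G : EuclideanSpace ℝ (Fin n) → Matrix (Fin n) (Fin n) ℝ} {y : EuclideanSpace ℝ (Fin n)}
  {u : EuclideanSpace ℝ (Fin n) → ℝ}

/-- The partial derivatives of `log u`. -/
def dlog (u : EuclideanSpace ℝ (Fin n) → ℝ) (i : Fin n) (y : EuclideanSpace ℝ (Fin n)) : ℝ :=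
  pd i (fun z => Real.log (u z)) y

theorem christoffel_of_conformal (hU : IsOpen U) (hu : ContDiffOn ℝ ∞ u U)
    (hpos : ∀ z ∈ U, 0 < u z)
    (hG : ∀ z ∈ U, G z = (u z) ^ 2 • (1 : Matrix (Fin n) (Fin n) ℝ)) (hy : y ∈ U)
    (k i j : Fin n) :
    christoffel G k i j y = conformalConn (fun a => dlog u a y) k i j := by
  have hu0 := (hpos y hy).ne'
  have du := hu.differentiableAt_of_isOpen hU hy
  have hinv : (G y)⁻¹ = ((u y) ^ 2)⁻¹ • (1 : Matrix (Fin n) (Fin n) ℝ) := by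
    rw [hG y hy]
    refine Matrix.inv_eq_left_inv ?_
    rw [Matrix.smul_mul, Matrix.one_mul, smul_smul, inv_mul_cancel₀ (pow_ne_zero 2 hu0), one_smul]
  have hlog : ∀ a, pd a u y = u y * dlog u a y := by
    intro a
    have : dlog u a y = (u y)⁻¹ * pd a u y := by
      simp only [dlog, pd, fderiv.log du hu0, _root_.smul_apply, smul_eq_mul]
    rw [this, mul_inv_cancel_left₀ hu0]
  have hpd : ∀ a b c, pd a (fun z => G z b c) y
      = 2 * (u y) ^ 2 * ((1 : Matrix (Fin n) (Fin n) ℝ) b c * dlog u a y) := by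
    intro a b c
    have e : ∀ z ∈ U, G z b c = (1 : Matrix (Fin n) (Fin n) ℝ) b c * (u z * u z) := by
      intro z hz
      rw [hG z hz, Matrix.smul_apply, smul_eq_mul]
      ring
    rw [pd_congr_on hU hy e, pd_const_mul (du.fun_mul du), pd_mul du du, hlog]
    ring
  have h1 : ∀ l, (G y)⁻¹ k l * (pd i (fun z => G z j l) y + pd j (fun z => G z i l) y
      - pd l (fun z => G z i j) y)
      = (1 : Matrix (Fin n) (Fin n) ℝ) k l * (2 * ((1 : Matrix (Fin n) (Fin n) ℝ) j l * dlog u i y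
        + (1 : Matrix (Fin n) (Fin n) ℝ) i l * dlog u j y
        - (1 : Matrix (Fin n) (Fin n) ℝ) i j * dlog u l y)) := by
    intro l
    rw [hinv, hpd, hpd, hpd, Matrix.smul_apply, smul_eq_mul]
    field_simp
  rw [christoffel, Finset.sum_congr rfl fun l _ => h1 l, sum_one_apply_mul, conformalConn,
    one_apply_comm k j, one_apply_comm k i]
  ring

/-- A metric of the form `u² g₀` satisfies the Codazzi equation for its Schouten tensor. -/
theorem isCodazziAt_of_conformal (hn : 2 ≤ n) (hG : IsMetricOn U G) (hu : ContDiffOn ℝ ∞ u U)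
    (hpos : ∀ z ∈ U, 0 < u z)
    (hGu : ∀ z ∈ U, G z = (u z) ^ 2 • (1 : Matrix (Fin n) (Fin n) ℝ)) (hy : y ∈ U) :
    IsCodazziAt G (schouten G) y := by
  have hU := hG.isOpen
  have hn1 : (n : ℝ) - 1 ≠ 0 := by
    have : (2 : ℝ) ≤ n := by exact_mod_cast hn
    linarith
  have hlog : ContDiffOn ℝ ∞ (fun z => Real.log (u z)) U := hu.log fun z hz => (hpos z hz).ne'
  have hv : ∀ i, ContDiffOn ℝ ∞ (dlog u i) U := fun i => contDiffOn_pd hU hlog i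
  have hvv : ∀ i j, ContDiffOn ℝ ∞ (pd i (dlog u j)) U := fun i j => contDiffOn_pd hU (hv j) i
  have hΓ := fun k i j z (hz : z ∈ U) => christoffel_of_conformal hU hu hpos hGu hz k i j
  have hsym : ∀ z ∈ U, ∀ i j, pd i (dlog u j) z = pd j (dlog u i) z := fun z hz i j =>
    pd_comm hU hlog hz i j
  have hdΓ : ∀ z ∈ U, ∀ a k i j, pd a (christoffel G k i j) z
      = (1 : Matrix (Fin n) (Fin n) ℝ) k j * pd a (dlog u i) z
        + (1 : Matrix (Fin n) (Fin n) ℝ) k i * pd a (dlog u j) z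
        - (1 : Matrix (Fin n) (Fin n) ℝ) i j * pd a (dlog u k) z := by
    intro z hz a k i j
    have d := fun i => (hv i).differentiableAt_of_isOpen hU hz
    rw [pd_congr_on hU hz (fun z hz => hΓ k i j z hz)]
    simp only [conformalConn]
    rw [pd_sub (((d i).const_mul _).fun_add ((d j).const_mul _)) ((d k).const_mul _),
      pd_add ((d i).const_mul _) ((d j).const_mul _), pd_const_mul (d i), pd_const_mul (d j),
      pd_const_mul (d k)]
  have hric : ∀ z ∈ U, ∀ j k, ric G j k z = -((n : ℝ) - 2) * pd j (dlog u k) z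
      - (1 : Matrix (Fin n) (Fin n) ℝ) j k * ∑ i, pd i (dlog u i) z
      + ((n : ℝ) - 2) * (dlog u j z * dlog u k z
        - (1 : Matrix (Fin n) (Fin n) ℝ) j k * ∑ s, dlog u s z * dlog u s z) := by
    intro z hz j k
    simp only [ric, riem, Finset.sum_add_distrib, hdΓ z hz, hΓ _ _ _ z hz]
    rw [sum_conformalConn_mul_sub]
    congr 1
    have e : ∀ i, (1 : Matrix (Fin n) (Fin n) ℝ) i k * pd i (dlog u j) z
        + (1 : Matrix (Fin n) (Fin n) ℝ) i j * pd i (dlog u k) z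
        - (1 : Matrix (Fin n) (Fin n) ℝ) j k * pd i (dlog u i) z
        - ((1 : Matrix (Fin n) (Fin n) ℝ) i k * pd j (dlog u i) z
          + (1 : Matrix (Fin n) (Fin n) ℝ) i i * pd j (dlog u k) z
          - (1 : Matrix (Fin n) (Fin n) ℝ) i k * pd j (dlog u i) z)
        = (1 : Matrix (Fin n) (Fin n) ℝ) k i * pd i (dlog u j) z
          + (1 : Matrix (Fin n) (Fin n) ℝ) j i * pd i (dlog u k) z
          - (1 : Matrix (Fin n) (Fin n) ℝ) j k * pd i (dlog u i) z
          - (1 : Matrix (Fin n) (Fin n) ℝ) i i * pd j (dlog u k) z := by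
      intro i
      rw [one_apply_comm i k, one_apply_comm i j]
      ring
    simp only [e, Finset.sum_add_distrib, Finset.sum_sub_distrib, sum_one_apply_mul,
      ← Finset.mul_sum, ← Finset.sum_mul, sum_one_apply_self]
    rw [hsym z hz k j]
    ring
  -- Subtracting the trace term cancels the Laplacian of `log u`, and the `u²` of the metric cancels
  -- the `u⁻²` of the scalar curvature. The tensor becomes `(n - 2) (v ⊗ v - ∂v - |v|² g₀ / 2)` with
  -- `v = d log u`.
  have hsch : ∀ z ∈ U, ∀ j k, schouten G z j k = ((n : ℝ) - 2) * (dlog u j z * dlog u k z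
      - pd j (dlog u k) z
      - (1 : Matrix (Fin n) (Fin n) ℝ) j k * ((1 / 2) * ∑ s, dlog u s z * dlog u s z)) := by
    intro z hz j k
    have hu1 : u z ≠ 0 := (hpos z hz).ne'
    have hu2 : (u z) ^ 2 ≠ 0 := pow_ne_zero 2 hu1
    have hinv : (G z)⁻¹ = ((u z) ^ 2)⁻¹ • (1 : Matrix (Fin n) (Fin n) ℝ) := by
      rw [hGu z hz]
      refine Matrix.inv_eq_left_inv ?_
      rw [Matrix.smul_mul, Matrix.one_mul, smul_smul, inv_mul_cancel₀ hu2, one_smul]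
    have hscal : scal G z = ((u z) ^ 2)⁻¹ * ∑ i, ric G i i z := by
      rw [scal_eq, ricEnd_eq, hinv, Matrix.smul_mul, Matrix.one_mul, Matrix.trace_smul]
      rfl
    have htr : ∑ i, ric G i i z = -(2 * ((n : ℝ) - 1)) * (∑ i, pd i (dlog u i) z
        + ((n : ℝ) - 2) / 2 * ∑ s, dlog u s z * dlog u s z) := by
      simp only [hric z hz, Finset.sum_add_distrib, Finset.sum_sub_distrib, ← Finset.mul_sum,
        ← Finset.sum_mul, sum_one_apply_self]
      ring
    simp only [schouten, Matrix.sub_apply, Matrix.smul_apply, smul_eq_mul, ricMatrix, hscal]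
    rw [htr, hric z hz, hGu z hz, Matrix.smul_apply, smul_eq_mul]
    field_simp
    ring
  intro i j k
  have dv := fun i => (hv i).differentiableAt_of_isOpen hU hy
  have dvv := fun i j => (hvv i j).differentiableAt_of_isOpen hU hy
  have hpd : ∀ i j, pdMatrix i (schouten G) y j k = ((n : ℝ) - 2) *
      (pd i (dlog u j) y * dlog u k y + dlog u j y * pd i (dlog u k) y
      - pd i (pd j (dlog u k)) y
      - (1 : Matrix (Fin n) (Fin n) ℝ) j k * ∑ s, pd i (dlog u s) y * dlog u s y) := by
    intro i j
    have d1 : DifferentiableAt ℝ (fun z => ∑ s, dlog u s z * dlog u s z) y :=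
      DifferentiableAt.fun_sum fun s _ => (dv s).fun_mul (dv s)
    have d2 := ((dv j).fun_mul (dv k)).fun_sub (dvv j k)
    have d3 := (d1.const_mul (1 / 2)).const_mul ((1 : Matrix (Fin n) (Fin n) ℝ) j k)
    rw [pdMatrix, pd_congr_on hU hy (fun z hz => hsch z hz j k), pd_const_mul (d2.fun_sub d3),
      pd_sub d2 d3, pd_sub ((dv j).fun_mul (dv k)) (dvv j k), pd_mul (dv j) (dv k),
      pd_const_mul (d1.const_mul _), pd_const_mul d1,
      pd_sum _ fun s _ => (dv s).fun_mul (dv s)]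
    simp only [pd_mul (dv _) (dv _)]
    have : ∀ s, pd i (dlog u s) y * dlog u s y + dlog u s y * pd i (dlog u s) y
        = 2 * (pd i (dlog u s) y * dlog u s y) := fun s => by ring
    simp only [this, ← Finset.mul_sum]
    ring
  have hm : ∀ i j, (schouten G y * connMatrix G i y) j k
      = schouten G y j k * dlog u i y + schouten G y j i * dlog u k y
        - (1 : Matrix (Fin n) (Fin n) ℝ) i k * ∑ s, schouten G y j s * dlog u s y := by
    intro i j
    rw [Matrix.mul_apply, ← sum_mul_conformalConn (fun s => schouten G y j s)
      (fun s => dlog u s y)]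
    exact Finset.sum_congr rfl fun s _ => by rw [connMatrix, hΓ s i k y hy]
  have hsv : ∀ j, ∑ s, schouten G y j s * dlog u s y = ((n : ℝ) - 2) *
      ((1 / 2) * dlog u j y * ∑ s, dlog u s y * dlog u s y
        - ∑ s, pd j (dlog u s) y * dlog u s y) := by
    intro j
    have : ∀ s, schouten G y j s * dlog u s y = ((n : ℝ) - 2) *
        (dlog u j y * (dlog u s y * dlog u s y) - pd j (dlog u s) y * dlog u s y
        - (1 : Matrix (Fin n) (Fin n) ℝ) j s *
          (dlog u s y * ((1 / 2) * ∑ s, dlog u s y * dlog u s y))) := fun s => by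
      rw [hsch y hy]
      ring
    simp only [this, ← Finset.mul_sum, Finset.sum_sub_distrib, sum_one_apply_mul]
    ring
  -- Once `∂_i ∂_j v_k` and `∂_i v_j` are known to be symmetric in `i, j`, the equation is a
  -- polynomial identity.
  rw [Matrix.sub_apply, Matrix.sub_apply, hpd, hpd, hm, hm, hsv, hsv, hsch y hy, hsch y hy,
    hsch y hy, hsch y hy, pd_comm hU (hv k) hy i j, hsym y hy i j, one_apply_comm i j]
  ring

end ConformallyFlat


/-! ### The metric in charts and under changes of charts. -/

section Charts

variable {n : ℕ} {M : Type*} [TopologicalSpace M]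
  [ChartedSpace (EuclideanSpace ℝ (Fin n)) M] [IsManifold (𝓡 n) ∞ M]
  {g : Bundle.ContMDiffRiemannianMetric (𝓡 n) ∞ (EuclideanSpace ℝ (Fin n))
    (fun x : M => TangentSpace (𝓡 n) x)}
  {e e' : OpenPartialHomeomorph M (EuclideanSpace ℝ (Fin n))} {y : EuclideanSpace ℝ (Fin n)}

/-- A coordinate field is the tangent map of `e.symm` applied to a constant vector field. -/
theorem contMDiffOn_coordVec (he : e ∈ IsManifold.maximalAtlas (𝓡 n) ∞ M) (i : Fin n) :
    ContMDiffOn (𝓡 n) ((𝓡 n).prod 𝓘(ℝ, EuclideanSpace ℝ (Fin n))) ∞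
      (fun y => (Bundle.TotalSpace.mk' (EuclideanSpace ℝ (Fin n)) (e.symm y) (coordVec e i y) :
        TangentBundle (𝓡 n) M)) e.target := by
  have hs : ContMDiffOn (𝓡 n) (𝓡 n) ∞ e.symm e.target :=
    contMDiffOn_symm_of_mem_maximalAtlas he
  have ht := hs.contMDiffOn_tangentMapWithin (m := ∞) (by rfl)
    e.open_target.uniqueMDiffOn
  have hv : ContMDiff (𝓡 n) ((𝓡 n).prod 𝓘(ℝ, EuclideanSpace ℝ (Fin n))) ∞
      (fun y => (Bundle.TotalSpace.mk' (EuclideanSpace ℝ (Fin n)) y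
        (EuclideanSpace.single i (1 : ℝ) : EuclideanSpace ℝ (Fin n)) :
        TangentBundle (𝓡 n) (EuclideanSpace ℝ (Fin n)))) :=
    contMDiff_vectorSpace_iff_contDiff.2 contDiff_const
  refine (ht.comp (hv.contMDiffOn (s := e.target)) fun y hy => hy).congr fun y hy => ?_
  simp only [Function.comp, tangentMapWithin, coordVec, mfderivWithin_of_isOpen e.open_target hy]

omit [IsManifold (𝓡 n) ∞ M] in
theorem contDiffOn_chartFun (he : e ∈ IsManifold.maximalAtlas (𝓡 n) ∞ M) {F : M → ℝ}
    (hF : ContMDiff (𝓡 n) 𝓘(ℝ, ℝ) ∞ F) : ContDiffOn ℝ ∞ (chartFun F e) e.target :=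
  contMDiffOn_iff_contDiffOn.1
    (hF.comp_contMDiffOn (contMDiffOn_symm_of_mem_maximalAtlas he))

theorem smoothMatrixOn_chartMetric (he : e ∈ IsManifold.maximalAtlas (𝓡 n) ∞ M) :
    SmoothMatrixOn e.target (chartMetric g e) := by
  intro i j
  rw [← contMDiffOn_iff_contDiffOn]
  have hs : ContMDiffOn (𝓡 n) (𝓡 n) ∞ e.symm e.target :=
    contMDiffOn_symm_of_mem_maximalAtlas he
  have h : ContMDiffOn (𝓡 n) ((𝓡 n).prod 𝓘(ℝ)) ∞
      (fun y => Bundle.TotalSpace.mk' ℝ (E := Bundle.Trivial M ℝ) (e.symm y)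
        (g.inner (e.symm y) (coordVec e i y) (coordVec e j y))) e.target := by
    apply ContMDiffOn.clm_bundle_apply₂ (F₁ := EuclideanSpace ℝ (Fin n))
      (F₂ := EuclideanSpace ℝ (Fin n))
    · exact g.contMDiff.comp_contMDiffOn hs
    · exact contMDiffOn_coordVec he i
    · exact contMDiffOn_coordVec he j
  intro y hy
  have := h y hy
  simp only [Bundle.contMDiffWithinAt_totalSpace] at this
  exact this.2

omit [IsManifold (𝓡 n) ∞ M] in
theorem mdifferentiableAt_symm (he : e ∈ IsManifold.maximalAtlas (𝓡 n) ∞ M) (hy : y ∈ e.target) :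
    MDifferentiableAt (𝓡 n) (𝓡 n) e.symm y :=
  (contMDiffAt_symm_of_mem_maximalAtlas he hy).mdifferentiableAt (by simp)

omit [IsManifold (𝓡 n) ∞ M] in
theorem mdifferentiableAt_chart (he : e ∈ IsManifold.maximalAtlas (𝓡 n) ∞ M) {p : M}
    (hp : p ∈ e.source) : MDifferentiableAt (𝓡 n) (𝓡 n) e p :=
  (contMDiffAt_of_mem_maximalAtlas he hp).mdifferentiableAt (by simp)

omit [IsManifold (𝓡 n) ∞ M] in
theorem mfderiv_symm_injective (he : e ∈ IsManifold.maximalAtlas (𝓡 n) ∞ M) (hy : y ∈ e.target) :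
    Function.Injective (mfderiv (𝓡 n) (𝓡 n) e.symm y) := by
  have h1 : mfderiv (𝓡 n) (𝓡 n) (e ∘ e.symm) y = ContinuousLinearMap.id ℝ _ := by
    rw [Filter.EventuallyEq.mfderiv_eq (f₁ := e ∘ e.symm) (f := id)
      (Filter.eventuallyEq_of_mem (e.open_target.mem_nhds hy) fun z hz => e.right_inv hz)]
    exact mfderiv_id
  rw [mfderiv_comp y (mdifferentiableAt_chart he (e.map_target hy))
    (mdifferentiableAt_symm he hy)] at h1
  intro v w hvw
  have h2 := congrArg (mfderiv (𝓡 n) (𝓡 n) e (e.symm y)) hvw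
  have h3 := fun v => congrArg (fun L => L v) h1
  exact (h3 v).symm.trans (h2.trans (h3 w))

omit [IsManifold (𝓡 n) ∞ M] in
theorem sum_smul_coordVec (e : OpenPartialHomeomorph M (EuclideanSpace ℝ (Fin n)))
    (y : EuclideanSpace ℝ (Fin n)) (x : Fin n → ℝ) :
    ∑ i, x i • coordVec e i y = mfderiv (𝓡 n) (𝓡 n) e.symm y
      (∑ i, x i • EuclideanSpace.single i (1 : ℝ) : EuclideanSpace ℝ (Fin n)) := by
  simp only [coordVec]
  erw [map_sum]
  refine Finset.sum_congr rfl fun i _ => ?_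
  erw [map_smul]

theorem isMetricOn_chartMetric (he : e ∈ IsManifold.maximalAtlas (𝓡 n) ∞ M) :
    IsMetricOn e.target (chartMetric g e) where
  isOpen := e.open_target
  smooth := smoothMatrixOn_chartMetric he
  posDef y hy := by
    refine Matrix.PosDef.of_dotProduct_mulVec_pos ?_ ?_
    · ext i j
      simp only [Matrix.conjTranspose_apply, star_trivial, chartMetric]
      exact g.symm _ _ _
    · intro x hx
      -- The quadratic form of the matrix is `g(v, v)` for `v = ∑ x_i ∂_i`, and `v ≠ 0` because the
      -- derivative of `e.symm` is injective.
      have h1 : star x ⬝ᵥ (chartMetric g e y).mulVec x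
          = g.inner (e.symm y) (∑ i, x i • coordVec e i y) (∑ i, x i • coordVec e i y) := by
        simp only [map_sum, map_smul, _root_.sum_apply, _root_.smul_apply,
          smul_eq_mul, dotProduct, Matrix.mulVec, chartMetric, star_trivial, Finset.mul_sum]
        rw [Finset.sum_comm]
        exact Finset.sum_congr rfl fun i _ => Finset.sum_congr rfl fun j _ => by ring
      rw [h1]
      refine g.pos _ _ fun h0 => hx ?_
      rw [sum_smul_coordVec] at h0
      have h2 := mfderiv_symm_injective he hy (h0.trans (map_zero _).symm)
      funext i
      have := congrArg (fun v : EuclideanSpace ℝ (Fin n) => v i) h2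
      simp only [WithLp.ofLp_sum, WithLp.ofLp_smul, Finset.sum_apply, Pi.smul_apply,
        PiLp.single_apply, smul_eq_mul, mul_ite, mul_one, mul_zero, Finset.sum_ite_eq,
        Finset.mem_univ, if_true] at this
      exact this

theorem IsMetricOn.mono {U V : Set (EuclideanSpace ℝ (Fin n))}
    {G : EuclideanSpace ℝ (Fin n) → Matrix (Fin n) (Fin n) ℝ} (hG : IsMetricOn U G)
    (hV : IsOpen V) (hVU : V ⊆ U) : IsMetricOn V G :=
  ⟨hV, fun i j => (hG.smooth i j).mono hVU, fun y hy => hG.posDef y (hVU hy)⟩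

/-- A change of charts is an isometry between the metrics in the two charts. -/
theorem isIsometryOn_transition (he : e ∈ IsManifold.maximalAtlas (𝓡 n) ∞ M)
    (he' : e' ∈ IsManifold.maximalAtlas (𝓡 n) ∞ M) :
    IsIsometryOn (e.symm.trans e').source e'.target (chartMetric g e) (chartMetric g e')
      (fun z => e' (e.symm z)) := by
  have hsub : (e.symm.trans e').source ⊆ e.target := by
    intro z hz
    rw [OpenPartialHomeomorph.trans_source] at hz
    exact hz.1
  have hsrc : ∀ z ∈ (e.symm.trans e').source, e.symm z ∈ e'.source := by
    intro z hz
    rw [OpenPartialHomeomorph.trans_source] at hz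
    exact hz.2
  have hsm : ContDiffOn ℝ ∞ (fun z => e' (e.symm z)) (e.symm.trans e').source :=
    contMDiffOn_iff_contDiffOn.1 ((contMDiffOn_of_mem_maximalAtlas he').comp
      ((contMDiffOn_symm_of_mem_maximalAtlas he).mono hsub) hsrc)
  have hopen := (e.symm.trans e').open_source
  refine ⟨(isMetricOn_chartMetric he).mono hopen hsub, isMetricOn_chartMetric he', hsm,
    fun z hz => e'.map_source (hsrc z hz), fun y hy => ?_⟩
  have hT : DifferentiableAt ℝ (fun z => e' (e.symm z)) y :=
    (hsm.contDiffAt (hopen.mem_nhds hy)).differentiableAt (by simp)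
  have hy' : e' (e.symm y) ∈ e'.target := e'.map_source (hsrc y hy)
  have hp : e'.symm (e' (e.symm y)) = e.symm y := e'.left_inv (hsrc y hy)
  have h1 : mfderiv (𝓡 n) (𝓡 n) e.symm y
      = mfderiv (𝓡 n) (𝓡 n) (e'.symm ∘ fun z => e' (e.symm z)) y :=
    Filter.EventuallyEq.mfderiv_eq (Filter.eventuallyEq_of_mem (hopen.mem_nhds hy)
      fun z hz => (e'.left_inv (hsrc z hz)).symm)
  -- The chain rule `∂_i = ∑ J_ai ∂'_a`. Both sides are read in the model space, since their base
  -- points agree only propositionally; `hinner` below makes the same transfer for `g`.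
  have h2 : ∀ i, (coordVec e i y : EuclideanSpace ℝ (Fin n))
      = ∑ a, jacobian (fun z => e' (e.symm z)) y a i •
        (coordVec e' a (e' (e.symm y)) : EuclideanSpace ℝ (Fin n)) := by
    intro i
    have hv : fderiv ℝ (fun z => e' (e.symm z)) y (EuclideanSpace.single i 1)
        = ∑ a, jacobian (fun z => e' (e.symm z)) y a i • EuclideanSpace.single a (1 : ℝ) := by
      ext a
      simp [jacobian_apply hT, Finset.sum_apply, Pi.single_apply]
    have h3 : mfderiv (𝓡 n) (𝓡 n) (e'.symm ∘ fun z => e' (e.symm z)) y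
        = (mfderiv (𝓡 n) (𝓡 n) e'.symm (e' (e.symm y))).comp
          (mfderiv (𝓡 n) (𝓡 n) (fun z => e' (e.symm z)) y) :=
      mfderiv_comp y (mdifferentiableAt_symm he' hy') hT.mdifferentiableAt
    rw [mfderiv_eq_fderiv] at h3
    refine Eq.trans ?_ (sum_smul_coordVec e' (e' (e.symm y))
      fun a => jacobian (fun z => e' (e.symm z)) y a i).symm
    rw [← hv]
    exact congrArg (fun L : EuclideanSpace ℝ (Fin n) →L[ℝ] EuclideanSpace ℝ (Fin n) =>
      L (EuclideanSpace.single i 1)) (h1.trans h3)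
  have hinner : ∀ p q : M, p = q → ∀ v w : EuclideanSpace ℝ (Fin n),
      g.inner p v w = g.inner q v w := by
    rintro p _ rfl v w
    rfl
  ext i j
  have h4 : chartMetric g e y i j = g.inner (e'.symm (e' (e.symm y)))
      (∑ a, jacobian (fun z => e' (e.symm z)) y a i • coordVec e' a (e' (e.symm y)))
      (∑ a, jacobian (fun z => e' (e.symm z)) y a j • coordVec e' a (e' (e.symm y))) := by
    refine (hinner _ _ hp.symm (coordVec e i y) (coordVec e j y)).trans ?_
    rw [h2 i, h2 j]
  rw [h4]
  simp only [map_sum, map_smul, _root_.sum_apply, _root_.smul_apply, smul_eq_mul,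
    Matrix.mul_apply, Matrix.transpose_apply, Finset.sum_mul, Finset.mul_sum, chartMetric]
  exact Finset.sum_congr rfl fun a _ => Finset.sum_congr rfl fun b _ => by ring

end Charts


/-! ### Existence of normal charts. -/

section NormalCoordinates

variable {n : ℕ}

theorem IsIsometryOn.congr {U U' : Set (EuclideanSpace ℝ (Fin n))}
    {G G' : EuclideanSpace ℝ (Fin n) → Matrix (Fin n) (Fin n) ℝ}
    {T S : EuclideanSpace ℝ (Fin n) → EuclideanSpace ℝ (Fin n)}
    (h : IsIsometryOn U U' G G' T) (hS : ∀ z ∈ U, S z = T z) : IsIsometryOn U U' G G' S := by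
  refine ⟨h.metric, h.metric', h.smooth.congr hS, fun z hz => by rw [hS z hz]; exact h.mapsTo hz,
    fun z hz => ?_⟩
  have hJ : jacobian S z = jacobian T z := by
    ext a i
    exact pd_congr_on h.metric.isOpen hz (fun w hw => by rw [hS w hw]) i
  rw [hJ, hS z hz, h.pullback z hz]

/-- The inverse function theorem for smooth maps, with a smooth inverse on the whole target. -/
theorem exists_openPartialHomeomorph {E F : Type*} [NormedAddCommGroup E] [NormedSpace ℝ E]
    [CompleteSpace E] [NormedAddCommGroup F] [NormedSpace ℝ F] {T : E → F}
    (hT : ContDiff ℝ ∞ T) {y : E} {L : E ≃L[ℝ] F} (hL : HasFDerivAt T (L : E →L[ℝ] F) y) :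
    ∃ φ : OpenPartialHomeomorph E F,
      y ∈ φ.source ∧ (∀ z, φ z = T z) ∧ ContDiffOn ℝ ∞ φ.symm φ.target := by
  have hcont : Continuous (fderiv ℝ T) := hT.continuous_fderiv (by simp)
  -- Restricting to the open set where the derivative is invertible makes the inverse smooth on the
  -- whole target, not only near the image of `y`.
  have hS : IsOpen (fderiv ℝ T ⁻¹' Set.range ((↑) : (E ≃L[ℝ] F) → E →L[ℝ] F)) :=
    ContinuousLinearEquiv.isOpen.preimage hcont
  let ψ := hT.contDiffAt.toOpenPartialHomeomorph T hL (by simp)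
  have hψ : ∀ z, ψ z = T z := fun z => rfl
  refine ⟨ψ.restrOpen _ hS, ?_, hψ, ?_⟩
  · rw [OpenPartialHomeomorph.restrOpen_source]
    exact ⟨hT.contDiffAt.mem_toOpenPartialHomeomorph_source hL (by simp), L, hL.fderiv.symm⟩
  · intro z hz
    have hz' := (ψ.restrOpen _ hS).map_target hz
    rw [OpenPartialHomeomorph.restrOpen_source] at hz'
    obtain ⟨L', hL'⟩ := hz'.2
    have hd : HasFDerivAt T (L' : E →L[ℝ] F) ((ψ.restrOpen _ hS).symm z) := by
      rw [hL']
      exact (hT.contDiffAt.differentiableAt (by simp)).hasFDerivAt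
    exact ((ψ.restrOpen _ hS).contDiffAt_symm hz hd hT.contDiffAt).contDiffWithinAt

theorem exists_hasFDerivAt_equiv {T : EuclideanSpace ℝ (Fin n) → EuclideanSpace ℝ (Fin n)}
    {y : EuclideanSpace ℝ (Fin n)} (hd : DifferentiableAt ℝ T y)
    (hdet : (jacobian T y).det ≠ 0) :
    ∃ L : EuclideanSpace ℝ (Fin n) ≃L[ℝ] EuclideanSpace ℝ (Fin n),
      HasFDerivAt T (L : EuclideanSpace ℝ (Fin n) →L[ℝ] EuclideanSpace ℝ (Fin n)) y := by
  have hinj : Function.Injective (fderiv ℝ T y).toLinearMap := by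
    rw [← LinearMap.ker_eq_bot, LinearMap.ker_eq_bot']
    intro v hv
    have h1 : (jacobian T y).mulVec v = 0 := by
      funext a
      have h2 : fderiv ℝ T y v a = ∑ i, jacobian T y a i * v i := by
        have hv : v = ∑ i, v i • EuclideanSpace.single i (1 : ℝ) := by
          ext k
          simp [Finset.sum_apply, Pi.single_apply]
        conv_lhs => rw [hv]
        simp [jacobian_apply hd, mul_comm]
      have h3 : fderiv ℝ T y v = 0 := hv
      rw [h3] at h2
      exact h2.symm
    have h4 := Matrix.eq_zero_of_mulVec_eq_zero hdet h1
    ext i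
    exact congrFun h4 i
  exact ⟨(LinearEquiv.ofInjectiveEndo _ hinj).toContinuousLinearEquiv, hd.hasFDerivAt⟩

/-- The quadratic map whose value at `y` has first derivative `B` and second derivative `B Γ`. -/
def quadraticMap (B : Matrix (Fin n) (Fin n) ℝ) (Γ : Fin n → Fin n → Fin n → ℝ)
    (y z : EuclideanSpace ℝ (Fin n)) : EuclideanSpace ℝ (Fin n) :=
  WithLp.toLp 2 fun c => ∑ k, B c k * ((z k - y k)
    + ∑ a, ∑ b, (1 / 2) * Γ k a b * ((z a - y a) * (z b - y b)))

theorem contDiff_quadraticMap (B : Matrix (Fin n) (Fin n) ℝ) (Γ : Fin n → Fin n → Fin n → ℝ)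
    (y : EuclideanSpace ℝ (Fin n)) : ContDiff ℝ ∞ (quadraticMap B Γ y) := by
  rw [contDiff_euclidean]
  intro c
  have hx : ∀ a, ContDiff ℝ ∞ fun z : EuclideanSpace ℝ (Fin n) => z a - y a := fun a =>
    (EuclideanSpace.proj a : EuclideanSpace ℝ (Fin n) →L[ℝ] ℝ).contDiff.sub contDiff_const
  simp only [quadraticMap]
  exact ContDiff.sum fun k _ => contDiff_const.mul ((hx k).add (ContDiff.sum fun a _ =>
    ContDiff.sum fun b _ => contDiff_const.mul ((hx a).mul (hx b))))

theorem pd_coord (a i : Fin n) (y z : EuclideanSpace ℝ (Fin n)) :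
    pd i (fun z => z a - y a) z = (1 : Matrix (Fin n) (Fin n) ℝ) i a := by
  have h : HasFDerivAt (fun z : EuclideanSpace ℝ (Fin n) => z a - y a)
      (EuclideanSpace.proj a : EuclideanSpace ℝ (Fin n) →L[ℝ] ℝ) z :=
    (EuclideanSpace.proj a : EuclideanSpace ℝ (Fin n) →L[ℝ] ℝ).hasFDerivAt.sub_const _
  simp [pd, h.fderiv, Matrix.one_apply, eq_comm]

theorem jacobian_quadraticMap (B : Matrix (Fin n) (Fin n) ℝ) {Γ : Fin n → Fin n → Fin n → ℝ}
    (hΓ : ∀ k a b, Γ k a b = Γ k b a) (y z : EuclideanSpace ℝ (Fin n)) (c i : Fin n) :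
    jacobian (quadraticMap B Γ y) z c i
      = B c i + ∑ b, (∑ k, B c k * Γ k i b) * (z b - y b) := by
  have dx : ∀ a, DifferentiableAt ℝ (fun z : EuclideanSpace ℝ (Fin n) => z a - y a) z := fun a =>
    ((EuclideanSpace.proj a : EuclideanSpace ℝ (Fin n) →L[ℝ] ℝ).differentiableAt).sub_const _
  have dm := fun k a b => ((dx a).fun_mul (dx b)).const_mul ((1 / 2) * Γ k a b)
  have ds := fun k a => DifferentiableAt.fun_sum (u := Finset.univ) fun b _ => dm k a b
  have dss := fun k => DifferentiableAt.fun_sum (u := Finset.univ) fun a _ => ds k a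
  have h1 : jacobian (quadraticMap B Γ y) z c i = ∑ k, B c k *
      ((1 : Matrix (Fin n) (Fin n) ℝ) i k + ∑ a, ∑ b, (1 / 2) * Γ k a b *
        ((1 : Matrix (Fin n) (Fin n) ℝ) i a * (z b - y b)
          + (z a - y a) * (1 : Matrix (Fin n) (Fin n) ℝ) i b)) := by
    simp only [jacobian, quadraticMap]
    rw [pd_sum _ fun k _ => ((dx k).fun_add (dss k)).const_mul _]
    refine Finset.sum_congr rfl fun k _ => ?_
    rw [pd_const_mul ((dx k).fun_add (dss k)), pd_add (dx k) (dss k), pd_coord,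
      pd_sum _ fun a _ => ds k a]
    congr 2
    refine Finset.sum_congr rfl fun a _ => ?_
    rw [pd_sum _ fun b _ => dm k a b]
    refine Finset.sum_congr rfl fun b _ => ?_
    rw [pd_const_mul ((dx a).fun_mul (dx b)), pd_mul (dx a) (dx b), pd_coord, pd_coord]
  have h2 : ∀ k, ∑ a, ∑ b, (1 / 2) * Γ k a b *
      ((1 : Matrix (Fin n) (Fin n) ℝ) i a * (z b - y b)
        + (z a - y a) * (1 : Matrix (Fin n) (Fin n) ℝ) i b) = ∑ b, Γ k i b * (z b - y b) := by
    intro k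
    have e1 : ∑ a, ∑ b, (1 : Matrix (Fin n) (Fin n) ℝ) i a * ((1 / 2) * Γ k a b * (z b - y b))
        = ∑ b, (1 / 2) * Γ k i b * (z b - y b) := by
      simp only [← Finset.mul_sum]
      rw [sum_one_apply_mul i fun a => ∑ b, (1 / 2) * Γ k a b * (z b - y b)]
    have e2 : ∑ a, ∑ b, (1 : Matrix (Fin n) (Fin n) ℝ) i b * ((1 / 2) * Γ k a b * (z a - y a))
        = ∑ b, (1 / 2) * Γ k i b * (z b - y b) := by
      refine Finset.sum_congr rfl fun a _ => ?_
      rw [sum_one_apply_mul i fun b => (1 / 2) * Γ k a b * (z a - y a), hΓ k a i]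
    have e3 : ∀ a b, (1 / 2) * Γ k a b * ((1 : Matrix (Fin n) (Fin n) ℝ) i a * (z b - y b)
        + (z a - y a) * (1 : Matrix (Fin n) (Fin n) ℝ) i b)
        = (1 : Matrix (Fin n) (Fin n) ℝ) i a * ((1 / 2) * Γ k a b * (z b - y b))
          + (1 : Matrix (Fin n) (Fin n) ℝ) i b * ((1 / 2) * Γ k a b * (z a - y a)) :=
      fun a b => by ring
    simp only [e3, Finset.sum_add_distrib, e1, e2]
    rw [← Finset.sum_add_distrib]
    exact Finset.sum_congr rfl fun b _ => by ring
  simp only [h1, h2]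
  simp only [mul_add, Finset.sum_add_distrib]
  congr 1
  · simp [Matrix.one_apply]
  · simp only [Finset.mul_sum, Finset.sum_mul]
    rw [Finset.sum_comm]
    exact Finset.sum_congr rfl fun b _ => Finset.sum_congr rfl fun k _ => by ring

/-- At `y`, where the Jacobian is `B`, this says `∂_i J = J Γ_i`. By
`IsIsometryOn.pdMatrix_jacobian` it is the condition under which the connection vanishes in the new
coordinates. -/
theorem pd_jacobian_quadraticMap (B : Matrix (Fin n) (Fin n) ℝ) {Γ : Fin n → Fin n → Fin n → ℝ}
    (hΓ : ∀ k a b, Γ k a b = Γ k b a) (y z : EuclideanSpace ℝ (Fin n)) (c i j : Fin n) :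
    pd i (fun z => jacobian (quadraticMap B Γ y) z c j) z = ∑ k, B c k * Γ k i j := by
  have dx : ∀ a, DifferentiableAt ℝ (fun z : EuclideanSpace ℝ (Fin n) => z a - y a) z := fun a =>
    ((EuclideanSpace.proj a : EuclideanSpace ℝ (Fin n) →L[ℝ] ℝ).differentiableAt).sub_const _
  simp only [jacobian_quadraticMap B hΓ]
  rw [pd_add (differentiableAt_const _) (DifferentiableAt.fun_sum fun b _ => (dx b).const_mul _),
    pd_const, zero_add, pd_sum _ fun b _ => (dx b).const_mul _]
  have h : ∀ b, pd i (fun z => (∑ k, B c k * Γ k j b) * (z b - y b)) z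
      = (1 : Matrix (Fin n) (Fin n) ℝ) i b * ∑ k, B c k * Γ k j b := fun b => by
    rw [pd_const_mul (dx b), pd_coord, mul_comm]
  simp only [h, sum_one_apply_mul, hΓ _ j i]

/-- An isometry with first derivative `B`, `Bᵀ B = G`, and second derivative `B Γ` at `y` leads to
normal coordinates. -/
theorem IsIsometryOn.isNormalAt {U U' : Set (EuclideanSpace ℝ (Fin n))}
    {G G' : EuclideanSpace ℝ (Fin n) → Matrix (Fin n) (Fin n) ℝ}
    {T : EuclideanSpace ℝ (Fin n) → EuclideanSpace ℝ (Fin n)} {y : EuclideanSpace ℝ (Fin n)}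
    (h : IsIsometryOn U U' G G' T) (hy : y ∈ U)
    (h1 : (jacobian T y).transpose * jacobian T y = G y)
    (h2 : ∀ i, pdMatrix i (jacobian T) y = jacobian T y * connMatrix G i y) :
    IsNormalAt G' (T y) := by
  have hu := h.isUnit_det_jacobian hy
  have hu' : IsUnit (jacobian T y).transpose.det := by rwa [Matrix.det_transpose]
  constructor
  · have h3 := h.pullback y hy
    rw [← h1] at h3
    have h4 := congrArg (fun X => (jacobian T y).transpose⁻¹ * (X * (jacobian T y)⁻¹)) h3
    simp only [Matrix.mul_nonsing_inv_cancel_right _ _ hu] at h4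
    rw [Matrix.nonsing_inv_mul _ hu', Matrix.nonsing_inv_mul_cancel_left _ _ hu'] at h4
    exact h4.symm
  · have hz : ∀ i, pulledConn G' T i y = 0 := by
      intro i
      have h3 := h.pdMatrix_jacobian hy i
      rw [h2, eq_comm, sub_eq_self] at h3
      rw [← Matrix.mul_nonsing_inv_cancel_right _ (pulledConn G' T i y) hu, h3, zero_mul]
    intro c
    -- The pulled back connection vanishes; inverting its contraction with `J` recovers the
    -- individual connection matrices.
    have h3 : ∑ i, (jacobian T y)⁻¹ i c • pulledConn G' T i y = connMatrix G' c (T y) := by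
      simp only [pulledConn, Finset.smul_sum, smul_smul]
      rw [Finset.sum_comm]
      have h4 : ∀ a, ∑ i, (jacobian T y)⁻¹ i c * jacobian T y a i
          = (1 : Matrix (Fin n) (Fin n) ℝ) a c := by
        intro a
        rw [← Matrix.mul_nonsing_inv _ hu, Matrix.mul_apply]
        exact Finset.sum_congr rfl fun i _ => mul_comm _ _
      simp only [← Finset.sum_smul, h4, Matrix.one_apply, ite_smul, one_smul, zero_smul,
        Finset.sum_ite_eq', Finset.mem_univ, if_true]
    rw [← h3]
    simp only [hz, smul_zero, Finset.sum_const_zero]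

variable {M : Type*} [TopologicalSpace M]
  [ChartedSpace (EuclideanSpace ℝ (Fin n)) M] [IsManifold (𝓡 n) ∞ M]
  (g : Bundle.ContMDiffRiemannianMetric (𝓡 n) ∞ (EuclideanSpace ℝ (Fin n))
    (fun x : M => TangentSpace (𝓡 n) x))
  {e : OpenPartialHomeomorph M (EuclideanSpace ℝ (Fin n))}

open scoped MatrixOrder ComplexOrder in
/-- Around each point there is a chart of normal coordinates. -/
theorem exists_normal_chart (he : e ∈ IsManifold.maximalAtlas (𝓡 n) ∞ M) {p : M}
    (hp : p ∈ e.source) : ∃ e' ∈ IsManifold.maximalAtlas (𝓡 n) ∞ M, p ∈ e'.source ∧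
      IsNormalAt (chartMetric g e') (e' p) := by
  set y := e p with hy
  have hyt : y ∈ e.target := e.map_source hp
  have hG := isMetricOn_chartMetric (g := g) he
  -- With `g(y) = Bᵀ B`, taking `B` as first derivative of the coordinate change turns the metric at
  -- `y` into the identity.
  obtain ⟨B, hB⟩ : ∃ B : Matrix (Fin n) (Fin n) ℝ, chartMetric g e y = B.transpose * B := by
    obtain ⟨B, hB⟩ := CStarAlgebra.nonneg_iff_eq_star_mul_self.mp (hG.posDef y hyt).posSemidef.nonneg
    exact ⟨B, by
      rw [hB, Matrix.star_eq_conjTranspose, Matrix.conjTranspose_eq_transpose_of_trivial]⟩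
  set Γ : Fin n → Fin n → Fin n → ℝ := fun k i j => christoffel (chartMetric g e) k i j y with hΓ
  have hΓs : ∀ k i j, Γ k i j = Γ k j i := fun k i j => hG.christoffel_symm hyt k i j
  set T := quadraticMap B Γ y with hT
  have hTs : ContDiff ℝ ∞ T := contDiff_quadraticMap B Γ y
  have hJ : jacobian T y = B := by
    ext c i
    rw [hT, jacobian_quadraticMap B hΓs]
    simp
  have hdet : (jacobian T y).det ≠ 0 := by
    have := hG.det_ne_zero hyt
    rw [hB, Matrix.det_mul] at this
    rw [hJ]
    exact right_ne_zero_of_mul this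
  obtain ⟨L, hL⟩ := exists_hasFDerivAt_equiv (hTs.contDiffAt.differentiableAt (by simp)) hdet
  obtain ⟨φ, hφy, hφT, hφs⟩ := exists_openPartialHomeomorph hTs hL
  have he' : e.trans φ ∈ IsManifold.maximalAtlas (𝓡 n) ∞ M := by
    refine OpenPartialHomeomorph.mem_maximalAtlas_of_contMDiffOn _ ?_ ?_
    · have h1 : ContMDiffOn (𝓡 n) (𝓡 n) ∞ φ Set.univ :=
        (contMDiffOn_iff_contDiffOn.2 hTs.contDiffOn).congr fun z _ => hφT z
      exact h1.comp ((contMDiffOn_of_mem_maximalAtlas he).mono (by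
        rw [OpenPartialHomeomorph.trans_source]
        exact Set.inter_subset_left)) fun _ _ => Set.mem_univ _
    · refine (contMDiffOn_symm_of_mem_maximalAtlas he).comp
        ((contMDiffOn_iff_contDiffOn.2 hφs).mono ?_) ?_
      · rw [OpenPartialHomeomorph.trans_target]
        exact Set.inter_subset_left
      · intro z hz
        rw [OpenPartialHomeomorph.trans_target] at hz
        exact hz.2
  have hps : p ∈ (e.trans φ).source := by
    rw [OpenPartialHomeomorph.trans_source]
    exact ⟨hp, hφy⟩
  refine ⟨_, he', hps, ?_⟩
  have hiso := (isIsometryOn_transition (g := g) he he').congr (S := T) fun z hz => by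
    rw [OpenPartialHomeomorph.trans_source] at hz
    rw [OpenPartialHomeomorph.trans_apply, e.right_inv hz.1, hφT]
  have hyU : y ∈ (e.symm.trans (e.trans φ)).source := by
    rw [OpenPartialHomeomorph.trans_source]
    refine ⟨hyt, ?_⟩
    rw [Set.mem_preimage, hy, e.left_inv hp]
    exact hps
  have hTy : (e.trans φ) p = T y := by
    rw [OpenPartialHomeomorph.trans_apply, hφT]
  rw [hTy]
  refine hiso.isNormalAt hyU (by rw [hJ, hB]) fun i => ?_
  ext c j
  rw [hJ, Matrix.mul_apply]
  exact pd_jacobian_quadraticMap B hΓs y y c i j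

end NormalCoordinates


/-! ### From the wedge identity to the eigenvector, in one chart. -/

section Eigenvector

variable {n : ℕ} {U : Set (EuclideanSpace ℝ (Fin n))}
  {G : EuclideanSpace ℝ (Fin n) → Matrix (Fin n) (Fin n) ℝ} {y : EuclideanSpace ℝ (Fin n)}

theorem IsMetricOn.curvForm_self (hG : IsMetricOn U G) (hy : y ∈ U) (X : Fin n → ℝ)
    (i j : Fin n) : curvForm G X X i j y = 0 := by
  rw [curvForm_eq_dotProduct (hG.transpose_eq hy)]
  have h : X ⬝ᵥ (G y * curvMatrix G i j y).mulVec X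
      = -(X ⬝ᵥ (G y * curvMatrix G i j y).mulVec X) := by
    conv_lhs => rw [Matrix.dotProduct_mulVec, ← Matrix.mulVec_transpose,
      hG.mul_curvMatrix_transpose hy, Matrix.neg_mulVec, neg_dotProduct, dotProduct_comm]
  linarith

theorem curvForm_smul_left (G : EuclideanSpace ℝ (Fin n) → Matrix (Fin n) (Fin n) ℝ)
    (c : ℝ) (X Y : Fin n → ℝ) (i j : Fin n) (y : EuclideanSpace ℝ (Fin n)) :
    curvForm G (c • X) Y i j y = c * curvForm G X Y i j y := by
  simp only [curvForm, Finset.mul_sum, Pi.smul_apply, smul_eq_mul]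
  exact Finset.sum_congr rfl fun k _ => Finset.sum_congr rfl fun l _ =>
    Finset.sum_congr rfl fun s _ => by ring

theorem exists_eq_mul_of_wedge_eq_zero {α β : Fin n → ℝ} (hβ : β ≠ 0)
    (h : ∀ i j, wedge α β i j = 0) : ∃ c, ∀ i, α i = c * β i := by
  obtain ⟨k, hk⟩ := Function.ne_iff.1 hβ
  have hk' : β k ≠ 0 := hk
  refine ⟨α k / β k, fun i => ?_⟩
  have := h i k
  unfold wedge at this
  field_simp
  linarith

theorem IsMetricOn.mulVec_grad (hG : IsMetricOn U G) (hy : y ∈ U)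
    (F : EuclideanSpace ℝ (Fin n) → ℝ) : (G y).mulVec (grad G F y) = fun i => pd i F y := by
  rw [grad_eq, Matrix.mulVec_mulVec, Matrix.mul_nonsing_inv _ (hG.isUnit_det hy),
    Matrix.one_mulVec]

/-- If `dφ ∧ df = 0` near `y` and the wedge identity holds at `y`, then `∇f` is an eigenvector of
the Ricci tensor. -/
theorem IsMetricOn.exists_eigenvalue (hG : IsMetricOn U G) (hy : y ∈ U) (hn : 3 ≤ n)
    {f φ : EuclideanSpace ℝ (Fin n) → ℝ} {lam : ℝ} {m : ℕ} (hm : 0 < m)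
    (hf : ContDiffOn ℝ ∞ f U) (hφ : ContDiffOn ℝ ∞ φ U) (hpos : 0 < f y)
    (heq : ∀ i j, ric G i j y + hess G φ i j y
      = lam * G y i j + (m / f y) * hess G f i j y)
    (hdf : (fun i => pd i f y) ≠ 0)
    (hwedge : ∀ i j, wedge (fun k => mainForm G m f φ k y) (fun k => pd k f y) i j
      = ((n : ℝ) - 1) * f y * curvForm G (grad G φ y) (grad G f y) i j y)
    (hpar : ∀ z ∈ U, ∀ i j, wedge (fun k => pd k φ z) (fun k => pd k f z) i j = 0) :
    ∃ μ : ℝ, (ricEnd G y).mulVec (grad G f y) = μ • grad G f y := by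
  have hU := hG.isOpen
  -- Here `c` is just a number at `y`. Below it is `dφ ∧ df = 0` that gets differentiated, so no
  -- regularity of `c` as a function is needed.
  obtain ⟨c, hc⟩ := exists_eq_mul_of_wedge_eq_zero hdf (hpar y hy)
  have hsym : ∀ i j, ric G i j y = ric G j i y := by
    intro i j
    have h1 := heq i j
    have h2 := heq j i
    rw [hG.hess_symm hy hφ j i, hG.hess_symm hy hf j i, hG.apply_comm hy j i] at h2
    linarith
  have hgrad : grad G φ y = c • grad G f y := by
    rw [grad_eq, grad_eq, ← Matrix.mulVec_smul]
    congr 1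
    funext i
    exact hc i
  set v := grad G f y with hv
  set R : Fin n → ℝ := fun i => ∑ k, ric G k i y * v k with hR
  set P : Fin n → ℝ := fun i => ∑ k, hess G φ k i y * v k with hP
  set H : Fin n → ℝ := fun i => ∑ k, hess G f k i y * v k with hH
  have hGv : ∀ i, ∑ k, G y k i * v k = pd i f y := by
    intro i
    have := congrFun (hG.mulVec_grad hy f) i
    rw [← this]
    exact Finset.sum_congr rfl fun k _ => by rw [hG.apply_comm hy k i]
  have h1 : ∀ i, R i + P i = lam * pd i f y + (m / f y) * H i := by
    intro i
    rw [← hGv i, hR, hP, hH]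
    simp only [Finset.mul_sum, ← Finset.sum_add_distrib]
    exact Finset.sum_congr rfl fun k _ => by linear_combination v k * heq k i
  have h2 : ∀ i j, wedge (fun i => ((m : ℝ) + n - 2 - f y * c) * R i + ((n : ℝ) - 2) * P i)
      (fun k => pd k f y) i j = 0 := by
    intro i j
    have hw := hwedge i j
    rw [hgrad, curvForm_smul_left, hG.curvForm_self hy, mul_zero, mul_zero] at hw
    have hmf : ∀ i, mainForm G m f φ i y
        = ((m : ℝ) + n - 2 - f y * c) * R i + ((n : ℝ) - 2) * P i := by
      intro i
      have : ∑ k, ric G k i y * (c • v) k = c * R i := by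
        rw [hR]
        simp only [Pi.smul_apply, smul_eq_mul, Finset.mul_sum]
        exact Finset.sum_congr rfl fun k _ => by ring
      rw [mainForm, hgrad, this]
      ring
    simpa only [hmf] using hw
  have h3 : ∀ k i j, hess G φ k i y * pd j f y + c * pd i f y * hess G f k j y
      - (hess G φ k j y * pd i f y + c * pd j f y * hess G f k i y) = 0 := by
    intro k i j
    have dφ := fun i => (contDiffOn_pd hU hφ i).differentiableAt_of_isOpen hU hy
    have df := fun i => (contDiffOn_pd hU hf i).differentiableAt_of_isOpen hU hy
    have hd := pd_congr_on hU hy (fun z hz => hpar z hz i j) k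
    simp only [wedge] at hd
    rw [pd_const, pd_sub ((dφ i).fun_mul (df j)) ((df i).fun_mul (dφ j)), pd_mul (dφ i) (df j),
      pd_mul (df i) (dφ j), hc i, hc j] at hd
    have hS : ∀ a b, ∑ s, christoffel G s a b y * pd s φ y
        = c * ∑ s, christoffel G s a b y * pd s f y := by
      intro a b
      rw [Finset.mul_sum]
      exact Finset.sum_congr rfl fun s _ => by rw [hc s]; ring
    simp only [hess, hS]
    linear_combination hd
  -- Contracting the derivative of `dφ ∧ df = 0` with `∇f`.
  have h4 : ∀ i j, wedge P (fun k => pd k f y) i j = c * wedge H (fun k => pd k f y) i j := by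
    intro i j
    have hs : ∑ k, (hess G φ k i y * pd j f y + c * pd i f y * hess G f k j y
      - (hess G φ k j y * pd i f y + c * pd j f y * hess G f k i y)) * v k = 0 :=
      Finset.sum_eq_zero fun k _ => by rw [h3, zero_mul]
    have he : ∑ k, (hess G φ k i y * pd j f y + c * pd i f y * hess G f k j y
      - (hess G φ k j y * pd i f y + c * pd j f y * hess G f k i y)) * v k
      = P i * pd j f y + c * pd i f y * H j - (P j * pd i f y + c * pd j f y * H i) := by
      rw [hP, hH]
      simp only [Finset.mul_sum, Finset.sum_mul, ← Finset.sum_add_distrib,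
        ← Finset.sum_sub_distrib]
      exact Finset.sum_congr rfl fun k _ => by ring
    rw [he] at hs
    unfold wedge
    linear_combination hs
  have h5 : ∀ i j, wedge R (fun k => pd k f y) i j = 0 := by
    intro i j
    have e1 := h4 i j
    have e2 := h2 i j
    have e3 : wedge R (fun k => pd k f y) i j + wedge P (fun k => pd k f y) i j
        = (m / f y) * wedge H (fun k => pd k f y) i j := by
      unfold wedge
      linear_combination pd j f y * h1 i - pd i f y * h1 j
    have e4 : ((m : ℝ) + n - 2 - f y * c) * wedge R (fun k => pd k f y) i j
        + ((n : ℝ) - 2) * wedge P (fun k => pd k f y) i j = 0 := by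
      unfold wedge at e2 ⊢
      linear_combination e2
    set wH := wedge H (fun k => pd k f y) i j
    have hf0 := hpos.ne'
    have hm' : (0 : ℝ) < m := by exact_mod_cast hm
    have hn' : (3 : ℝ) ≤ n := by exact_mod_cast hn
    have e5 : wedge R (fun k => pd k f y) i j = (m / f y - c) * wH := by
      linear_combination e3 - e1
    -- Substituting `wR = (m / f - c) wH` and `wP = c wH` and multiplying by `f` completes a square;
    -- the other summand `(n - 2) m` is positive.
    have e6 : (((m : ℝ) - f y * c) ^ 2 + ((n : ℝ) - 2) * m) * wH = 0 := by
      rw [e5, e1] at e4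
      field_simp at e4
      linear_combination e4
    have e7 : wH = 0 := by
      refine (mul_eq_zero.1 e6).resolve_left (ne_of_gt ?_)
      have : 0 < ((n : ℝ) - 2) * m := mul_pos (by linarith) hm'
      positivity
    rw [e5, e7, mul_zero]
  obtain ⟨μ, hμ⟩ := exists_eq_mul_of_wedge_eq_zero hdf h5
  refine ⟨μ, ?_⟩
  rw [ricEnd_eq, ← Matrix.mulVec_mulVec]
  have h6 : (ricMatrix G y).mulVec v = μ • fun i => pd i f y := by
    funext i
    rw [Pi.smul_apply, smul_eq_mul, ← hμ i, hR]
    change ∑ k, ric G i k y * v k = ∑ k, ric G k i y * v k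
    exact Finset.sum_congr rfl fun k _ => by rw [hsym k i]
  rw [h6, Matrix.mulVec_smul]
  rfl

end Eigenvector

/-! ### The wedge identity on the manifold. -/

section WedgeIdentity

variable {n : ℕ} {M : Type*} [TopologicalSpace M]
  [ChartedSpace (EuclideanSpace ℝ (Fin n)) M] [IsManifold (𝓡 n) ∞ M]
  {g : Bundle.ContMDiffRiemannianMetric (𝓡 n) ∞ (EuclideanSpace ℝ (Fin n))
    (fun x : M => TangentSpace (𝓡 n) x)}
  {m : ℕ} {f φ lam : M → ℝ} {e e' : OpenPartialHomeomorph M (EuclideanSpace ℝ (Fin n))}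
  {y : EuclideanSpace ℝ (Fin n)}

/-- Every other term of the defining equation is symmetric, so the symmetry of `Ric` comes without
the first Bianchi identity. -/
theorem IsRicciHessianType.ric_symm (hRH : IsRicciHessianType g m f φ lam)
    (he : e ∈ IsManifold.maximalAtlas (𝓡 n) ∞ M) (hy : y ∈ e.target) (i j : Fin n) :
    ric (chartMetric g e) i j y = ric (chartMetric g e) j i y := by
  have hG := isMetricOn_chartMetric (g := g) he
  have h1 := hRH.equation e he y hy i j
  have h2 := hRH.equation e he y hy j i
  rw [hG.hess_symm hy (contDiffOn_chartFun he hRH.smooth_φ) j i,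
    hG.hess_symm hy (contDiffOn_chartFun he hRH.smooth_f) j i, hG.apply_comm hy j i] at h2
  linarith

omit [ChartedSpace (EuclideanSpace ℝ (Fin n)) M] [IsManifold (𝓡 n) ∞ M] in
theorem transition_mem_source (hy : y ∈ e.target) (hy' : e.symm y ∈ e'.source) :
    y ∈ (e.symm.trans e').source := by
  rw [OpenPartialHomeomorph.trans_source]
  exact ⟨hy, hy'⟩

omit [ChartedSpace (EuclideanSpace ℝ (Fin n)) M] [IsManifold (𝓡 n) ∞ M] in
theorem chartFun_transition (F : M → ℝ) {z : EuclideanSpace ℝ (Fin n)}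
    (hz : z ∈ (e.symm.trans e').source) : chartFun F e z = chartFun F e' (e' (e.symm z)) := by
  rw [OpenPartialHomeomorph.trans_source] at hz
  rw [chartFun, chartFun, e'.left_inv hz.2]

theorem IsLocallyConformallyFlat.isCodazziAt (hn : 2 ≤ n) (h : IsLocallyConformallyFlat g)
    (he : e ∈ IsManifold.maximalAtlas (𝓡 n) ∞ M) (hy : y ∈ e.target) :
    IsCodazziAt (chartMetric g e) (schouten (chartMetric g e)) y := by
  obtain ⟨e', he', hp, u, hu, hpos, hG⟩ := h (e.symm y)
  have hiso := isIsometryOn_transition (g := g) he he'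
  exact hiso.isCodazziAt (transition_mem_source hy hp) hiso.metric'.smooth_schouten
    (fun z hz => hiso.schouten_eq hz)
    (isCodazziAt_of_conformal hn hiso.metric' hu hpos hG (e'.map_source hp))

/-- The wedge identity in an arbitrary chart. -/
theorem wedge_mainForm_eq (hn : 3 ≤ n) (hRH : IsRicciHessianType g m f φ lam)
    (hW : HasHarmonicWeyl g) (he : e ∈ IsManifold.maximalAtlas (𝓡 n) ∞ M) (hy : y ∈ e.target)
    (i j : Fin n) :
    wedge (fun k => mainForm (chartMetric g e) m (chartFun f e) (chartFun φ e) k y)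
        (fun k => pd k (chartFun f e) y) i j
      = ((n : ℝ) - 1) * chartFun f e y * curvForm (chartMetric g e)
          (grad (chartMetric g e) (chartFun φ e) y) (grad (chartMetric g e) (chartFun f e) y)
          i j y := by
  obtain ⟨e', he', hp, hN⟩ := exists_normal_chart g he (e.map_target hy)
  have hG' := isMetricOn_chartMetric (g := g) he'
  have hy' : e' (e.symm y) ∈ e'.target := e'.map_source hp
  have hsym : ∀ z ∈ e'.target, ∀ i j,
      ric (chartMetric g e') i j z = ric (chartMetric g e') j i z :=
    fun z hz => hRH.ric_symm he' hz
  have hcod : IsCodazziAt (chartMetric g e') (schouten (chartMetric g e')) (e' (e.symm y)) := by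
    rcases hn.eq_or_lt with h3 | h4
    · exact (hW.2 h3.symm).isCodazziAt (by omega) he' hy'
    · exact hN.isCodazziAt_of_divWeyl hG' hy' hsym h4 fun i j k => hW.1 e' he' _ hy' i j k
  have sf := contDiffOn_chartFun he' hRH.smooth_f
  have sφ := contDiffOn_chartFun he' hRH.smooth_φ
  have hmain := hN.wedge_mainForm hG' hy' hsym m sf sφ (contDiffOn_chartFun he' hRH.smooth_lam)
    (fun z _ => hRH.f_pos _) (hRH.equation e' he') hcod
  have hiso := isIsometryOn_transition (g := g) he he'
  have hyU := transition_mem_source hy hp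
  have cf := fun z (hz : z ∈ (e.symm.trans e').source) => chartFun_transition f hz
  have cφ := fun z (hz : z ∈ (e.symm.trans e').source) => chartFun_transition φ hz
  -- Both sides are covariant 2-tensors, so each is the sum of its components in the normal chart
  -- weighted by `J_ai J_bj`.
  rw [hiso.curvForm_eq hyU, hiso.jacobian_mulVec_grad hyU sf cf,
    hiso.jacobian_mulVec_grad hyU sφ cφ, cf y hyU]
  simp only [wedge, hiso.mainForm_eq hyU sf cf sφ cφ, hiso.pd_eq hyU sf cf] at hmain ⊢
  rw [Finset.sum_mul_sum, Finset.sum_mul_sum]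
  simp only [Finset.mul_sum]
  have hterm : ∀ a b, ((n : ℝ) - 1) * chartFun f e' (e' (e.symm y)) *
      (jacobian (fun z => e' (e.symm z)) y a i * jacobian (fun z => e' (e.symm z)) y b j *
        curvForm (chartMetric g e') (grad (chartMetric g e') (chartFun φ e') (e' (e.symm y)))
          (grad (chartMetric g e') (chartFun f e') (e' (e.symm y))) a b (e' (e.symm y)))
      = jacobian (fun z => e' (e.symm z)) y a i * jacobian (fun z => e' (e.symm z)) y b j *
        (mainForm (chartMetric g e') m (chartFun f e') (chartFun φ e') a (e' (e.symm y))
            * pd b (chartFun f e') (e' (e.symm y))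
          - pd a (chartFun f e') (e' (e.symm y))
            * mainForm (chartMetric g e') m (chartFun f e') (chartFun φ e') b
              (e' (e.symm y))) := by
    intro a b
    rw [hmain a b]
    ring
  simp only [hterm, mul_sub, Finset.sum_sub_distrib]
  congr 1 <;>
  exact Finset.sum_congr rfl fun a _ => Finset.sum_congr rfl fun b _ => by ring

end WedgeIdentity


/-! ### Sard's theorem for smooth real functions. -/

section Sard

open MeasureTheory Filter Topology

/-- By the Lindelöf property, countably many of the neighbourhoods cover `S`. -/
theorem volume_image_eq_zero_of_local {X : Type*} [TopologicalSpace X] [SecondCountableTopology X]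
    {f : X → ℝ} {S : Set X} (h : ∀ x ∈ S, ∃ V ∈ 𝓝 x, volume (f '' (V ∩ S)) = 0) :
    volume (f '' S) = 0 := by
  choose! V hV hnull using h
  obtain ⟨t, htS, htc, hcov⟩ := TopologicalSpace.countable_cover_nhdsWithin (f := V) (s := S)
    fun x hx => mem_nhdsWithin_of_mem_nhds (hV x hx)
  have hsub : f '' S ⊆ ⋃ x ∈ t, f '' (V x ∩ S) := by
    rintro _ ⟨x, hx, rfl⟩
    obtain ⟨z, hz, hxz⟩ := Set.mem_iUnion₂.1 (hcov hx)
    exact Set.mem_iUnion₂.2 ⟨z, hz, x, ⟨hxz, hx⟩, rfl⟩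
  exact measure_mono_null hsub ((measure_biUnion_null_iff htc).2 fun z hz => hnull z (htS hz))

variable {E : Type} [NormedAddCommGroup E] [NormedSpace ℝ E] [FiniteDimensional ℝ E]

/-- A smooth map is `O(‖y - x‖ ^ k)` near a point, uniformly in the points `x` at which its
derivatives of order less than `k` vanish. -/
theorem exists_norm_le_of_iteratedFDeriv_eq_zero (k : ℕ) : ∀ {F : Type} [NormedAddCommGroup F]
    [NormedSpace ℝ F] {h : E → F} (_ : ContDiff ℝ ∞ h) (x₀ : E), ∃ K : ℝ, 0 ≤ K ∧
      ∀ x ∈ Metric.ball x₀ 1, (∀ j < k, iteratedFDeriv ℝ j h x = 0) →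
        ∀ y ∈ Metric.ball x₀ 1, ‖h y‖ ≤ K * ‖y - x‖ ^ k := by
  induction k with
  | zero =>
    intro F _ _ h hh x₀
    have : ProperSpace E := FiniteDimensional.proper_real E
    obtain ⟨K, hK⟩ := (isCompact_closedBall x₀ 1).exists_bound_of_continuousOn
      hh.continuous.continuousOn
    refine ⟨max K 0, le_max_right _ _, fun x _ _ y hy => ?_⟩
    rw [pow_zero, mul_one]
    exact (hK y (Metric.ball_subset_closedBall hy)).trans (le_max_left _ _)
  | succ k ih =>
    intro F _ _ h hh x₀
    -- The bound of order `k` for the derivative, integrated along the segment from `x` to `y`,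
    -- gains one power.
    obtain ⟨K, hK0, hK⟩ := ih (hh.fderiv_right (m := ∞) (by simp)) x₀
    refine ⟨K, hK0, fun x hx hvan y hy => ?_⟩
    have hfd : ∀ z ∈ Metric.ball x₀ 1, ‖fderiv ℝ h z‖ ≤ K * ‖z - x‖ ^ k := by
      refine hK x hx fun j hj => ?_
      rw [← norm_eq_zero, norm_iteratedFDeriv_fderiv, hvan (j + 1) (by omega), norm_zero]
    have h0 : h x = 0 := by
      have := hvan 0 (by omega)
      rwa [← norm_eq_zero, norm_iteratedFDeriv_zero, norm_eq_zero] at this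
    have hseg := (convex_ball x₀ 1).segment_subset hx hy
    have hb : ∀ z ∈ segment ℝ x y, ‖fderiv ℝ h z‖ ≤ K * ‖y - x‖ ^ k := by
      intro z hz
      refine (hfd z (hseg hz)).trans ?_
      have : ‖z - x‖ ≤ ‖y - x‖ := by
        rw [← dist_eq_norm, ← dist_eq_norm, dist_comm z x, dist_comm y x]
        have := dist_add_dist_of_mem_segment hz
        linarith [dist_nonneg (x := z) (y := y)]
      gcongr
    have := (convex_segment x y).norm_image_sub_le_of_norm_fderiv_le
      (fun z _ => hh.contDiffAt.differentiableAt (by simp)) hb (left_mem_segment ℝ x y)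
      (right_mem_segment ℝ x y)
    rw [h0, sub_zero] at this
    rw [pow_succ, ← mul_assoc]
    exact this

/-- The image of the set where sufficiently many derivatives vanish is a null set. -/
theorem volume_image_flat_eq_zero {f : E → ℝ} (hf : ContDiff ℝ ∞ f) :
    volume (f '' {x | ∀ j < Module.finrank ℝ E, iteratedFDeriv ℝ j (fderiv ℝ f) x = 0}) = 0 := by
  set N := Module.finrank ℝ E with hN
  set S := {x | ∀ j < N, iteratedFDeriv ℝ j (fderiv ℝ f) x = 0} with hS
  have hr : (0 : NNReal) < (N : NNReal) + 1 := by positivity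
  -- On the flat set `f` is locally Hölder of exponent `N + 1`, so the image has dimension at most
  -- `N / (N + 1) < 1`.
  have hdim : dimH (f '' S) ≤ dimH S / ((N : NNReal) + 1 : NNReal) := by
    refine dimH_image_le_of_locally_holder_on hr fun x₀ _ => ?_
    obtain ⟨K, hK0, hK⟩ := exists_norm_le_of_iteratedFDeriv_eq_zero N
      (hf.fderiv_right (m := ∞) (by simp)) x₀
    lift K to NNReal using hK0
    refine ⟨K, Metric.ball x₀ 1 ∩ S, ?_, ?_⟩
    · exact Filter.inter_mem (mem_nhdsWithin_of_mem_nhds (Metric.ball_mem_nhds x₀ one_pos))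
        self_mem_nhdsWithin
    · intro x hx y hy
      have hseg := (convex_ball x₀ 1).segment_subset hx.1 hy.1
      have hb : ∀ z ∈ segment ℝ x y, ‖fderiv ℝ f z‖ ≤ K * ‖y - x‖ ^ N := by
        intro z hz
        refine (hK x hx.1 hx.2 z (hseg hz)).trans ?_
        have : ‖z - x‖ ≤ ‖y - x‖ := by
          rw [← dist_eq_norm, ← dist_eq_norm, dist_comm z x, dist_comm y x]
          have := dist_add_dist_of_mem_segment hz
          linarith [dist_nonneg (x := z) (y := y)]
        gcongr
      have h1 := (convex_segment x y).norm_image_sub_le_of_norm_fderiv_le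
        (fun z _ => hf.contDiffAt.differentiableAt (by simp)) hb (left_mem_segment ℝ x y)
        (right_mem_segment ℝ x y)
      rw [mul_assoc, ← pow_succ, ← dist_eq_norm, ← dist_eq_norm, dist_comm (f y), dist_comm y] at h1
      have h2 : nndist (f x) (f y) ≤ K * nndist x y ^ (N + 1) := by
        rw [← NNReal.coe_le_coe]
        simpa using h1
      rw [edist_nndist, edist_nndist]
      have h3 : ((N : NNReal) + 1 : NNReal) = ((N + 1 : ℕ) : NNReal) := by push_cast; rfl
      rw [h3, NNReal.coe_natCast, ENNReal.rpow_natCast]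
      exact_mod_cast h2
  have hlt : dimH (f '' S) < (1 : NNReal) := by
    refine hdim.trans_lt ?_
    have h1 : dimH S ≤ (N : ENNReal) := (dimH_mono (Set.subset_univ S)).trans
      (by rw [Real.dimH_univ_eq_finrank])
    refine (ENNReal.div_le_div_right h1 _).trans_lt ?_
    rw [ENNReal.div_lt_iff (Or.inl (by exact_mod_cast hr.ne')) (Or.inl ENNReal.coe_ne_top)]
    rw [ENNReal.coe_one, one_mul]
    exact_mod_cast Nat.lt_succ_self N
  refine measure_zero_of_dimH_lt ?_ hlt
  rw [NNReal.coe_one, hausdorffMeasure_real]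

/-- A cut-off by a bump function, which reduces functions defined on open sets to the global case.
-/
theorem exists_contDiff_eventuallyEq {f : E → ℝ} {U : Set E} (hU : IsOpen U)
    (hf : ContDiffOn ℝ ∞ f U) {x : E} (hx : x ∈ U) :
    ∃ F : E → ℝ, ContDiff ℝ ∞ F ∧ F =ᶠ[𝓝 x] f := by
  obtain ⟨ε, hε, hball⟩ := Metric.isOpen_iff.1 hU x hx
  let χ : ContDiffBump x := ⟨ε / 4, ε / 2, by positivity, by linarith⟩
  refine ⟨fun z => χ z * f z, ?_, ?_⟩
  · rw [contDiff_iff_contDiffAt]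
    intro z
    by_cases hz : z ∈ U
    · exact χ.contDiff.contDiffAt.mul (hf.contDiffAt (hU.mem_nhds hz))
    · have hzt : z ∉ tsupport χ := by
        rw [χ.tsupport_eq]
        intro hz'
        refine hz (hball ?_)
        rw [Metric.mem_closedBall] at hz'
        rw [Metric.mem_ball]
        exact hz'.trans_lt (by change ε / 2 < ε; linarith)
      have h0 : (fun z => χ z * f z) =ᶠ[𝓝 z] fun _ => 0 := by
        filter_upwards [notMem_tsupport_iff_eventuallyEq.1 hzt] with w hw
        rw [hw]
        simp
      exact contDiffAt_const.congr_of_eventuallyEq h0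
  · filter_upwards [χ.eventuallyEq_one] with z hz
    rw [hz]
    simp

theorem volume_image_critical_on_eq_zero (h : ∀ F : E → ℝ, ContDiff ℝ ∞ F →
      volume (F '' {x | fderiv ℝ F x = 0}) = 0) {f : E → ℝ} {U : Set E} (hU : IsOpen U)
    (hf : ContDiffOn ℝ ∞ f U) : volume (f '' {x ∈ U | fderiv ℝ f x = 0}) = 0 := by
  have : SecondCountableTopology E := by
    have : ProperSpace E := FiniteDimensional.proper_real E
    infer_instance
  refine volume_image_eq_zero_of_local fun x hx => ?_
  obtain ⟨F, hF, hFf⟩ := exists_contDiff_eventuallyEq hU hf hx.1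
  refine ⟨_, eventually_eventually_nhds.2 hFf, measure_mono_null ?_ (h F hF)⟩
  rintro _ ⟨z, ⟨hz, hzU⟩, rfl⟩
  have hz' : F =ᶠ[𝓝 z] f := hz
  exact ⟨z, by rw [Set.mem_ofPred_eq, hz'.fderiv_eq]; exact hzU.2, hz'.self_of_nhds⟩

/-- The inductive step in the theorem of Sard: critical points on a smooth hypersurface. -/
theorem exists_volume_image_hypersurface_eq_zero
    (ih : ∀ (K : Type) [NormedAddCommGroup K] [NormedSpace ℝ K] [FiniteDimensional ℝ K],
      Module.finrank ℝ K < Module.finrank ℝ E → ∀ F : K → ℝ, ContDiff ℝ ∞ F →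
      volume (F '' {x | fderiv ℝ F x = 0}) = 0)
    {f w : E → ℝ} (hf : ContDiff ℝ ∞ f) (hw : ContDiff ℝ ∞ w) {x₀ : E}
    (hw0 : fderiv ℝ w x₀ ≠ 0) :
    ∃ V ∈ 𝓝 x₀, volume (f '' {x ∈ V | w x = 0 ∧ fderiv ℝ f x = 0}) = 0 := by
  have : CompleteSpace E := FiniteDimensional.complete ℝ E
  set L := fderiv ℝ w x₀ with hL
  obtain ⟨v₀, hv₀⟩ : ∃ v, L v ≠ 0 := by
    by_contra hcon
    push Not at hcon
    exact hw0 (ContinuousLinearMap.ext hcon)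
  set v := (L v₀)⁻¹ • v₀ with hv
  have hLv : L v = 1 := by rw [hv, map_smul, smul_eq_mul, inv_mul_cancel₀ hv₀]
  let K := L.ker
  have hfin : Module.finrank ℝ K < Module.finrank ℝ E := by
    refine Submodule.finrank_lt fun htop => hv₀ ?_
    have : v₀ ∈ K := by rw [show K = ⊤ from htop]; trivial
    exact this
  let P : E →L[ℝ] K := (ContinuousLinearMap.id ℝ E - L.smulRight v).codRestrict K fun z => by
    change L (z - L z • v) = 0
    rw [map_sub, map_smul, hLv, smul_eq_mul, mul_one, sub_self]
  have hP : ∀ z, (P z : E) = z - L z • v := fun z => rfl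
  -- The splitting `E ≅ ℝ v ⊕ ker L`. By the inverse function theorem `z ↦ (w z, P z)` is then a
  -- local coordinate system which flattens `{w = 0}` into `{0} × K`.
  let A : E ≃L[ℝ] ℝ × K := ContinuousLinearEquiv.equivOfInverse (L.prod P)
    ((K.subtypeL.comp (ContinuousLinearMap.snd ℝ ℝ K))
      + (ContinuousLinearMap.fst ℝ ℝ K).smulRight v)
    (fun z => by
      change (P z : E) + L z • v = z
      rw [hP, sub_add_cancel])
    (fun q => by
      obtain ⟨t, k⟩ := q
      have hk : L (k : E) = 0 := k.2
      have h1 : L ((k : E) + t • v) = t := by rw [map_add, map_smul, hk, hLv]; simp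
      refine Prod.ext h1 (Subtype.ext ?_)
      change ((k : E) + t • v) - L ((k : E) + t • v) • v = k
      rw [h1, add_sub_cancel_right])
  have hT : ContDiff ℝ ∞ fun z => (w z, P z) := hw.prodMk P.contDiff
  have hA : HasFDerivAt (fun z => (w z, P z)) (A : E →L[ℝ] ℝ × K) x₀ :=
    (hw.contDiffAt.differentiableAt (by simp)).hasFDerivAt.prodMk P.hasFDerivAt
  obtain ⟨φ, hφx, hφT, hφs⟩ := exists_openPartialHomeomorph hT hA
  have hincl : ContDiff ℝ ∞ fun k : K => ((0 : ℝ), k) := contDiff_const.prodMk contDiff_id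
  have hO : IsOpen ((fun k : K => ((0 : ℝ), k)) ⁻¹' φ.target) :=
    φ.open_target.preimage hincl.continuous
  have hψ : ContDiffOn ℝ ∞ (fun k : K => φ.symm ((0 : ℝ), k))
      ((fun k : K => ((0 : ℝ), k)) ⁻¹' φ.target) :=
    hφs.comp hincl.contDiffOn fun k hk => hk
  have hnull := volume_image_critical_on_eq_zero (ih K hfin) hO (hf.comp_contDiffOn hψ)
  refine ⟨φ.source, φ.open_source.mem_nhds hφx, measure_mono_null ?_ hnull⟩
  rintro _ ⟨x, ⟨hx, hwx, hfx⟩, rfl⟩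
  have h1 : ((0 : ℝ), P x) = φ x := by rw [hφT, hwx]
  have h2 : φ.symm ((0 : ℝ), P x) = x := by rw [h1, φ.left_inv hx]
  have h3 : P x ∈ (fun k : K => ((0 : ℝ), k)) ⁻¹' φ.target := by
    rw [Set.mem_preimage, h1]
    exact φ.map_source hx
  -- A critical point of `f` on the hypersurface is critical for `f` restricted to it, a function on
  -- a space of smaller dimension.
  refine ⟨P x, ⟨h3, ?_⟩, by rw [Function.comp, h2]⟩
  rw [fderiv_comp (P x) (hf.contDiffAt.differentiableAt (by simp))
    ((hψ.contDiffAt (hO.mem_nhds h3)).differentiableAt (by simp)), h2, hfx]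
  exact ContinuousLinearMap.zero_comp _

/-- The theorem of Sard for smooth real functions. -/
theorem volume_image_critical_eq_zero (N : ℕ) : ∀ (E : Type) [NormedAddCommGroup E]
    [NormedSpace ℝ E] [FiniteDimensional ℝ E], Module.finrank ℝ E = N → ∀ f : E → ℝ,
    ContDiff ℝ ∞ f → volume (f '' {x | fderiv ℝ f x = 0}) = 0 := by
  induction N using Nat.strong_induction_on with
  | _ N ih =>
    intro E _ _ _ hE f hf
    have : SecondCountableTopology E := by
      have : ProperSpace E := FiniteDimensional.proper_real E
      infer_instance
    have hf' : ContDiff ℝ ∞ (fderiv ℝ f) := hf.fderiv_right (by simp)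
    have hD : ∀ k, ContDiff ℝ ∞ (iteratedFDeriv ℝ k (fderiv ℝ f)) := fun k =>
      hf'.iteratedFDeriv_right (m := ∞) (by exact_mod_cast le_top)
    have hstep : ∀ k, volume (f '' {x | fderiv ℝ f x = 0 ∧
        iteratedFDeriv ℝ k (fderiv ℝ f) x = 0 ∧
        fderiv ℝ (iteratedFDeriv ℝ k (fderiv ℝ f)) x ≠ 0}) = 0 := by
      intro k
      refine volume_image_eq_zero_of_local fun x₀ hx₀ => ?_
      obtain ⟨v, hv⟩ : ∃ v, fderiv ℝ (iteratedFDeriv ℝ k (fderiv ℝ f)) x₀ v ≠ 0 := by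
        by_contra hcon
        push Not at hcon
        exact hx₀.2.2 (ContinuousLinearMap.ext hcon)
      -- A functional that does not vanish on the nonzero derivative in direction `v` makes the
      -- tensor-valued derivative a scalar `w` with `w = 0` on the set and `dw ≠ 0` at `x₀`.
      obtain ⟨ℓ, -, hℓ⟩ := exists_dual_vector ℝ _ (norm_ne_zero_iff.2 hv)
      have hw0 : fderiv ℝ (fun x => ℓ (iteratedFDeriv ℝ k (fderiv ℝ f) x)) x₀ ≠ 0 := by
        have h1 : HasFDerivAt (fun x => ℓ (iteratedFDeriv ℝ k (fderiv ℝ f) x))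
            (ℓ.comp (fderiv ℝ (iteratedFDeriv ℝ k (fderiv ℝ f)) x₀)) x₀ :=
          ℓ.hasFDerivAt.comp x₀ ((hD k).contDiffAt.differentiableAt (by simp)).hasFDerivAt
        rw [h1.fderiv]
        intro h0
        have h2 := congrArg (fun B : E →L[ℝ] ℝ => B v) h0
        simp only [ContinuousLinearMap.comp_apply, hℓ] at h2
        exact norm_ne_zero_iff.2 hv (by simpa using h2)
      obtain ⟨V, hV, hnull⟩ := exists_volume_image_hypersurface_eq_zero
        (fun K _ _ _ hK F hF => ih _ (hE ▸ hK) K rfl F hF) hf (ℓ.contDiff.comp (hD k)) hw0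
      refine ⟨V, hV, measure_mono_null (Set.image_mono ?_) hnull⟩
      rintro x ⟨hxV, hx1, hx2, -⟩
      exact ⟨hxV, by rw [Function.comp, hx2, map_zero], hx1⟩
    have hsub : f '' {x | fderiv ℝ f x = 0} ⊆
        f '' {x | ∀ j < Module.finrank ℝ E, iteratedFDeriv ℝ j (fderiv ℝ f) x = 0} ∪
        ⋃ k, f '' {x | fderiv ℝ f x = 0 ∧ iteratedFDeriv ℝ k (fderiv ℝ f) x = 0 ∧
          fderiv ℝ (iteratedFDeriv ℝ k (fderiv ℝ f)) x ≠ 0} := by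
      rintro _ ⟨x, hx, rfl⟩
      by_cases hflat : ∀ j, iteratedFDeriv ℝ j (fderiv ℝ f) x = 0
      · exact Or.inl ⟨x, fun j _ => hflat j, rfl⟩
      · push Not at hflat
        classical
        -- A critical point which is not flat is sorted by the first nonvanishing derivative of
        -- `df`; its order is positive because `df = 0` there.
        have hspec := Nat.find_spec hflat
        have hmin := fun j (hj : j < Nat.find hflat) => Nat.find_min hflat hj
        set j₀ := Nat.find hflat
        obtain ⟨k, hk⟩ : ∃ k, j₀ = k + 1 := by
          refine Nat.exists_eq_succ_of_ne_zero fun h0 => hspec ?_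
          rw [h0, ← norm_eq_zero, norm_iteratedFDeriv_zero, norm_eq_zero]
          exact hx
        refine Or.inr (Set.mem_iUnion.2 ⟨k, x, ⟨hx, ?_, ?_⟩, rfl⟩)
        · by_contra hne
          exact hmin k (by omega) hne
        · intro h0
          apply hspec
          rw [hk]
          ext v
          rw [iteratedFDeriv_succ_apply_left, h0]
          rfl
    exact measure_mono_null hsub
      (measure_union_null (volume_image_flat_eq_zero hf) (measure_iUnion_null hstep))

end Sard


/-! ### Density of regular values and the proportionality of `dφ` and `df`. -/

section RegularValues

open MeasureTheory Filter Topology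

variable {n : ℕ}

theorem pd_eq_zero_iff {F : EuclideanSpace ℝ (Fin n) → ℝ} {y : EuclideanSpace ℝ (Fin n)} :
    (fun i => pd i F y) = 0 ↔ fderiv ℝ F y = 0 := by
  constructor
  · intro h
    ext v
    rw [fderiv_eq_sum_pd]
    exact Finset.sum_eq_zero fun i _ => by rw [show pd i F y = 0 from congrFun h i, zero_mul]
  · intro h
    funext i
    simp [pd, h]

variable {M : Type*} [TopologicalSpace M] [ChartedSpace (EuclideanSpace ℝ (Fin n)) M]
  {f φ : M → ℝ} {e : OpenPartialHomeomorph M (EuclideanSpace ℝ (Fin n))}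
  {y : EuclideanSpace ℝ (Fin n)}

theorem fderiv_chartFun (he : e ∈ IsManifold.maximalAtlas (𝓡 n) ∞ M) (hy : y ∈ e.target)
    (hf : ContMDiff (𝓡 n) 𝓘(ℝ, ℝ) ∞ f) :
    fderiv ℝ (chartFun f e) y
      = (mfderiv (𝓡 n) 𝓘(ℝ, ℝ) f (e.symm y)).comp (mfderiv (𝓡 n) (𝓡 n) e.symm y) := by
  rw [← mfderiv_eq_fderiv]
  exact mfderiv_comp y ((hf _).mdifferentiableAt (by simp)) (mdifferentiableAt_symm he hy)

theorem mfderiv_symm_surjective (he : e ∈ IsManifold.maximalAtlas (𝓡 n) ∞ M)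
    (hy : y ∈ e.target) : Function.Surjective (mfderiv (𝓡 n) (𝓡 n) e.symm y) := by
  let L : EuclideanSpace ℝ (Fin n) →L[ℝ] EuclideanSpace ℝ (Fin n) :=
    mfderiv (𝓡 n) (𝓡 n) e.symm y
  exact (LinearMap.injective_iff_surjective (f := L.toLinearMap)).1 (mfderiv_symm_injective he hy)

theorem fderiv_chartFun_eq_zero_iff (he : e ∈ IsManifold.maximalAtlas (𝓡 n) ∞ M)
    (hy : y ∈ e.target) (hf : ContMDiff (𝓡 n) 𝓘(ℝ, ℝ) ∞ f) :
    fderiv ℝ (chartFun f e) y = 0 ↔ mfderiv (𝓡 n) 𝓘(ℝ, ℝ) f (e.symm y) = 0 := by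
  rw [fderiv_chartFun he hy hf]
  constructor
  · intro h
    ext v
    obtain ⟨w, rfl⟩ := mfderiv_symm_surjective he hy v
    exact congrArg (fun L => L w) h
  · intro h
    rw [h]
    exact ContinuousLinearMap.zero_comp _

variable [IsManifold (𝓡 n) ∞ M]

/-- The theorem of Sard for a smooth real function on a manifold. -/
theorem volume_image_mfderiv_eq_zero [SecondCountableTopology M]
    (hf : ContMDiff (𝓡 n) 𝓘(ℝ, ℝ) ∞ f) :
    volume (f '' {p | mfderiv (𝓡 n) 𝓘(ℝ, ℝ) f p = 0}) = 0 := by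
  refine volume_image_eq_zero_of_local fun p _ => ?_
  have he := IsManifold.chart_mem_maximalAtlas (I := 𝓡 n) (n := ∞) p
  set e := chartAt (EuclideanSpace ℝ (Fin n)) p
  have hnull := volume_image_critical_on_eq_zero
    (volume_image_critical_eq_zero _ (EuclideanSpace ℝ (Fin n)) rfl) e.open_target
    (contDiffOn_chartFun he hf)
  refine ⟨e.source, e.open_source.mem_nhds (mem_chart_source _ p), measure_mono_null ?_ hnull⟩
  rintro _ ⟨q, ⟨hq, hq0⟩, rfl⟩
  refine ⟨e q, ⟨e.map_source hq, ?_⟩, ?_⟩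
  · rw [fderiv_chartFun_eq_zero_iff he (e.map_source hq) hf, e.left_inv hq]
    exact hq0
  · rw [chartFun, e.left_inv hq]

/-- If `dφ` vanishes on the kernel of `df` along the regular levels of `f`, then `dφ ∧ df = 0`
wherever `df ≠ 0`, since the regular values are dense. -/
theorem GradNormalOnLevels.wedge_eq_zero [SecondCountableTopology M]
    (h : GradNormalOnLevels n f φ) (hf : ContMDiff (𝓡 n) 𝓘(ℝ, ℝ) ∞ f)
    (hφ : ContMDiff (𝓡 n) 𝓘(ℝ, ℝ) ∞ φ) (he : e ∈ IsManifold.maximalAtlas (𝓡 n) ∞ M)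
    (hy : y ∈ e.target) (hdf : fderiv ℝ (chartFun f e) y ≠ 0) (i j : Fin n) :
    wedge (fun k => pd k (chartFun φ e) y) (fun k => pd k (chartFun f e) y) i j = 0 := by
  have sf := contDiffOn_chartFun he hf
  have sφ := contDiffOn_chartFun he hφ
  by_contra hne
  have hcont : ContinuousOn (fun z => wedge (fun k => pd k (chartFun φ e) z)
      (fun k => pd k (chartFun f e) z) i j) e.target := by
    have c1 := fun i => (contDiffOn_pd e.open_target sf i).continuousOn
    have c2 := fun i => (contDiffOn_pd e.open_target sφ i).continuousOn
    exact ((c2 i).mul (c1 j)).sub ((c1 i).mul (c2 j))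
  have hnhds := e.open_target.mem_nhds hy
  have hV : {z | z ∈ e.target ∧ wedge (fun k => pd k (chartFun φ e) z)
      (fun k => pd k (chartFun f e) z) i j ≠ 0} ∈ 𝓝 y :=
    inter_mem hnhds ((hcont.continuousAt hnhds).eventually_ne hne)
  have hstrict : HasStrictFDerivAt (chartFun f e) (fderiv ℝ (chartFun f e) y) y :=
    (sf.contDiffAt hnhds).hasStrictFDerivAt (by simp)
  have hsurj : (fderiv ℝ (chartFun f e) y).range = ⊤ := by
    refine LinearMap.range_eq_top.2 (LinearMap.surjective fun h0 => hdf ?_)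
    exact ContinuousLinearMap.coe_injective h0
  -- Since `f` is a submersion at `y`, the image of a neighbourhood has positive measure and so
  -- contains a regular value. A change of level is needed because the level of `y` itself may
  -- contain critical points elsewhere, and then the hypothesis says nothing about it.
  have himg : chartFun f e '' {z | z ∈ e.target ∧ wedge (fun k => pd k (chartFun φ e) z)
      (fun k => pd k (chartFun f e) z) i j ≠ 0} ∈ 𝓝 (chartFun f e y) := by
    rw [← hstrict.map_nhds_eq_of_surj hsurj]
    exact image_mem_map hV
  obtain ⟨c, ⟨z, ⟨hz, hwz⟩, rfl⟩, hreg⟩ : ∃ c ∈ chartFun f e '' {z | z ∈ e.target ∧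
      wedge (fun k => pd k (chartFun φ e) z) (fun k => pd k (chartFun f e) z) i j ≠ 0},
      c ∉ f '' {p | mfderiv (𝓡 n) 𝓘(ℝ, ℝ) f p = 0} := by
    by_contra hcon
    push Not at hcon
    exact (Measure.measure_pos_of_mem_nhds volume himg).ne'
      (measure_mono_null hcon (volume_image_mfderiv_eq_zero hf))
  have hker : ∀ v, fderiv ℝ (chartFun f e) z v = 0 → fderiv ℝ (chartFun φ e) z v = 0 := by
    intro v hv
    rw [fderiv_chartFun he hz hf] at hv
    rw [fderiv_chartFun he hz hφ]
    exact h (chartFun f e z) (fun p hp h0 => hreg ⟨p, h0, hp⟩) (e.symm z) rfl _ hv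
  refine hwz ?_
  -- This vector lies in the kernel of `df`, and `dφ` takes on it the value of the wedge component.
  have hv := hker (pd j (chartFun f e) z • EuclideanSpace.single i 1
    - pd i (chartFun f e) z • EuclideanSpace.single j 1)
  simp only [map_sub, map_smul, smul_eq_mul] at hv
  have hv' : pd j (chartFun f e) z * pd i (chartFun φ e) z
      - pd i (chartFun f e) z * pd j (chartFun φ e) z = 0 :=
    hv (sub_eq_zero.2 (mul_comm (pd j (chartFun f e) z) (pd i (chartFun f e) z)))
  unfold wedge
  linear_combination hv'

end RegularValues

/-! ### The eigenvector statement in all charts. -/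

section Eigenvalue

variable {n : ℕ} {M : Type*} [TopologicalSpace M] [SecondCountableTopology M]
  [ChartedSpace (EuclideanSpace ℝ (Fin n)) M] [IsManifold (𝓡 n) ∞ M]
  {g : Bundle.ContMDiffRiemannianMetric (𝓡 n) ∞ (EuclideanSpace ℝ (Fin n))
    (fun x : M => TangentSpace (𝓡 n) x)}
  {m : ℕ} {f φ lam : M → ℝ}

/-- Where `∇f ≠ 0`, it is an eigenvector of the Ricci tensor in every chart. -/
theorem exists_hasEigenvector_grad (hn : 3 ≤ n) (hRH : IsRicciHessianType g m f φ lam)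
    (hW : HasHarmonicWeyl g) (hnormal : GradNormalOnLevels n f φ) {p : M}
    (hp : mfderiv (𝓡 n) 𝓘(ℝ, ℝ) f p ≠ 0) :
    ∃ μ : ℝ, ∀ e ∈ IsManifold.maximalAtlas (𝓡 n) ∞ M, p ∈ e.source →
      Module.End.HasEigenvector (Matrix.toLin' (ricEnd (chartMetric g e) (e p))) μ
        (grad (chartMetric g e) (chartFun f e) (e p)) := by
  have he₀ := IsManifold.chart_mem_maximalAtlas (I := 𝓡 n) (n := ∞) p
  have hp₀ := mem_chart_source (EuclideanSpace ℝ (Fin n)) p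
  set e₀ := chartAt (EuclideanSpace ℝ (Fin n)) p
  have hy := e₀.map_source hp₀
  have hpy : e₀.symm (e₀ p) = p := e₀.left_inv hp₀
  have hdf : ∀ e ∈ IsManifold.maximalAtlas (𝓡 n) ∞ M, p ∈ e.source →
      fderiv ℝ (chartFun f e) (e p) ≠ 0 := by
    intro e he hpe
    rw [Ne, fderiv_chartFun_eq_zero_iff he (e.map_source hpe) hRH.smooth_f, e.left_inv hpe]
    exact hp
  have sf := contDiffOn_chartFun he₀ hRH.smooth_f
  have sφ := contDiffOn_chartFun he₀ hRH.smooth_φ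
  -- The wedge `dφ ∧ df` is differentiated later, so its vanishing is needed on an open set; the set
  -- `df ≠ 0` serves.
  have hU : IsOpen (e₀.target ∩ fderiv ℝ (chartFun f e₀) ⁻¹' {0}ᶜ) :=
    (sf.continuousOn_fderiv_of_isOpen e₀.open_target (by simp)).isOpen_inter_preimage
      e₀.open_target isOpen_compl_singleton
  have hUsub : e₀.target ∩ fderiv ℝ (chartFun f e₀) ⁻¹' {0}ᶜ ⊆ e₀.target :=
    Set.inter_subset_left
  obtain ⟨μ, hμ⟩ := ((isMetricOn_chartMetric (g := g) he₀).mono hU hUsub).exists_eigenvalue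
    ⟨hy, hdf e₀ he₀ hp₀⟩ hn hRH.m_pos (sf.mono hUsub) (sφ.mono hUsub) (hRH.f_pos _)
    (hRH.equation e₀ he₀ _ hy) (pd_eq_zero_iff.not.2 (hdf e₀ he₀ hp₀))
    (wedge_mainForm_eq hn hRH hW he₀ hy)
    fun z hz => hnormal.wedge_eq_zero hRH.smooth_f hRH.smooth_φ he₀ hz.1 hz.2
  refine ⟨μ, fun e he hpe => ⟨?_, fun h0 => hdf e he hpe ?_⟩⟩
  · rw [Module.End.mem_eigenspace_iff, Matrix.toLin'_apply]
    have hiso := isIsometryOn_transition (g := g) he₀ he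
    have hyU := transition_mem_source hy (hpy.symm ▸ hpe)
    have hgrad := hiso.jacobian_mulVec_grad hyU (contDiffOn_chartFun he hRH.smooth_f)
      fun z hz => chartFun_transition f hz
    have hric := hiso.jacobian_mul_ricEnd hyU
    simp only [hpy] at hgrad hric
    -- The Jacobian intertwines the Ricci endomorphisms and maps gradient to gradient, so the same
    -- `μ` works in every chart.
    rw [← hgrad, Matrix.mulVec_mulVec, ← hric, ← Matrix.mulVec_mulVec, hμ, Matrix.mulVec_smul]
  · rw [← pd_eq_zero_iff, ← (isMetricOn_chartMetric (g := g) he).mulVec_grad (e.map_source hpe),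
      h0, Matrix.mulVec_zero]

end Eigenvalue


end

end RicciHessian

theorem proposition1p3 {n : ℕ} (hn : 3 ≤ n) {M : Type*} [TopologicalSpace M] [T2Space M]
    [SecondCountableTopology M] [ChartedSpace (EuclideanSpace ℝ (Fin n)) M]
    [IsManifold (𝓡 n) ∞ M]
    (g : Bundle.ContMDiffRiemannianMetric (𝓡 n) ∞ (EuclideanSpace ℝ (Fin n))
      (fun x : M => TangentSpace (𝓡 n) x))
    (m : ℕ) (f φ lam : M → ℝ)
    (hRH : RicciHessian.IsRicciHessianType g m f φ lam)
    (hW : RicciHessian.HasHarmonicWeyl g) :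
    (∀ e ∈ IsManifold.maximalAtlas (𝓡 n) ∞ M, ∀ y ∈ e.target, ∀ i j,
      RicciHessian.wedge
          (fun k => RicciHessian.mainForm (RicciHessian.chartMetric g e) m
            (RicciHessian.chartFun f e) (RicciHessian.chartFun φ e) k y)
          (fun k => RicciHessian.pd k (RicciHessian.chartFun f e) y) i j
        = ((n : ℝ) - 1) * RicciHessian.chartFun f e y *
          RicciHessian.curvForm (RicciHessian.chartMetric g e)
            (RicciHessian.grad (RicciHessian.chartMetric g e) (RicciHessian.chartFun φ e) y)
            (RicciHessian.grad (RicciHessian.chartMetric g e) (RicciHessian.chartFun f e) y)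
            i j y) ∧
    (RicciHessian.GradNormalOnLevels n f φ →
      ∀ p : M, mfderiv (𝓡 n) 𝓘(ℝ, ℝ) f p ≠ 0 →
        ∃ μ : ℝ, ∀ e ∈ IsManifold.maximalAtlas (𝓡 n) ∞ M, p ∈ e.source →
          Module.End.HasEigenvector
            (Matrix.toLin' (RicciHessian.ricEnd (RicciHessian.chartMetric g e) (e p))) μ
            (RicciHessian.grad (RicciHessian.chartMetric g e) (RicciHessian.chartFun f e)
              (e p))) := by
  exact ⟨fun e he y hy i j => RicciHessian.wedge_mainForm_eq hn hRH hW he hy i j,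
    fun hnormal p hp => RicciHessian.exists_hasEigenvector_grad hn hRH hW hnormal hp⟩
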